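/- **Setting.** Let $\Lambda$ be a countable $k$-graph: a countable small category with object set $\Lambda^0$, range and source maps $r,s$, and a degree functor $d:\Lambda\to\mathbb N^k$ with the unique factorisation property (if $d(\lambda)=m+n$ then $\lambda=\mu\nu$ for unique $\mu,\nu$ with $d(\mu)=m$, $d(\nu)=n$). Write $v\Lambda^m=\{\lambda: r(\lambda)=v,\ d(\lambda)=m\}$, let $e_1,\dots,e_k$ be the standard generators of $\mathbb N^k$, and let $v\Lambda^{\le m}$ be the set of $\lambda$ with $r(\lambda)=v$ and $d(\lambda)\le m$ such that no $\lambda\mu$ with $d(\mu)\neq 0$ has degree $\le m$. Assume that $\Lambda$ is *row-finite* (each $\bigcup_i v\Lambda^{e_i}$ is finite) and *locally convex* (if $i<j$, $\mu\in v\Lambda^{e_i}$ and $\nu\in v\Lambda^{e_j}$, then $s(\mu)\Lambda^{e_j}$ and $s(\nu)\Lambda^{e_i}$ are nonempty). **Algebras.** $\mathcal O_\Lambda$ is the universal C$^*$-algebra generated by $(x_\lambda)_{\lambda\in\Lambda}$ such that the $x_v$, $v\in\Lambda^0$, are mutually orthogonal projections, $x_\lambda^*x_\lambda=x_{s(\lambda)}$,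 $x_\lambda x_\mu=x_{\lambda\mu}$ if $s(\lambda)=r(\mu)$, and $x_v=\sum_{\lambda\in v\Lambda^{e_i}}x_\lambda x_\lambda^*$ whenever $v\Lambda^{e_i}\ne\emptyset$. $\mathcal P_\Lambda$ is the universal C$^*$-algebra generated by $(a_\lambda)_{\lambda\in\Lambda}$ such that the $a_v$ are mutually orthogonal projections, $a_\mu a_\lambda=a_{\lambda\mu}$ if $s(\lambda)=r(\mu)$, and $\sum_{\lambda\in v\Lambda^{\le m}}a_\lambda^*a_\lambda=a_v$ for all $v\in\Lambda^0$, $m\in\mathbb N^k$. $\mathcal A_\Lambda\subset\mathcal P_\Lambda$ is the norm-closed (non-self-adjoint) subalgebra generated by the $a_\lambda$. **Modules and representations.** A *representation* of $\mathcal O_\Lambda$ is a $*$-homomorphism $\pi:\mathcal O_\Lambda\to B(L)$, $L$ a Hilbert space, with $\sum_v\pi(x_v)=1$ strongly; put $X_\lambda=\pi(x_\lambda)$. An *$\mathcal A_\Lambda$-module* is a continuous algebra homomorphism $\pi:\mathcal A_\Lambda\to B(H)$, $H$ a Hilbert space, such that, with $A_\lambda=\pi(a_\lambda)$, each $A_v$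 is an orthogonal projection, $\sum_{\lambda\in v\Lambda^{e_i}}A_\lambda^*A_\lambda=A_v$ whenever $v\Lambda^{e_i}\neq\emptyset$, and $\sum_vA_v=1$ weakly; put $H_v=A_vH$. Isomorphisms are bounded invertible intertwiners; submodules are closed invariant subspaces; *irreducible* means nonzero with no closed invariant subspaces other than $0$ and the whole space. The *(usual) dimension vector* of $H$ is $(\dim H_v)_{v\in\Lambda^0}$. **The map $\Pi$.** For an $\mathcal A_\Lambda$-module $H$, $\Pi(H)$ is the Hilbert space obtained by separation and completion from the formal span of the symbols $[\lambda,\xi]$, linear in $\xi\in H_{s(\lambda)}$, $\lambda\in\Lambda$, with $$\langle[\lambda,\xi],[\mu,\eta]\rangle=\sum\langle A_\nu\xi,A_\gamma\eta\rangle ,$$ the sum being over all pairs $(\nu,\gamma)$ with $\lambda\nu=\mu\gamma\in r(\lambda)\Lambda^{\le d(\lambda)+d(\mu)}$. The representation of $\mathcal O_\Lambda$ is given by $X_\mu[\lambda,\xi]=[\mu\lambda,\xi]$ if $s(\mu)=r(\lambda)$, and $X_\mu[\lambda,\xi]=0$ otherwise. **The map $\Sigma$.** The *trees at $v$* are the sets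 of paths obtained from $\{v\}$ by finitely many steps replacing an element $\mu$ of a tree $t$ by the set $\mu\,(s(\mu)\Lambda^{\le e_i})$ for some $i$. A submodule $H'\subset H$ is *complete* if for all $\varepsilon>0$, $v\in\Lambda^0$, $\xi\in H_v$ there are a tree $t$ at $v$ and vectors $\eta_\mu\in H'$ $(\mu\in t)$ with $\sum_{\mu\in t}\|A_\mu\xi-\eta_\mu\|^2<\varepsilon^2$. A representation $L$ of $\mathcal O_\Lambda$ is an $\mathcal A_\Lambda$-module via $a_\lambda\mapsto X_\lambda^*$; let $\Sigma(L)$ be the intersection of all its complete submodules, regarded as an $\mathcal A_\Lambda$-module. The representation $L$ has *finite Pythagorean dimension* if $L\cong\Pi(K)$ for some finite-dimensional $\mathcal A_\Lambda$-module $K$; its *Pythagorean dimension vector* is then the usual dimension vector of $\Sigma(L)$. **Statement.** Let $\delta:\Lambda^0\to\mathbb N$ be finitely supported. 1. If $L$ is an irreducible representation of $\mathcal O_\Lambda$ of finite Pythagorean dimension with Pythagorean dimension vector $\delta$, then $\Sigma(L)$ is a complete submodule of $L$, hence its smallest complete submodule. 2. If $H$ is an irreducible $\mathcal A_\Lambda$-module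 with usual dimension vector $\delta$, then $\Pi(H)$ is an irreducible representation of $\mathcal O_\Lambda$ of finite Pythagorean dimension with Pythagorean dimension vector $\delta$. If $L$ is as in 1, then $\Sigma(L)$ is an irreducible $\mathcal A_\Lambda$-module with usual dimension vector $\delta$. 3. The assignments $[H]\mapsto[\Pi(H)]$ and $[L]\mapsto[\Sigma(L)]$ are well defined and mutually inverse bijections between the isomorphism classes of irreducible $\mathcal A_\Lambda$-modules with usual dimension vector $\delta$ and the isomorphism classes of irreducible representations of $\mathcal O_\Lambda$ with Pythagorean dimension vector $\delta$. -/

import Mathlib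

open CategoryTheory

universe u

noncomputable section

/-- A path of a small category: an arrow together with its source and its range. -/
structure KPath (V : Type u) [SmallCategory V] : Type u where
  src : V
  rng : V
  hom : src ⟶ rng

namespace KPath

variable {V : Type u} [SmallCategory V]

/-- The identity arrow of a vertex; this is how a vertex is regarded as a path. -/
def id (v : V) : KPath V := ⟨v, v, 𝟙 v⟩

open Classical in
/-- `p * q` is the composition `p ∘ q` when `s(p) = r(q)`; otherwise it is a junk value that is
never used. -/
instance : Mul (KPath V) :=
  ⟨fun p q => if h : q.rng = p.src then ⟨q.src, p.rng, q.hom ≫ eqToHom h ≫ p.hom⟩ else p⟩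

theorem mk_mul_mk {a b c : V} (f : a ⟶ b) (g : b ⟶ c) :
    (⟨b, c, g⟩ * ⟨a, b, f⟩ : KPath V) = ⟨a, c, f ≫ g⟩ := by
  refine (dif_pos rfl).trans ?_
  simp

@[simp] theorem id_src (v : V) : (id v).src = v := rfl
@[simp] theorem id_rng (v : V) : (id v).rng = v := rfl

theorem src_mul {p q : KPath V} (h : p.src = q.rng) : (p * q).src = q.src := by
  rcases p with ⟨a, b, f⟩; rcases q with ⟨c, d, g⟩
  obtain rfl : a = d := h
  rw [mk_mul_mk]

theorem rng_mul {p q : KPath V} (h : p.src = q.rng) : (p * q).rng = p.rng := by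
  rcases p with ⟨a, b, f⟩; rcases q with ⟨c, d, g⟩
  obtain rfl : a = d := h
  rw [mk_mul_mk]

theorem assoc {p q r : KPath V} (h : p.src = q.rng) (h' : q.src = r.rng) :
    p * q * r = p * (q * r) := by
  rcases p with ⟨a, b, f⟩; rcases q with ⟨c, d, g⟩; rcases r with ⟨x, y, e⟩
  obtain rfl : a = d := h
  obtain rfl : c = y := h'
  simp only [mk_mul_mk, Category.assoc]

theorem id_mul {p : KPath V} {v : V} (h : v = p.rng) : id v * p = p := by
  rcases p with ⟨a, b, f⟩
  obtain rfl : v = b := h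
  simp [id, mk_mul_mk]

theorem mul_id {p : KPath V} {v : V} (h : p.src = v) : p * id v = p := by
  rcases p with ⟨a, b, f⟩
  obtain rfl : a = v := h
  simp [id, mk_mul_mk]

end KPath

/-- A `k`-graph: a countable category `Λ` with a degree functor to `ℕ^k` that has the
factorisation property. The vertices are the objects, and the arrow `f : v ⟶ w` is a path with
source `v` and range `w`. -/
structure KGraph (k : ℕ) (V : Type u) [SmallCategory V] : Type u where
  deg : ∀ {v w : V}, (v ⟶ w) → (Fin k → ℕ)
  deg_id : ∀ v : V, deg (𝟙 v) = 0
  deg_comp : ∀ {u v w : V} (f : u ⟶ v) (g : v ⟶ w), deg (f ≫ g) = deg g + deg f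
  factor : ∀ {v w : V} (f : v ⟶ w) (m n : Fin k → ℕ), deg f = m + n →
    ∃! q : Σ x : V, (x ⟶ w) × (v ⟶ x), q.2.2 ≫ q.2.1 = f ∧ deg q.2.1 = m ∧ deg q.2.2 = n
  countable : Countable (KPath V)

namespace KGraph

variable {k : ℕ} {V : Type u} [SmallCategory V] (Λ : KGraph k V)

/-- The degree of a path. -/
def d (p : KPath V) : Fin k → ℕ := Λ.deg p.hom

/-- The standard basis vector `e_i` of `ℕ^k`. -/
def e (i : Fin k) : Fin k → ℕ := Pi.single i 1

/-- `v Λ^m`, the paths of degree `m` and range `v`. -/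
def pathsTo (v : V) (m : Fin k → ℕ) : Set (KPath V) := {p | p.rng = v ∧ Λ.d p = m}

/-- `v Λ^{≤ m}`, the paths of range `v` whose degree is at most `m` and that cannot be extended to
a strictly longer path of degree at most `m`. -/
def pathsLE (v : V) (m : Fin k → ℕ) : Set (KPath V) :=
  {p | p.rng = v ∧ Λ.d p ≤ m ∧
    ∀ q : KPath V, p.src = q.rng → Λ.d (p * q) ≤ m → Λ.d q = 0}

/-- Every vertex receives finitely many edges. -/
class RowFinite : Prop where
  finite : ∀ v : V, (⋃ i : Fin k, Λ.pathsTo v (e i)).Finite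

/-- Local convexity. -/
class LocallyConvex : Prop where
  nonempty : ∀ (i j : Fin k), i < j → ∀ (v : V), ∀ p ∈ Λ.pathsTo v (e i),
    ∀ q ∈ Λ.pathsTo v (e j),
      (Λ.pathsTo p.src (e j)).Nonempty ∧ (Λ.pathsTo q.src (e i)).Nonempty

variable {Λ}

@[simp] theorem d_id (v : V) : Λ.d (KPath.id v) = 0 := Λ.deg_id v

theorem d_mul {p q : KPath V} (h : p.src = q.rng) : Λ.d (p * q) = Λ.d p + Λ.d q := by
  rcases p with ⟨a, b, f⟩; rcases q with ⟨c, d, g⟩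
  obtain rfl : a = d := h
  rw [KPath.mk_mul_mk]
  exact Λ.deg_comp g f

theorem exists_factor {p : KPath V} {m n : Fin k → ℕ} (h : Λ.d p = m + n) :
    ∃ a b : KPath V, a.src = b.rng ∧ a * b = p ∧ Λ.d a = m ∧ Λ.d b = n := by
  rcases p with ⟨v, w, f⟩
  obtain ⟨⟨x, g, g'⟩, ⟨h1, h2, h3⟩, -⟩ := Λ.factor f m n h
  refine ⟨⟨x, w, g⟩, ⟨v, x, g'⟩, rfl, ?_, h2, h3⟩
  rw [KPath.mk_mul_mk]
  exact congrArg (KPath.mk v w) h1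

theorem factor_unique {a b a' b' : KPath V} (h : a.src = b.rng) (h' : a'.src = b'.rng)
    (hp : a * b = a' * b') (hd : Λ.d a = Λ.d a') : a = a' ∧ b = b' := by
  have hdb : Λ.d b = Λ.d b' := by
    have := congrArg Λ.d hp
    rw [d_mul h, d_mul h', hd] at this
    exact add_left_cancel this
  rcases a with ⟨x, w, f⟩; rcases b with ⟨v, y, g⟩
  rcases a' with ⟨x', w', f'⟩; rcases b' with ⟨v', y', g'⟩
  obtain rfl : x = y := h
  obtain rfl : x' = y' := h'
  rw [KPath.mk_mul_mk, KPath.mk_mul_mk] at hp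
  obtain rfl : v = v' := congrArg KPath.src hp
  obtain rfl : w = w' := congrArg KPath.rng hp
  have hp' : g ≫ f = g' ≫ f' := by simpa using hp
  have := (Λ.factor (g ≫ f) (Λ.deg f) (Λ.deg g) (Λ.deg_comp g f)).unique
    (y₁ := ⟨x, f, g⟩) (y₂ := ⟨x', f', g'⟩) ⟨rfl, rfl, rfl⟩ ⟨hp'.symm, hd.symm, hdb.symm⟩
  cases this
  exact ⟨rfl, rfl⟩

theorem eq_id_of_d_eq_zero {p : KPath V} (h : Λ.d p = 0) : p = KPath.id p.rng := by
  refine (factor_unique (Λ := Λ) (a := p) (b := KPath.id p.src) (a' := KPath.id p.rng) (b' := p)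
    rfl rfl ?_ (by simp [h])).1
  rw [KPath.mul_id rfl, KPath.id_mul rfl]

theorem mul_left_cancel (Λ : KGraph k V) {a b b' : KPath V} (h : a.src = b.rng) (h' : a.src = b'.rng)
    (hp : a * b = a * b') : b = b' :=
  (factor_unique (Λ := Λ) h h' hp rfl).2

theorem e_same (i : Fin k) : e i i = 1 := by simp [e]

theorem e_ne {i j : Fin k} (h : j ≠ i) : e i j = 0 := by simp [e, h]

theorem e_le_iff {i : Fin k} {m : Fin k → ℕ} : e i ≤ m ↔ 1 ≤ m i := by
  constructor
  · intro h
    simpa [e_same] using h i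
  · intro h j
    by_cases hj : j = i
    · subst hj; simpa [e_same] using h
    · simp [e_ne hj]

/-- If some path with range `v` has a positive `i`-th degree then `v Λ^{e_i}` is nonempty. -/
theorem nonempty_of_pos {p : KPath V} {i : Fin k} (h : 1 ≤ Λ.d p i) :
    (Λ.pathsTo p.rng (e i)).Nonempty := by
  obtain ⟨a, b, hab, rfl, ha, -⟩ := exists_factor (Λ := Λ) (p := p) (m := e i)
    (n := Λ.d p - e i) (add_tsub_cancel_of_le (e_le_iff.2 h)).symm
  exact ⟨a, (KPath.rng_mul hab).symm, ha⟩

/-- The usual form of the definition of `v Λ^{≤ m}`. -/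
theorem mem_pathsLE {v : V} {m : Fin k → ℕ} {p : KPath V} :
    p ∈ Λ.pathsLE v m ↔ p.rng = v ∧ Λ.d p ≤ m ∧
      ∀ i, Λ.d p i < m i → ¬ (Λ.pathsTo p.src (e i)).Nonempty := by
  refine and_congr_right fun _ => and_congr_right fun hle => ⟨fun h i hi => ?_, fun h q hq hqm => ?_⟩
  · rintro ⟨q, hq, hqd⟩
    have := h q hq.symm (by
      rw [d_mul hq.symm, hqd]
      intro j
      by_cases hj : j = i
      · subst hj; simpa [e_same] using hi
      · simpa [e_ne hj] using hle j)
    have h1 := congrFun (hqd.symm.trans this) i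
    simp [e_same] at h1
  · by_contra hne
    obtain ⟨i, hi⟩ : ∃ i, Λ.d q i ≠ 0 := by
      by_contra hall
      push Not at hall
      exact hne (funext hall)
    refine h i ?_ (hq ▸ nonempty_of_pos (Nat.one_le_iff_ne_zero.2 hi))
    have this : Λ.d (p * q) i ≤ m i := hqm i
    rw [d_mul hq, Pi.add_apply] at this
    omega

theorem mem_pathsLE_self (p : KPath V) : p ∈ Λ.pathsLE p.rng (Λ.d p) :=
  mem_pathsLE.2 ⟨rfl, le_rfl, fun _ h => absurd h (lt_irrefl _)⟩

theorem pathsLE_zero (v : V) : Λ.pathsLE v 0 = {KPath.id v} := by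
  ext p
  rw [mem_pathsLE, Set.mem_singleton_iff]
  constructor
  · rintro ⟨rfl, h, -⟩
    exact eq_id_of_d_eq_zero (Λ := Λ) (le_antisymm h (fun _ => Nat.zero_le _))
  · rintro rfl
    exact ⟨rfl, by simp, fun i h => by simp at h⟩

/-- `v Λ^{≤ e_i}` is `v Λ^{e_i}` if the latter is nonempty, and `{v}` otherwise. -/
theorem mem_pathsLE_e {v : V} {i : Fin k} {p : KPath V} :
    p ∈ Λ.pathsLE v (e i) ↔
      p ∈ Λ.pathsTo v (e i) ∨ (p = KPath.id v ∧ ¬ (Λ.pathsTo v (e i)).Nonempty) := by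
  rw [mem_pathsLE]
  constructor
  · rintro ⟨rfl, hle, h⟩
    by_cases hi : Λ.d p i = 0
    · have h0 : Λ.d p = 0 := by
        funext j
        by_cases hj : j = i
        · subst hj; exact hi
        · have := hle j
          rw [e_ne hj] at this
          simpa using this
      have hp := eq_id_of_d_eq_zero h0
      refine Or.inr ⟨hp, ?_⟩
      have := h i (by rw [hi, e_same]; exact one_pos)
      rw [hp] at this
      exact this
    · refine Or.inl ⟨rfl, le_antisymm hle (e_le_iff.2 (Nat.one_le_iff_ne_zero.2 hi))⟩
  · rintro (⟨rfl, h⟩ | ⟨rfl, h⟩)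
    · exact ⟨rfl, h.le, fun j hj => absurd hj (by rw [h]; exact lt_irrefl _)⟩
    · refine ⟨rfl, by simp, fun j hj => ?_⟩
      have : j = i := by
        by_contra hne
        simp [e_ne hne] at hj
      subst this
      exact h

theorem exists_edge [h : Λ.LocallyConvex] {i j : Fin k} (hij : j ≠ i) {v : V} {p : KPath V}
    (hp : p ∈ Λ.pathsTo v (e i)) (hv : (Λ.pathsTo v (e j)).Nonempty) :
    (Λ.pathsTo p.src (e j)).Nonempty := by
  obtain ⟨q, hq⟩ := hv
  rcases lt_or_gt_of_ne hij with hlt | hlt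
  · exact (h.nonempty j i hlt v q hq p hp).2
  · exact (h.nonempty i j hlt v p hp q hq).1

/-- Induction on `ℕ^k` by adding basis vectors. -/
theorem degree_induction {P : (Fin k → ℕ) → Prop} (h0 : P 0)
    (hs : ∀ m i, P m → P (m + e i)) (m : Fin k → ℕ) : P m := by
  induction hn : ∑ i, m i generalizing m with
  | zero =>
    have : m = 0 := by
      funext i
      exact (Finset.sum_eq_zero_iff.1 hn) i (Finset.mem_univ _)
    exact this ▸ h0
  | succ n ih =>
    obtain ⟨i, hi⟩ : ∃ i, 1 ≤ m i := by
      by_contra hall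
      push Not at hall
      have : ∑ i, m i = 0 := Finset.sum_eq_zero fun i _ => by have := hall i; omega
      omega
    have hm : m - e i + e i = m := tsub_add_cancel_of_le (e_le_iff.2 hi)
    rw [← hm]
    refine hs _ _ (ih _ ?_)
    have h1 : ∑ j, m j = ∑ j, (m - e i) j + ∑ j, (e i) j := by
      rw [← Finset.sum_add_distrib]
      exact Finset.sum_congr rfl fun j _ => (congrFun hm j).symm
    have h2 : ∑ j, (e i : Fin k → ℕ) j = 1 := by simp [e]
    omega

theorem exists_edge_of_path [Λ.LocallyConvex] {i : Fin k} (p : KPath V)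
    (hpi : Λ.d p i = 0) (hv : (Λ.pathsTo p.rng (e i)).Nonempty) :
    (Λ.pathsTo p.src (e i)).Nonempty := by
  obtain ⟨m, hm⟩ : ∃ m, Λ.d p = m := ⟨_, rfl⟩
  induction m using degree_induction generalizing p with
  | h0 =>
    have := eq_id_of_d_eq_zero hm
    rw [this] at hv ⊢
    exact hv
  | hs m j ih =>
    obtain ⟨a, b, hab, rfl, ha, hb⟩ := exists_factor hm
    have hji : i ≠ j := by
      rintro rfl
      rw [hm] at hpi
      simp [e_same] at hpi
    rw [KPath.rng_mul hab] at hv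
    rw [KPath.src_mul hab]
    have h1 := ih a (by rw [ha]; rw [hm] at hpi; simp at hpi; exact hpi.1) hv ha
    exact exists_edge hji (p := b) (v := a.src) ⟨hab.symm, hb⟩ h1

/-- `Λ^{≤ m} Λ^{≤ e_i} ⊆ Λ^{≤ m + e_i}`. -/
theorem mul_mem_pathsLE {v : V} {m : Fin k → ℕ} {i : Fin k} {p q : KPath V}
    (hp : p ∈ Λ.pathsLE v m) (hq : q ∈ Λ.pathsLE p.src (e i)) : p * q ∈ Λ.pathsLE v (m + e i) := by
  rw [mem_pathsLE] at hp
  obtain ⟨rfl, hle, hmax⟩ := hp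
  have hpq : p.src = q.rng := by
    rw [mem_pathsLE] at hq; exact hq.1.symm
  rw [mem_pathsLE, KPath.rng_mul hpq, KPath.src_mul hpq, d_mul hpq]
  rcases mem_pathsLE_e.1 hq with ⟨-, hqd⟩ | ⟨rfl, hne⟩
  · rw [hqd]
    refine ⟨rfl, add_le_add_left hle _, fun j hj hN => ?_⟩
    have hj' : Λ.d p j < m j := by simpa using hj
    obtain ⟨f, hf, hfd⟩ := hN
    have h1 : 1 ≤ Λ.d (q * f) j := by
      rw [d_mul hf.symm, hfd]; simp [e_same]
    have h2 := nonempty_of_pos h1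
    rw [KPath.rng_mul hf.symm, ← hpq] at h2
    exact hmax j hj' h2
  · refine ⟨rfl, by simpa using hle.trans (le_add_of_nonneg_right (fun _ => Nat.zero_le _)),
      fun j hj => ?_⟩
    by_cases hji : j = i
    · subst hji; exact hne
    · exact hmax j (by simpa [e_ne hji] using hj)

theorem mul_mem_pathsLE_iff {μ s : KPath V} (h : μ.src = s.rng) {m : Fin k → ℕ} :
    μ * s ∈ Λ.pathsLE μ.rng (Λ.d μ + m) ↔ s ∈ Λ.pathsLE μ.src m := by
  rw [mem_pathsLE, mem_pathsLE, KPath.rng_mul h, KPath.src_mul h, d_mul h]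
  simp [h]

/-- `Λ^{≤ m + e_i} ⊆ Λ^{≤ m} Λ^{≤ e_i}`; here local convexity is used. -/
theorem exists_mul_of_mem_pathsLE [Λ.LocallyConvex] {v : V} {m : Fin k → ℕ} {i : Fin k}
    {r : KPath V} (hr : r ∈ Λ.pathsLE v (m + e i)) :
    ∃ p q : KPath V, p ∈ Λ.pathsLE v m ∧ q ∈ Λ.pathsLE p.src (e i) ∧ p * q = r := by
  rw [mem_pathsLE] at hr
  obtain ⟨rfl, hle, hmax⟩ := hr
  by_cases hi : Λ.d r i ≤ m i
  · have hN : ¬ (Λ.pathsTo r.src (e i)).Nonempty :=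
      hmax i (by simp [e_same]; omega)
    refine ⟨r, KPath.id r.src, mem_pathsLE.2 ⟨rfl, fun j => ?_, fun j hj => hmax j ?_⟩,
      mem_pathsLE_e.2 (Or.inr ⟨rfl, hN⟩), KPath.mul_id rfl⟩
    · by_cases hji : j = i
      · subst hji; exact hi
      · simpa [e_ne hji] using hle j
    · simp only [Pi.add_apply]; omega
  · have hi' : Λ.d r i = m i + 1 := by
      have := hle i
      simp [e_same] at this
      omega
    have hei : e i ≤ Λ.d r := e_le_iff.2 (by omega)
    obtain ⟨p, q, hpq, rfl, hp, hq⟩ := exists_factor (Λ := Λ) (p := r) (m := Λ.d r - e i)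
      (n := e i) (tsub_add_cancel_of_le hei).symm
    rw [d_mul hpq, hq] at hle hmax hi'
    rw [KPath.rng_mul hpq]
    rw [KPath.src_mul hpq] at hmax
    refine ⟨p, q, mem_pathsLE.2 ⟨rfl, fun j => ?_, fun j hj hN => ?_⟩,
      mem_pathsLE_e.2 (Or.inl ⟨hpq.symm, hq⟩), rfl⟩
    · have := hle j
      simpa using this
    · have hji : j ≠ i := by
        rintro rfl
        simp [e_same] at hi'
        omega
      exact hmax j (by simpa using hj) (exists_edge hji ⟨hpq.symm, hq⟩ hN)

/-- The factorisation of an element of `Λ^{≤ m + e_i}` is unique. -/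
theorem mul_unique_of_mem_pathsLE {v v' : V} {m : Fin k → ℕ} {i : Fin k} {p q p' q' : KPath V}
    (hp : p ∈ Λ.pathsLE v m) (hq : q ∈ Λ.pathsLE p.src (e i))
    (hp' : p' ∈ Λ.pathsLE v' m) (hq' : q' ∈ Λ.pathsLE p'.src (e i))
    (h : p * q = p' * q') : p = p' ∧ q = q' := by
  have hpq : p.src = q.rng := (mem_pathsLE.1 hq).1.symm
  have hpq' : p'.src = q'.rng := (mem_pathsLE.1 hq').1.symm
  refine factor_unique (Λ := Λ) hpq hpq' h ?_
  have hd := congrArg Λ.d h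
  rw [d_mul hpq, d_mul hpq'] at hd
  have aux : ∀ {p q : KPath V} {v : V}, p ∈ Λ.pathsLE v m → q ∈ Λ.pathsTo p.src (e i) →
      Λ.d p i = m i := by
    intro p q v hp hq
    rw [mem_pathsLE] at hp
    by_contra hne
    exact hp.2.2 i (lt_of_le_of_ne (hp.2.1 i) hne) ⟨q, hq⟩
  rcases mem_pathsLE_e.1 hq with h1 | ⟨h1, hN⟩ <;> rcases mem_pathsLE_e.1 hq' with h2 | ⟨h2, hN'⟩
  · rw [h1.2, h2.2] at hd
    exact add_right_cancel hd
  · exfalso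
    have := congrFun hd i
    rw [h1.2, h2] at this
    simp [e_same, aux hp h1] at this
    have h3 : Λ.d p' i ≤ m i := (mem_pathsLE.1 hp').2.1 i
    omega
  · exfalso
    have := congrFun hd i
    rw [h2.2, h1] at this
    simp [e_same, aux hp' h2] at this
    have h3 : Λ.d p i ≤ m i := (mem_pathsLE.1 hp).2.1 i
    omega
  · rw [h1, h2] at hd
    simpa using hd

theorem finite_pathsTo_e [h : Λ.RowFinite] (v : V) (i : Fin k) : (Λ.pathsTo v (e i)).Finite :=
  (h.finite v).subset (Set.subset_iUnion (fun i => Λ.pathsTo v (e i)) i)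

theorem finite_pathsLE_e [Λ.RowFinite] (v : V) (i : Fin k) : (Λ.pathsLE v (e i)).Finite := by
  refine ((finite_pathsTo_e (Λ := Λ) v i).union (Set.finite_singleton (KPath.id v))).subset ?_
  intro p hp
  rcases mem_pathsLE_e.1 hp with h | h
  · exact Or.inl h
  · exact Or.inr h.1

theorem finite_pathsLE [Λ.RowFinite] [Λ.LocallyConvex] (v : V) (m : Fin k → ℕ) :
    (Λ.pathsLE v m).Finite := by
  induction m using degree_induction with
  | h0 => rw [pathsLE_zero]; exact Set.finite_singleton _
  | hs m i ih =>
    refine (ih.biUnion fun p _ => (finite_pathsLE_e (Λ := Λ) p.src i).image (p * ·)).subset ?_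
    intro r hr
    obtain ⟨p, q, hp, hq, rfl⟩ := exists_mul_of_mem_pathsLE hr
    exact Set.mem_biUnion hp ⟨q, hq, rfl⟩

variable (Λ)

/-- `v Λ^{e_i}` as a finite set. -/
def edges [Λ.RowFinite] (v : V) (i : Fin k) : Finset (KPath V) :=
  (finite_pathsTo_e (Λ := Λ) v i).toFinset

/-- `v Λ^{≤ m}` as a finite set. -/
def lePaths [Λ.RowFinite] [Λ.LocallyConvex] (v : V) (m : Fin k → ℕ) : Finset (KPath V) :=
  (finite_pathsLE (Λ := Λ) v m).toFinset

variable {Λ}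

@[simp] theorem mem_edges [Λ.RowFinite] {v : V} {i : Fin k} {p : KPath V} :
    p ∈ Λ.edges v i ↔ p.rng = v ∧ Λ.d p = e i := by
  simp [edges, pathsTo]

@[simp] theorem mem_lePaths [Λ.RowFinite] [Λ.LocallyConvex] {v : V} {m : Fin k → ℕ} {p : KPath V} :
    p ∈ Λ.lePaths v m ↔ p ∈ Λ.pathsLE v m := by
  simp [lePaths]

theorem edges_nonempty [Λ.RowFinite] {v : V} {i : Fin k} :
    (Λ.edges v i).Nonempty ↔ (Λ.pathsTo v (e i)).Nonempty := by
  simp [edges]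

section
variable [Λ.RowFinite] [Λ.LocallyConvex]

theorem lePaths_zero (v : V) : Λ.lePaths v 0 = {KPath.id v} := by
  ext p; simp [pathsLE_zero]

theorem lePaths_e_of_nonempty {v : V} {i : Fin k} (h : (Λ.edges v i).Nonempty) :
    Λ.lePaths v (e i) = Λ.edges v i := by
  ext p
  rw [mem_lePaths, mem_pathsLE_e, mem_edges]
  rw [edges_nonempty] at h
  exact ⟨fun h1 => h1.resolve_right fun h2 => h2.2 h, Or.inl⟩

theorem lePaths_e_of_empty {v : V} {i : Fin k} (h : ¬ (Λ.edges v i).Nonempty) :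
    Λ.lePaths v (e i) = {KPath.id v} := by
  ext p
  rw [mem_lePaths, mem_pathsLE_e, Finset.mem_singleton]
  rw [edges_nonempty] at h
  constructor
  · rintro (h1 | h1)
    · exact absurd ⟨p, h1⟩ h
    · exact h1.1
  · exact fun h1 => Or.inr ⟨h1, h⟩

theorem sum_lePaths_add {M : Type*} [AddCommMonoid M] (v : V) (m : Fin k → ℕ) (i : Fin k)
    (g : KPath V → M) :
    ∑ r ∈ Λ.lePaths v (m + e i), g r =
      ∑ p ∈ Λ.lePaths v m, ∑ q ∈ Λ.lePaths p.src (e i), g (p * q) := by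
  rw [Finset.sum_sigma']
  symm
  refine Finset.sum_bij (fun x _ => x.1 * x.2) ?_ ?_ ?_ (fun _ _ => rfl)
  · rintro ⟨p, q⟩ h
    simp only [Finset.mem_sigma, mem_lePaths] at h ⊢
    exact mul_mem_pathsLE h.1 h.2
  · rintro ⟨p, q⟩ h ⟨p', q'⟩ h' heq
    simp only [Finset.mem_sigma, mem_lePaths] at h h'
    obtain ⟨rfl, rfl⟩ := mul_unique_of_mem_pathsLE h.1 h.2 h'.1 h'.2 heq
    rfl
  · intro r hr
    rw [mem_lePaths] at hr
    obtain ⟨p, q, hp, hq, rfl⟩ := exists_mul_of_mem_pathsLE hr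
    exact ⟨⟨p, q⟩, by simp [hp, hq], rfl⟩

end

end KGraph

/-! ### Universal C*-algebras -/

section Universal

open scoped ENNReal

/-- A type of relations imposed on families of bounded operators indexed by `ι`. -/
abbrev OpRelations (ι : Type u) : Type (u + 1) :=
  ∀ (H : Type u) [NormedAddCommGroup H] [InnerProductSpace ℂ H] [CompleteSpace H],
    (ι → H →L[ℂ] H) → Prop

/-- A Hilbert space with a family of bounded operators that satisfies the relations `R`. -/
structure OpFamily {ι : Type u} (R : OpRelations ι) : Type (u + 1) where
  H : Type u
  [nacg : NormedAddCommGroup H]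
  [ips : InnerProductSpace ℂ H]
  [complete : CompleteSpace H]
  op : ι → H →L[ℂ] H
  rel : R H op

attribute [instance] OpFamily.nacg OpFamily.ips OpFamily.complete

/-- The C*-algebra of bounded families `(T_F)`, where `F` runs through all families of operators
that satisfy the relations `R` and `T_F` is a bounded operator on the Hilbert space of `F`. -/
def OpProduct {ι : Type u} (R : OpRelations ι) : Type (u + 1) :=
  lp (fun F : OpFamily R => F.H →L[ℂ] F.H) ∞

variable {ι : Type u} {R : OpRelations ι}

instance : NonUnitalCStarAlgebra (OpProduct R) :=
  inferInstanceAs (NonUnitalCStarAlgebra (lp (fun F : OpFamily R => F.H →L[ℂ] F.H) ∞))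

/-- The `i`-th generator of the universal C*-algebra. -/
def opGen (hR : ∀ (F : OpFamily R) (i : ι), ‖F.op i‖ ≤ 1) (i : ι) : OpProduct R :=
  (⟨fun F => F.op i, memℓp_infty ⟨1, by rintro _ ⟨F, rfl⟩; exact hR F i⟩⟩ :
    lp (fun F : OpFamily R => F.H →L[ℂ] F.H) ∞)

/-- The closed *-subalgebra that is generated by the tautological generators. -/
def opSubalgebra (hR : ∀ (F : OpFamily R) (i : ι), ‖F.op i‖ ≤ 1) :
    NonUnitalStarSubalgebra ℂ (OpProduct R) :=
  (NonUnitalStarAlgebra.adjoin ℂ (Set.range (opGen hR))).topologicalClosure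

/-- The universal C*-algebra with generators indexed by `ι` and relations `R` (relations that force
the generators to be contractions): the C*-algebra generated, inside the product of `B(H)` over
all families satisfying `R`, by the tautological generators. -/
def UniversalCStar (hR : ∀ (F : OpFamily R) (i : ι), ‖F.op i‖ ≤ 1) : Type (u + 1) :=
  opSubalgebra hR

instance (hR : ∀ (F : OpFamily R) (i : ι), ‖F.op i‖ ≤ 1) :
    NonUnitalCStarAlgebra (UniversalCStar hR) :=
  haveI : IsClosed (opSubalgebra hR : Set (OpProduct R)) :=
    NonUnitalStarSubalgebra.isClosed_topologicalClosure _
  inferInstanceAs (NonUnitalCStarAlgebra (opSubalgebra hR))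

namespace UniversalCStar

variable (hR : ∀ (F : OpFamily R) (i : ι), ‖F.op i‖ ≤ 1)

/-- The generators, as elements of the universal C*-algebra. -/
def gen (i : ι) : UniversalCStar hR :=
  ⟨opGen hR i, NonUnitalStarSubalgebra.le_topologicalClosure _
    (NonUnitalStarAlgebra.subset_adjoin ℂ _ ⟨i, rfl⟩)⟩

/-- The representation of the universal C*-algebra determined by a family of operators that
satisfies the relations. -/
def lift (F : OpFamily R) : UniversalCStar hR →⋆ₙₐ[ℂ] (F.H →L[ℂ] F.H) where
  toFun a := a.1.1 F
  map_smul' _ _ := rfl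
  map_zero' := rfl
  map_add' _ _ := rfl
  map_mul' _ _ := rfl
  map_star' _ := rfl

@[simp] theorem lift_gen (F : OpFamily R) (i : ι) : lift hR F (gen hR i) = F.op i := rfl

theorem lift_continuous (F : OpFamily R) : Continuous (lift hR F) := by
  have h : ∀ a : UniversalCStar hR, ‖lift hR F a‖ ≤ 1 * ‖a‖ := fun a => by
    rw [one_mul]
    exact lp.norm_apply_le_norm (E := fun F : OpFamily R => F.H →L[ℂ] F.H)
      ENNReal.top_ne_zero a.1 F
  exact AddMonoidHomClass.continuous_of_bound (lift hR F) 1 h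

theorem ext_lift {a b : UniversalCStar hR} (h : ∀ F : OpFamily R, lift hR F a = lift hR F b) :
    a = b :=
  Subtype.ext (Subtype.ext (funext h))

end UniversalCStar

end Universal

/-! ### The algebras of a `k`-graph -/

namespace KGraph

variable {k : ℕ} {V : Type u} [SmallCategory V] (Λ : KGraph k V) [Λ.RowFinite]

/-- The relations of the higher-rank graph C*-algebra. -/
structure IsCKFamily {B : Type*} [NonUnitalRing B] [StarRing B] (x : KPath V → B) : Prop where
  proj : ∀ v : V, IsStarProjection (x (KPath.id v))
  orth : ∀ v w : V, v ≠ w → x (KPath.id v) * x (KPath.id w) = 0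
  isom : ∀ p : KPath V, star (x p) * x p = x (KPath.id p.src)
  sum : ∀ (v : V) (i : Fin k), (Λ.edges v i).Nonempty →
    x (KPath.id v) = ∑ p ∈ Λ.edges v i, x p * star (x p)
  mul : ∀ p q : KPath V, p.src = q.rng → x p * x q = x (p * q)

/-- The relations of the Pythagorean algebra. -/
structure IsPyFamily [Λ.LocallyConvex] {B : Type*} [NonUnitalRing B] [StarRing B]
    (a : KPath V → B) : Prop where
  proj : ∀ v : V, IsStarProjection (a (KPath.id v))
  orth : ∀ v w : V, v ≠ w → a (KPath.id v) * a (KPath.id w) = 0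
  sum : ∀ (v : V) (m : Fin k → ℕ), ∑ p ∈ Λ.lePaths v m, star (a p) * a p = a (KPath.id v)
  mul : ∀ p q : KPath V, p.src = q.rng → a q * a p = a (p * q)

variable {Λ}

section Relations

variable {B : Type*} [NonUnitalRing B] [StarRing B]

/-- The relation for all `v Λ^{≤ m}` follows from the one for edges. -/
theorem sum_lePaths_of_edges [Λ.LocallyConvex] {a : KPath V → B}
    (proj : ∀ v : V, IsStarProjection (a (KPath.id v)))
    (sum : ∀ (v : V) (i : Fin k), (Λ.edges v i).Nonempty →
      ∑ p ∈ Λ.edges v i, star (a p) * a p = a (KPath.id v))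
    (mul : ∀ p q : KPath V, p.src = q.rng → a q * a p = a (p * q)) (v : V) (m : Fin k → ℕ) :
    ∑ p ∈ Λ.lePaths v m, star (a p) * a p = a (KPath.id v) := by
  have base : ∀ v, star (a (KPath.id v)) * a (KPath.id v) = a (KPath.id v) := fun v => by
    rw [(proj v).isSelfAdjoint.star_eq, (proj v).isIdempotentElem.eq]
  have edge : ∀ (v : V) (i : Fin k),
      ∑ p ∈ Λ.lePaths v (e i), star (a p) * a p = a (KPath.id v) := fun v i => by
    by_cases h : (Λ.edges v i).Nonempty
    · rw [lePaths_e_of_nonempty h, sum v i h]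
    · rw [lePaths_e_of_empty h, Finset.sum_singleton, base]
  induction m using degree_induction with
  | h0 => rw [lePaths_zero, Finset.sum_singleton, base]
  | hs m i ih =>
    rw [sum_lePaths_add, ← ih]
    refine Finset.sum_congr rfl fun p _ => ?_
    calc ∑ q ∈ Λ.lePaths p.src (e i), star (a (p * q)) * a (p * q)
        = ∑ q ∈ Λ.lePaths p.src (e i), star (a p) * (star (a q) * a q) * a p := by
          refine Finset.sum_congr rfl fun q hq => ?_
          have h : p.src = q.rng := by
            rw [mem_lePaths, mem_pathsLE] at hq; exact hq.1.symm
          rw [← mul p q h, star_mul]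
          simp only [mul_assoc]
      _ = star (a p) * a p := by
          rw [← Finset.sum_mul, ← Finset.mul_sum, edge, mul_assoc, mul p _ rfl, KPath.mul_id rfl]

theorem IsCKFamily.star_isPyFamily [Λ.LocallyConvex] {x : KPath V → B} (h : Λ.IsCKFamily x) :
    Λ.IsPyFamily fun p => star (x p) where
  proj v := by
    rw [(h.proj v).isSelfAdjoint.star_eq]; exact h.proj v
  orth v w hvw := by
    rw [← star_mul, h.orth w v hvw.symm, star_zero]
  mul p q hpq := by rw [← star_mul, h.mul p q hpq]
  sum v m := by
    refine sum_lePaths_of_edges (Λ := Λ) (a := fun p => star (x p)) (fun v => ?_) (fun v i hi => ?_)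
      (fun p q hpq => ?_) v m
    · rw [(h.proj v).isSelfAdjoint.star_eq]; exact h.proj v
    · simp only [star_star]
      rw [← h.sum v i hi, (h.proj v).isSelfAdjoint.star_eq]
    · rw [← star_mul, h.mul p q hpq]

end Relations

theorem IsCKFamily.norm_le {H : Type*} [NormedAddCommGroup H] [InnerProductSpace ℂ H]
    [CompleteSpace H] {x : KPath V → H →L[ℂ] H} (h : Λ.IsCKFamily x) (p : KPath V) :
    ‖x p‖ ≤ 1 := by
  have h1 : ‖x p‖ * ‖x p‖ ≤ 1 := by
    rw [← CStarRing.norm_star_mul_self, h.isom]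
    exact (h.proj _).norm_le
  nlinarith [norm_nonneg (x p)]

theorem sum_norm_sq {H : Type*} [NormedAddCommGroup H] [InnerProductSpace ℂ H]
    [CompleteSpace H] {a : KPath V → H →L[ℂ] H} {v : V} {s : Finset (KPath V)}
    (h : ∑ p ∈ s, star (a p) * a p = a (KPath.id v)) (ξ η : H) :
    ∑ p ∈ s, inner ℂ (a p ξ) (a p η) = inner ℂ ξ (a (KPath.id v) η) := by
  rw [← h, sum_apply, inner_sum]
  refine Finset.sum_congr rfl fun p _ => ?_
  rw [mul_apply_eq_comp, ContinuousLinearMap.star_eq_adjoint,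
    ContinuousLinearMap.adjoint_inner_right]

theorem sum_star_mul_self {H : Type*} [NormedAddCommGroup H] [InnerProductSpace ℂ H]
    [CompleteSpace H] {a : KPath V → H →L[ℂ] H} {v : V} {s : Finset (KPath V)}
    (h : ∀ ξ η : H, ∑ p ∈ s, inner ℂ (a p ξ) (a p η) = inner ℂ ξ (a (KPath.id v) η)) :
    ∑ p ∈ s, star (a p) * a p = a (KPath.id v) := by
  ext η
  refine ext_inner_left ℂ fun ξ => ?_
  rw [← h ξ η, sum_apply, inner_sum]
  refine Finset.sum_congr rfl fun p _ => ?_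
  rw [mul_apply_eq_comp, ContinuousLinearMap.star_eq_adjoint,
    ContinuousLinearMap.adjoint_inner_right]

theorem IsPyFamily.norm_le [Λ.LocallyConvex] {H : Type*} [NormedAddCommGroup H]
    [InnerProductSpace ℂ H] [CompleteSpace H] {a : KPath V → H →L[ℂ] H} (h : Λ.IsPyFamily a)
    (p : KPath V) : ‖a p‖ ≤ 1 := by
  refine ContinuousLinearMap.opNorm_le_bound _ zero_le_one fun ξ => ?_
  have h1 := congrArg Complex.re (sum_norm_sq (h.sum p.rng (Λ.d p)) ξ ξ)
  rw [Complex.re_sum] at h1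
  have h2 : ‖a p ξ‖ ^ 2 ≤ ∑ q ∈ Λ.lePaths p.rng (Λ.d p), (inner ℂ (a q ξ) (a q ξ) : ℂ).re := by
    rw [← inner_self_eq_norm_sq (𝕜 := ℂ)]
    refine Finset.single_le_sum (f := fun q => (inner ℂ (a q ξ) (a q ξ) : ℂ).re)
      (fun q _ => inner_self_nonneg (𝕜 := ℂ)) (mem_lePaths.2 (mem_pathsLE_self p))
  have h3 : (inner ℂ ξ (a (KPath.id p.rng) ξ) : ℂ).re ≤ ‖ξ‖ * ‖ξ‖ := by
    refine (Complex.re_le_norm _).trans ((norm_inner_le_norm _ _).trans ?_)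
    refine mul_le_mul_of_nonneg_left ?_ (norm_nonneg _)
    calc ‖a (KPath.id p.rng) ξ‖ ≤ ‖a (KPath.id p.rng)‖ * ‖ξ‖ :=
          ContinuousLinearMap.le_opNorm _ _
      _ ≤ 1 * ‖ξ‖ := mul_le_mul_of_nonneg_right (h.proj _).norm_le (norm_nonneg _)
      _ = ‖ξ‖ := one_mul _
  rw [one_mul]
  rw [h1] at h2
  exact abs_le_of_sq_le_sq' (by nlinarith) (norm_nonneg _) |>.2

variable (Λ)

/-- The relations of the graph C*-algebra, for families of operators. -/
def ckRel : OpRelations (KPath V) := fun _ _ _ _ X => Λ.IsCKFamily X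

/-- The relations of the Pythagorean algebra, for families of operators. -/
def pyRel [Λ.LocallyConvex] : OpRelations (KPath V) := fun _ _ _ _ A => Λ.IsPyFamily A

theorem ckRel_bound (F : OpFamily Λ.ckRel) (p : KPath V) : ‖F.op p‖ ≤ 1 :=
  IsCKFamily.norm_le (Λ := Λ) F.rel p

theorem pyRel_bound [Λ.LocallyConvex] (F : OpFamily Λ.pyRel) (p : KPath V) : ‖F.op p‖ ≤ 1 :=
  IsPyFamily.norm_le (Λ := Λ) F.rel p

/-- The higher-rank graph C*-algebra `O_Λ`. -/
abbrev O := UniversalCStar Λ.ckRel_bound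

/-- The generators `x_λ` of `O_Λ`. -/
def x (p : KPath V) : Λ.O := UniversalCStar.gen Λ.ckRel_bound p

/-- The generators of `O_Λ` satisfy the defining relations. -/
theorem x_isCKFamily : Λ.IsCKFamily Λ.x := by
  have F (F : OpFamily Λ.ckRel) : Λ.IsCKFamily F.op := F.rel
  constructor
  · intro v
    constructor
    · exact UniversalCStar.ext_lift _ fun G => ((F G).proj v).isIdempotentElem
    · exact UniversalCStar.ext_lift _ fun G => ((F G).proj v).isSelfAdjoint
  · exact fun v w h => UniversalCStar.ext_lift _ fun G => (F G).orth v w h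
  · exact fun p => UniversalCStar.ext_lift _ fun G => (F G).isom p
  · intro v i h
    refine UniversalCStar.ext_lift _ fun G => ?_
    rw [map_sum]
    exact (F G).sum v i h
  · exact fun p q h => UniversalCStar.ext_lift _ fun G => (F G).mul p q h

variable [Λ.LocallyConvex]

/-- The Pythagorean C*-algebra `P_Λ`. -/
abbrev P := UniversalCStar Λ.pyRel_bound

/-- The generators `a_λ` of `P_Λ`. -/
def aP (p : KPath V) : Λ.P := UniversalCStar.gen Λ.pyRel_bound p

/-- The non-self-adjoint algebra `A_Λ`: the closed subalgebra of `P_Λ` generated by the `a_λ`,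
without their adjoints. -/
def A : NonUnitalSubalgebra ℂ Λ.P :=
  (NonUnitalAlgebra.adjoin ℂ (Set.range Λ.aP)).topologicalClosure

/-- The generators `a_λ`, as elements of `A_Λ`. -/
def a (p : KPath V) : Λ.A :=
  ⟨Λ.aP p, NonUnitalSubalgebra.le_topologicalClosure _
    (NonUnitalAlgebra.subset_adjoin ℂ ⟨p, rfl⟩)⟩

/-- The generators of `P_Λ` satisfy the defining relations. -/
theorem aP_isPyFamily : Λ.IsPyFamily Λ.aP := by
  have F (F : OpFamily Λ.pyRel) : Λ.IsPyFamily F.op := F.rel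
  constructor
  · intro v
    constructor
    · exact UniversalCStar.ext_lift _ fun G => ((F G).proj v).isIdempotentElem
    · exact UniversalCStar.ext_lift _ fun G => ((F G).proj v).isSelfAdjoint
  · exact fun v w h => UniversalCStar.ext_lift _ fun G => (F G).orth v w h
  · intro v m
    refine UniversalCStar.ext_lift _ fun G => ?_
    rw [map_sum]
    exact (F G).sum v m
  · exact fun p q h => UniversalCStar.ext_lift _ fun G => (F G).mul p q h

theorem a_mul_a {p q : KPath V} (h : p.src = q.rng) : Λ.a q * Λ.a p = Λ.a (p * q) :=
  Subtype.ext (Λ.aP_isPyFamily.mul p q h)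

theorem a_orth {v w : V} (h : v ≠ w) : Λ.a (KPath.id v) * Λ.a (KPath.id w) = 0 :=
  Subtype.ext (Λ.aP_isPyFamily.orth v w h)

end KGraph

/-! ### Modules and representations -/

namespace KGraph

variable {k : ℕ} {V : Type u} [SmallCategory V] (Λ : KGraph k V) [Λ.RowFinite]

/-- A nondegenerate representation of `O_Λ` on a Hilbert space. Nondegeneracy means that the net of
the finite sums of the `x_v` converges strongly to the identity. -/
structure ORep : Type (u + 1) where
  H : Type u
  [nacg : NormedAddCommGroup H]
  [ips : InnerProductSpace ℂ H]
  [complete : CompleteSpace H]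
  π : Λ.O →⋆ₙₐ[ℂ] (H →L[ℂ] H)
  nondeg : ∀ ξ : H, HasSum (fun v : V => π (Λ.x (KPath.id v)) ξ) ξ

attribute [instance] ORep.nacg ORep.ips ORep.complete

/-- A nondegenerate `A_Λ`-module on a Hilbert space. Nondegeneracy means that the net of the finite
sums of the `π(a_v)` converges weakly to the identity. -/
structure AModule [Λ.LocallyConvex] : Type (u + 1) where
  H : Type u
  [nacg : NormedAddCommGroup H]
  [ips : InnerProductSpace ℂ H]
  [complete : CompleteSpace H]
  π : Λ.A →ₙₐ[ℂ] (H →L[ℂ] H)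
  cont : Continuous π
  proj : ∀ v : V, IsStarProjection (π (Λ.a (KPath.id v)))
  sum : ∀ (v : V) (i : Fin k), (Λ.edges v i).Nonempty →
    ∑ p ∈ Λ.edges v i, star (π (Λ.a p)) * π (Λ.a p) = π (Λ.a (KPath.id v))
  nondeg : ∀ ξ η : H, HasSum (fun v : V => inner ℂ η (π (Λ.a (KPath.id v)) ξ)) (inner ℂ η ξ)

attribute [instance] AModule.nacg AModule.ips AModule.complete

variable {Λ}

namespace ORep

/-- The operator `X_λ = π(x_λ)`. -/
def X (L : Λ.ORep) (p : KPath V) : L.H →L[ℂ] L.H := L.π (Λ.x p)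

theorem X_isCKFamily (L : Λ.ORep) : Λ.IsCKFamily L.X := by
  have h := Λ.x_isCKFamily
  constructor
  · exact fun v => (h.proj v).map L.π
  · intro v w hvw
    rw [X, X, ← map_mul, h.orth v w hvw, map_zero]
  · intro p
    rw [X, X, ← map_star, ← map_mul, h.isom]
  · intro v i hi
    simp only [X]
    conv_lhs => rw [h.sum v i hi]
    rw [map_sum]
    exact Finset.sum_congr rfl fun p _ => by rw [map_mul, map_star]
  · intro p q hpq
    rw [X, X, ← map_mul, h.mul p q hpq, X]

/-- Representations are isomorphic if there is an invertible bounded linear map that intertwines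
the actions of `O_Λ`. -/
def Iso (L L' : Λ.ORep) : Prop :=
  ∃ θ : L.H ≃L[ℂ] L'.H, ∀ (b : Λ.O) (ξ : L.H), θ (L.π b ξ) = L'.π b (θ ξ)

/-- A representation is irreducible if it is nonzero and has no closed invariant subspaces apart
from zero and the whole space. -/
def Irreducible (L : Λ.ORep) : Prop :=
  Nontrivial L.H ∧ ∀ S : Submodule ℂ L.H, IsClosed (S : Set L.H) →
    (∀ (b : Λ.O), ∀ ξ ∈ S, L.π b ξ ∈ S) → S = ⊥ ∨ S = ⊤

end ORep

theorem ORep.iso_equivalence : Equivalence (ORep.Iso (Λ := Λ)) where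
  refl M := ⟨ContinuousLinearEquiv.refl ℂ _, fun _ _ => rfl⟩
  symm := by
    rintro M N ⟨θ, h⟩
    refine ⟨θ.symm, fun b ξ => θ.injective ?_⟩
    rw [h, θ.apply_symm_apply, θ.apply_symm_apply]
  trans := by
    rintro M N K ⟨θ, h⟩ ⟨θ', h'⟩
    exact ⟨θ.trans θ', fun b ξ => by simp [h, h']⟩

variable [Λ.LocallyConvex]

namespace AModule

/-- The operator `A_λ = π(a_λ)`. -/
def A (M : Λ.AModule) (p : KPath V) : M.H →L[ℂ] M.H := M.π (Λ.a p)

theorem A_isPyFamily (M : Λ.AModule) : Λ.IsPyFamily M.A := by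
  have mul : ∀ p q : KPath V, p.src = q.rng → M.A q * M.A p = M.A (p * q) := fun p q h => by
    rw [A, A, A, ← map_mul, Λ.a_mul_a h]
  refine ⟨M.proj, fun v w h => ?_, fun v m => sum_lePaths_of_edges M.proj M.sum mul v m, mul⟩
  rw [A, A, ← map_mul, Λ.a_orth h, map_zero]

/-- The subspace `H_v = a_v H`. -/
def vertexSpace (M : Λ.AModule) (v : V) : Submodule ℂ M.H :=
  LinearMap.range (M.A (KPath.id v) : M.H →ₗ[ℂ] M.H)

/-- The usual dimension vector, with values in `ℕ ∪ {∞}`. -/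
def dimVec (M : Λ.AModule) (v : V) : ℕ∞ := Cardinal.toENat (Module.rank ℂ (M.vertexSpace v))

/-- Modules are isomorphic if there is an invertible bounded linear map that intertwines the actions
of `A_Λ`; it need not intertwine the adjoints. -/
def Iso (M N : Λ.AModule) : Prop :=
  ∃ θ : M.H ≃L[ℂ] N.H, ∀ (b : Λ.A) (ξ : M.H), θ (M.π b ξ) = N.π b (θ ξ)

/-- A submodule: a closed subspace that is invariant under the action of `A_Λ`. -/
structure Sub (M : Λ.AModule) extends Submodule ℂ M.H where
  closed : IsClosed (carrier : Set M.H)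
  invariant : ∀ (b : Λ.A), ∀ ξ ∈ carrier, M.π b ξ ∈ carrier

/-- A module is irreducible if it is nonzero and has no submodules apart from zero and itself. -/
def Irreducible (M : Λ.AModule) : Prop :=
  Nontrivial M.H ∧ ∀ S : M.Sub, S.toSubmodule = ⊥ ∨ S.toSubmodule = ⊤

/-- A submodule is itself a module. -/
def restrict (M : Λ.AModule) (S : M.Sub) : Λ.AModule :=
  haveI : CompleteSpace S.toSubmodule := S.closed.completeSpace_coe
  let T (b : Λ.A) : S.toSubmodule →L[ℂ] S.toSubmodule :=
    ((M.π b).comp S.toSubmodule.subtypeL).codRestrict S.toSubmodule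
      fun ξ => S.invariant b ξ ξ.2
  have hT : ∀ b (ξ : S.toSubmodule), ((T b ξ : S.toSubmodule) : M.H) = M.π b ξ := fun _ _ => rfl
  let ρ : Λ.A →ₙₐ[ℂ] (S.toSubmodule →L[ℂ] S.toSubmodule) :=
    { toFun := T
      map_smul' := fun c b => by
        ext ξ
        simp [hT]
      map_zero' := by
        ext ξ
        simp [hT]
      map_add' := fun b c => by
        ext ξ
        simp [hT]
      map_mul' := fun b c => by
        ext ξ
        simp [hT] }
  { H := S.toSubmodule
    π := ρ
    cont := by
      refine continuous_of_continuousAt_zero ρ ?_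
      rw [ContinuousAt, map_zero]
      refine (tendsto_zero_iff_norm_tendsto_zero (E := S.toSubmodule →L[ℂ] S.toSubmodule)).2 ?_
      have h0 : Filter.Tendsto (fun b => ‖M.π b‖) (nhds 0) (nhds 0) := by
        have := (M.cont.tendsto 0).norm
        rwa [map_zero, norm_zero] at this
      refine squeeze_zero (fun b => norm_nonneg _) (fun b => ?_) h0
      exact ContinuousLinearMap.opNorm_le_bound _ (norm_nonneg _) fun ξ =>
        (M.π b).le_opNorm (ξ : M.H)
    proj := fun v => by
      refine ⟨?_, ?_⟩
      · ext ξ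
        exact congrArg (fun f : M.H →L[ℂ] M.H => f ξ) (M.proj v).isIdempotentElem
      · rw [ContinuousLinearMap.isSelfAdjoint_iff_isSymmetric]
        intro ξ η
        exact ContinuousLinearMap.isSelfAdjoint_iff_isSymmetric.1 (M.proj v).isSelfAdjoint
          (ξ : M.H) (η : M.H)
    sum := fun v i hi => by
      refine sum_star_mul_self (a := fun p => ρ (Λ.a p)) fun ξ η => ?_
      exact sum_norm_sq (a := fun p => M.π (Λ.a p)) (M.sum v i hi) (ξ : M.H) (η : M.H)
    nondeg := fun ξ η => M.nondeg (ξ : M.H) (η : M.H) }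

end AModule

/-! ### Trees and complete submodules -/

variable (Λ)

/-- The trees at `v`, given by their sets of leaves: `{v}` is a tree, and a leaf `μ` of a tree may
be replaced by the paths `μλ` with `λ` in the caret `s(μ) Λ^{≤ e_i}`. -/
inductive IsTree (v : V) : Set (KPath V) → Prop
  | trivial : IsTree v {KPath.id v}
  | graft (t : Set (KPath V)) (μ : KPath V) (i : Fin k) : IsTree v t → μ ∈ t →
      IsTree v ((t \ {μ}) ∪ (fun q => μ * q) '' Λ.pathsLE μ.src (e i))

variable {Λ}

namespace AModule

/-- A submodule `S` is complete if every vector of every `H_v` can be approximated by `S` along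
trees at `v`. -/
def Sub.IsComplete {M : Λ.AModule} (S : M.Sub) : Prop :=
  ∀ ε : ℝ, 0 < ε → ∀ v : V, ∀ ξ ∈ M.vertexSpace v,
    ∃ (t : Set (KPath V)) (η : KPath V → M.H), Λ.IsTree v t ∧ (∀ μ ∈ t, η μ ∈ S.toSubmodule) ∧
      ∑ᶠ μ ∈ t, ‖M.A μ ξ - η μ‖ ^ 2 < ε ^ 2

/-- The intersection of all complete submodules; it is the smallest complete submodule whenever
there is one. -/
def smallestComplete (M : Λ.AModule) : M.Sub where
  toSubmodule := ⨅ S : {S : M.Sub // S.IsComplete}, S.1.toSubmodule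
  closed := by
    change IsClosed ((⨅ S : {S : M.Sub // S.IsComplete}, S.1.toSubmodule : Submodule ℂ M.H) :
      Set M.H)
    rw [Submodule.coe_iInf]
    exact isClosed_iInter fun S => S.1.closed
  invariant b ξ hξ := by
    have hξ' := (Submodule.mem_iInf _).1 hξ
    exact (Submodule.mem_iInf _).2 fun S => S.1.invariant b ξ (hξ' S)

end AModule

/-- The forgetful functor `U`: a representation of `O_Λ` is an `A_Λ`-module in which `a_λ` acts by
the adjoint of `x_λ`. -/
def ORep.U (L : Λ.ORep) : Λ.AModule :=
  let F : OpFamily Λ.pyRel := ⟨L.H, fun p => star (L.X p), L.X_isCKFamily.star_isPyFamily⟩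
  have hF : Λ.IsPyFamily fun p => star (L.X p) := L.X_isCKFamily.star_isPyFamily
  { H := L.H
    π := ((UniversalCStar.lift Λ.pyRel_bound F : Λ.P →ₙₐ[ℂ] (L.H →L[ℂ] L.H))).comp
      (NonUnitalSubalgebraClass.subtype Λ.A)
    cont := (UniversalCStar.lift_continuous Λ.pyRel_bound F).comp continuous_subtype_val
    proj := hF.proj
    sum := fun v i hi => by
      have := hF.sum v (e i)
      rw [lePaths_e_of_nonempty hi] at this
      exact this
    nondeg := fun ξ η => by
      have h := (L.nondeg ξ).mapL (innerSL ℂ η)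
      have h2 : ∀ v, star (L.X (KPath.id v)) = L.X (KPath.id v) := fun v =>
        (L.X_isCKFamily.proj v).isSelfAdjoint
      refine h.congr_fun ?_
      exact fun v => congrArg (fun f : L.H →L[ℂ] L.H => inner ℂ η (f ξ)) (h2 v) }

theorem ORep.U_A (L : Λ.ORep) (p : KPath V) : L.U.A p = star (L.X p) := rfl

/-- `Σ(L)`, the smallest complete submodule of `U(L)`. -/
def ORep.Sigma (L : Λ.ORep) : Λ.AModule := L.U.restrict L.U.smallestComplete

end KGraph

/-! ### The Pythagorean functor -/

namespace KGraph

variable {k : ℕ} {V : Type u} [SmallCategory V] {Λ : KGraph k V} [Λ.RowFinite] [Λ.LocallyConvex]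

namespace AModule

variable (M : Λ.AModule)

open Classical in
/-- The operator `A_ν` if `t = pν`, and zero if `t` does not extend `p`. -/
def ext (p t : KPath V) : M.H →L[ℂ] M.H :=
  if h : ∃ q : KPath V, p.src = q.rng ∧ p * q = t then M.A h.choose else 0

/-- The space `L^{00}` spanned by pairs `(λ, ξ)`, with the relations that make `(λ, ξ)` linear in
`ξ` already divided out. It is convenient to admit all `ξ ∈ H`: the pair `(λ, ξ)` stands for
`(λ, A_{s(λ)} ξ)`, from which it is not distinguished by the form below. -/
def Pre : Type u := KPath V →₀ M.H

instance : AddCommGroup M.Pre := inferInstanceAs (AddCommGroup (KPath V →₀ M.H))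
instance : Module ℂ M.Pre := inferInstanceAs (Module ℂ (KPath V →₀ M.H))

/-- The pair `(λ, ξ)`. -/
def single (p : KPath V) : M.H →ₗ[ℂ] M.Pre := Finsupp.lsingle (M := M.H) (R := ℂ) p

/-- The form on pairs: the sum of `⟨A_ν ξ, A_γ η⟩` over all `pν = qγ ∈ Λ^{≤ d(p) + d(q)}`. -/
def pair (p : KPath V) (ξ : M.H) (q : KPath V) (η : M.H) : ℂ :=
  ∑ t ∈ Λ.lePaths p.rng (Λ.d p + Λ.d q), inner ℂ (M.ext p t ξ) (M.ext q t η)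

/-- The sesquilinear extension of `pair`. -/
def form (f g : M.Pre) : ℂ :=
  Finsupp.sum (M := M.H) f fun p ξ => Finsupp.sum (M := M.H) g fun q η => M.pair p ξ q η

variable {M}

theorem A_mul {p q : KPath V} (h : p.src = q.rng) (ξ : M.H) : M.A q (M.A p ξ) = M.A (p * q) ξ := by
  rw [← M.A_isPyFamily.mul p q h]; rfl

theorem ext_mul {p q : KPath V} (h : p.src = q.rng) : M.ext p (p * q) = M.A q := by
  have hex : ∃ q' : KPath V, p.src = q'.rng ∧ p * q' = p * q := ⟨q, h, rfl⟩
  rw [ext, dif_pos hex]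
  congr 1
  exact Λ.mul_left_cancel hex.choose_spec.1 h hex.choose_spec.2

theorem ext_eq_zero {p t : KPath V} (h : ¬ ∃ q : KPath V, p.src = q.rng ∧ p * q = t) :
    M.ext p t = 0 := dif_neg h

theorem ext_eq_zero_of_rng {p t : KPath V} (h : t.rng ≠ p.rng) : M.ext p t = 0 := by
  refine ext_eq_zero ?_
  rintro ⟨q, hq, rfl⟩
  exact h (KPath.rng_mul hq)

theorem A_src_ext (p t : KPath V) (ξ : M.H) :
    M.A (KPath.id t.src) (M.ext p t ξ) = M.ext p t ξ := by
  by_cases h : ∃ q : KPath V, p.src = q.rng ∧ p * q = t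
  · obtain ⟨q, hq, rfl⟩ := h
    rw [ext_mul hq, KPath.src_mul hq, A_mul rfl, KPath.mul_id rfl]
  · rw [ext_eq_zero h]; simp

theorem ext_mul_of_mem {v : V} {m : Fin k → ℕ} {p t r : KPath V} (ht : t ∈ Λ.pathsLE v m)
    (hp : Λ.d p ≤ m) (hr : t.src = r.rng) (ξ : M.H) :
    M.ext p (t * r) ξ = M.A r (M.ext p t ξ) := by
  by_cases h : ∃ q : KPath V, p.src = q.rng ∧ p * q = t
  · obtain ⟨q, hq, rfl⟩ := h
    rw [KPath.src_mul hq] at hr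
    rw [KPath.assoc hq hr, ext_mul hq, ext_mul (by rw [KPath.rng_mul hr, hq]), A_mul hr]
  · rw [ext_eq_zero h, ext_eq_zero]
    · simp
    · rintro ⟨q', hq', heq⟩
      have hd := congrArg Λ.d heq
      rw [d_mul hq', d_mul hr] at hd
      have hle : Λ.d p ≤ Λ.d t := by
        intro j
        by_contra hj
        have hj' : Λ.d t j < Λ.d p j := not_le.1 hj
        have hj2 : Λ.d p j ≤ m j := hp j
        have h1 := congrFun hd j
        simp only [Pi.add_apply] at h1
        refine (mem_pathsLE.1 ht).2.2 j (by omega) ?_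
        rw [hr]
        exact nonempty_of_pos (by omega)
      obtain ⟨a, b, hab, rfl, ha, -⟩ := exists_factor (Λ := Λ) (p := t)
        (add_tsub_cancel_of_le hle).symm
      rw [KPath.src_mul hab] at hr
      rw [KPath.assoc hab hr] at heq
      obtain ⟨rfl, -⟩ := factor_unique (Λ := Λ) hq' (by rw [KPath.rng_mul hr, hab]) heq ha.symm
      exact h ⟨b, hab, rfl⟩

theorem sum_stable (v : V) {p q : KPath V} {m : Fin k → ℕ} (hp : Λ.d p ≤ m) (hq : Λ.d q ≤ m)
    (n : Fin k → ℕ) (ξ η : M.H) :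
    ∑ t ∈ Λ.lePaths v (m + n), inner ℂ (M.ext p t ξ) (M.ext q t η) =
      ∑ t ∈ Λ.lePaths v m, inner ℂ (M.ext p t ξ) (M.ext q t η) := by
  induction n using degree_induction with
  | h0 => rw [add_zero]
  | hs n i ih =>
    have hp' : Λ.d p ≤ m + n := hp.trans (le_add_of_nonneg_right fun _ => Nat.zero_le _)
    have hq' : Λ.d q ≤ m + n := hq.trans (le_add_of_nonneg_right fun _ => Nat.zero_le _)
    rw [← add_assoc, sum_lePaths_add, ← ih]
    refine Finset.sum_congr rfl fun t ht => ?_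
    rw [mem_lePaths] at ht
    have h1 := sum_norm_sq (M.A_isPyFamily.sum t.src (e i)) (M.ext p t ξ) (M.ext q t η)
    rw [A_src_ext] at h1
    rw [← h1]
    refine Finset.sum_congr rfl fun r hr => ?_
    have hr' : t.src = r.rng := by
      rw [mem_lePaths, mem_pathsLE] at hr; exact hr.1.symm
    rw [ext_mul_of_mem ht hp' hr', ext_mul_of_mem ht hq' hr']

theorem pair_eq {p q : KPath V} {m : Fin k → ℕ} (hp : Λ.d p ≤ m) (hq : Λ.d q ≤ m) (ξ η : M.H) :
    M.pair p ξ q η = ∑ t ∈ Λ.lePaths p.rng m, inner ℂ (M.ext p t ξ) (M.ext q t η) := by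
  have h1 := sum_stable p.rng (M := M) (le_sup_left : Λ.d p ≤ Λ.d p ⊔ Λ.d q)
    (le_sup_right : Λ.d q ≤ Λ.d p ⊔ Λ.d q) (m - (Λ.d p ⊔ Λ.d q)) ξ η
  have h2 := sum_stable p.rng (M := M) (le_sup_left : Λ.d p ≤ Λ.d p ⊔ Λ.d q)
    (le_sup_right : Λ.d q ≤ Λ.d p ⊔ Λ.d q) (Λ.d p + Λ.d q - (Λ.d p ⊔ Λ.d q)) ξ η
  rw [add_tsub_cancel_of_le (sup_le hp hq)] at h1
  rw [add_tsub_cancel_of_le (sup_le (le_add_of_nonneg_right fun _ => Nat.zero_le _)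
    (le_add_of_nonneg_left fun _ => Nat.zero_le _))] at h2
  rw [pair, h1, h2]

variable (M) in
/-- The map `(p, ξ) ↦ A_ν ξ` for `t = pν`. -/
def coord (t : KPath V) : M.Pre →ₗ[ℂ] M.H :=
  Finsupp.lsum (M := M.H) ℂ fun p => (M.ext p t : M.H →ₗ[ℂ] M.H)

theorem coord_single (t p : KPath V) (ξ : M.H) : M.coord t (M.single p ξ) = M.ext p t ξ := by
  exact Finsupp.sum_single_index (h := fun p ξ => M.ext p t ξ) (map_zero _)

variable (M) in
/-- The vectors supported on paths with range in `S` and degree at most `m`. -/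
def good (S : Finset V) (m : Fin k → ℕ) : Submodule ℂ M.Pre :=
  Finsupp.supported M.H ℂ {p | p.rng ∈ S ∧ Λ.d p ≤ m}

theorem good_mono {S S' : Finset V} {m m' : Fin k → ℕ} (hS : S ⊆ S') (hm : m ≤ m') :
    M.good S m ≤ M.good S' m' :=
  Finsupp.supported_mono fun _ hp => ⟨hS hp.1, hp.2.trans hm⟩

theorem single_mem_good {S : Finset V} {m : Fin k → ℕ} {p : KPath V} (h : p.rng ∈ S)
    (h' : Λ.d p ≤ m) (ξ : M.H) : M.single p ξ ∈ M.good S m :=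
  Finsupp.single_mem_supported ℂ ξ ⟨h, h'⟩

open Classical in
theorem exists_good (f : M.Pre) : ∃ S m, f ∈ M.good S m := by
  refine ⟨(Finsupp.support (M := M.H) f).image KPath.rng, (Finsupp.support (M := M.H) f).sup Λ.d, ?_⟩
  refine (Finsupp.mem_supported (M := M.H) ℂ f).2 fun p hp => ⟨?_, ?_⟩
  · exact Finset.mem_image_of_mem _ hp
  · exact Finset.le_sup (f := Λ.d) hp

open Classical in
theorem exists_good₃ (f g h : M.Pre) : ∃ S m, f ∈ M.good S m ∧ g ∈ M.good S m ∧ h ∈ M.good S m := by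
  obtain ⟨S, m, hf⟩ := exists_good f
  obtain ⟨S', m', hg⟩ := exists_good g
  obtain ⟨S'', m'', hh⟩ := exists_good h
  refine ⟨S ∪ S' ∪ S'', m ⊔ m' ⊔ m'', good_mono ?_ ?_ hf, good_mono ?_ ?_ hg, good_mono ?_ ?_ hh⟩
  · intro x hx; simp [hx]
  · exact le_sup_left.trans le_sup_left
  · intro x hx; simp [hx]
  · exact le_sup_right.trans le_sup_left
  · intro x hx; simp [hx]
  · exact le_sup_right

open Classical in
theorem form_eq {S : Finset V} {m : Fin k → ℕ} {f g : M.Pre} (hf : f ∈ M.good S m)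
    (hg : g ∈ M.good S m) :
    M.form f g =
      ∑ t ∈ S.biUnion fun v => Λ.lePaths v m, inner ℂ (M.coord t f) (M.coord t g) := by
  have hf' := (Finsupp.mem_supported (M := M.H) ℂ f).1 hf
  have hg' := (Finsupp.mem_supported (M := M.H) ℂ g).1 hg
  have hc : ∀ (t : KPath V) (f : M.Pre), M.coord t f =
      ∑ p ∈ Finsupp.support (M := M.H) f, M.ext p t (DFunLike.coe (F := KPath V →₀ M.H) f p) :=
    fun t f => rfl
  simp only [hc, sum_inner]
  simp only [inner_sum]
  rw [Finset.sum_comm]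
  change ∑ p ∈ Finsupp.support (M := M.H) f, _ = _
  refine Finset.sum_congr rfl fun p hp => ?_
  rw [Finset.sum_comm]
  change ∑ q ∈ Finsupp.support (M := M.H) g, _ = _
  refine Finset.sum_congr rfl fun q hq => ?_
  refine (pair_eq (hf' hp).2 (hg' hq).2 _ _).trans ?_
  refine Finset.sum_subset (fun t ht => ?_) (fun t ht ht' => ?_)
  · exact Finset.mem_biUnion.2 ⟨p.rng, (hf' hp).1, ht⟩
  · obtain ⟨v, hv, htv⟩ := Finset.mem_biUnion.1 ht
    have : t.rng ≠ p.rng := by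
      intro heq
      have h2 : t.rng = v := by
        rw [mem_lePaths, mem_pathsLE] at htv; exact htv.1
      rw [heq] at h2
      exact ht' (h2 ▸ htv)
    rw [ext_eq_zero_of_rng this]
    simp

theorem form_single (p q : KPath V) (ξ η : M.H) :
    M.form (M.single p ξ) (M.single q η) = M.pair p ξ q η := by
  classical
  rw [form_eq (S := {p.rng, q.rng}) (m := Λ.d p ⊔ Λ.d q)
    (single_mem_good (by simp) le_sup_left ξ) (single_mem_good (by simp) le_sup_right η),
    pair_eq (m := Λ.d p ⊔ Λ.d q) le_sup_left le_sup_right]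
  symm
  simp only [coord_single]
  refine Finset.sum_subset (fun t ht => ?_) (fun t ht ht' => ?_)
  · exact Finset.mem_biUnion.2 ⟨p.rng, by simp, ht⟩
  · obtain ⟨v, hv, htv⟩ := Finset.mem_biUnion.1 ht
    have : t.rng ≠ p.rng := by
      intro heq
      have h2 : t.rng = v := by
        rw [mem_lePaths, mem_pathsLE] at htv; exact htv.1
      rw [heq] at h2
      exact ht' (h2 ▸ htv)
    rw [ext_eq_zero_of_rng this]
    simp

variable (M) in
/-- The form is a positive semidefinite Hermitian form. -/
@[reducible] def preCore : PreInnerProductSpace.Core ℂ M.Pre where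
  inner := M.form
  conj_inner_symm f g := by
    obtain ⟨S, m, hf, hg, -⟩ := exists_good₃ f g 0
    simp only [form_eq hf hg, form_eq hg hf, map_sum, inner_conj_symm]
  re_inner_nonneg f := by
    obtain ⟨S, m, hf⟩ := exists_good f
    simp only [form_eq hf hf, map_sum]
    exact Finset.sum_nonneg fun t _ => inner_self_nonneg
  add_left f g h := by
    obtain ⟨S, m, hf, hg, hh⟩ := exists_good₃ f g h
    simp only [form_eq hf hh, form_eq hg hh, form_eq (add_mem hf hg) hh, map_add, inner_add_left,
      Finset.sum_add_distrib]
  smul_left f g c := by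
    obtain ⟨S, m, hf, hg, -⟩ := exists_good₃ f g 0
    simp only [form_eq hf hg, form_eq (Submodule.smul_mem _ c hf) hg, map_smul, inner_smul_left,
      Finset.mul_sum]

instance : SeminormedAddCommGroup M.Pre :=
  @InnerProductSpace.Core.toSeminormedAddCommGroup ℂ M.Pre _ _ _ M.preCore

instance : InnerProductSpace ℂ M.Pre := InnerProductSpace.ofCore M.preCore

theorem inner_single (p q : KPath V) (ξ η : M.H) :
    (inner ℂ (M.single p ξ) (M.single q η) : ℂ) = M.pair p ξ q η := form_single p q ξ η

theorem pre_induction {P : M.Pre → Prop} (h0 : P 0) (ha : ∀ f g, P f → P g → P (f + g))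
    (hs : ∀ p ξ, P (M.single p ξ)) (f : M.Pre) : P f :=
  Finsupp.induction_linear (M := M.H) f h0 ha hs

variable (M) in
open Classical in
/-- `X_μ` on `L^{00}`: the pair `(λ, ξ)` goes to `(μλ, ξ)` if `r(λ) = s(μ)`, and to zero
otherwise. -/
def preX (μ : KPath V) : M.Pre →ₗ[ℂ] M.Pre :=
  Finsupp.lsum (M := M.H) ℂ fun p => if μ.src = p.rng then M.single (μ * p) else 0

theorem preX_single {μ p : KPath V} (h : μ.src = p.rng) (ξ : M.H) :
    M.preX μ (M.single p ξ) = M.single (μ * p) ξ := by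
  classical
  refine (Finsupp.sum_single_index (h := fun p ξ =>
    (if μ.src = p.rng then M.single (μ * p) else 0) ξ) (map_zero _)).trans ?_
  rw [if_pos h]

theorem preX_single' {μ p : KPath V} (h : μ.src ≠ p.rng) (ξ : M.H) :
    M.preX μ (M.single p ξ) = 0 := by
  classical
  refine (Finsupp.sum_single_index (h := fun p ξ =>
    (if μ.src = p.rng then M.single (μ * p) else 0) ξ) (map_zero _)).trans ?_
  rw [if_neg h]
  rfl

theorem ext_mul_mul {μ p s : KPath V} (hp : μ.src = p.rng) (hs : μ.src = s.rng) :
    M.ext (μ * p) (μ * s) = M.ext p s := by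
  by_cases h : ∃ q : KPath V, p.src = q.rng ∧ p * q = s
  · obtain ⟨q, hq, rfl⟩ := h
    rw [ext_mul hq, ← KPath.assoc hp hq, ext_mul (by rw [KPath.src_mul hp, hq])]
  · rw [ext_eq_zero h, ext_eq_zero]
    rintro ⟨q, hq, heq⟩
    rw [KPath.src_mul hp] at hq
    rw [KPath.assoc hp hq] at heq
    exact h ⟨q, hq, Λ.mul_left_cancel (by rw [KPath.rng_mul hq, hp]) hs heq⟩

theorem pair_mul_mul {μ p q : KPath V} (hp : μ.src = p.rng) (hq : μ.src = q.rng) (ξ η : M.H) :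
    M.pair (μ * p) ξ (μ * q) η = M.pair p ξ q η := by
  classical
  rw [pair_eq (p := μ * p) (q := μ * q) (m := Λ.d μ + (Λ.d p ⊔ Λ.d q))
      (by rw [d_mul hp]; exact add_le_add_right le_sup_left _)
      (by rw [d_mul hq]; exact add_le_add_right le_sup_right _),
    pair_eq (p := p) (q := q) (m := Λ.d p ⊔ Λ.d q) le_sup_left le_sup_right,
    KPath.rng_mul hp, ← hp]
  symm
  have hmem : ∀ s ∈ Λ.lePaths μ.src (Λ.d p ⊔ Λ.d q), μ.src = s.rng := fun s hs => by
    rw [mem_lePaths, mem_pathsLE] at hs; exact hs.1.symm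
  refine Eq.trans ?_ (Finset.sum_subset (s₁ := (Λ.lePaths μ.src (Λ.d p ⊔ Λ.d q)).image (μ * ·))
    ?_ ?_)
  · rw [Finset.sum_image]
    · refine Finset.sum_congr rfl fun s hs => ?_
      rw [ext_mul_mul hp (hmem s hs), ext_mul_mul hq (hmem s hs)]
    · intro s hs s' hs' heq
      exact Λ.mul_left_cancel (hmem s hs) (hmem s' hs') heq
  · intro t ht
    obtain ⟨s, hs, rfl⟩ := Finset.mem_image.1 ht
    rw [mem_lePaths]
    exact (mul_mem_pathsLE_iff (hmem s hs)).2 (mem_lePaths.1 hs)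
  · intro t ht ht'
    rw [ext_eq_zero (p := μ * p)]
    · simp
    · rintro ⟨r, hr, rfl⟩
      rw [KPath.src_mul hp] at hr
      rw [KPath.assoc hp hr] at ht ht'
      have h2 : μ.src = (p * r).rng := by rw [KPath.rng_mul hr, hp]
      exact ht' (Finset.mem_image.2 ⟨p * r, mem_lePaths.2 ((mul_mem_pathsLE_iff h2).1
        (mem_lePaths.1 ht)), rfl⟩)

theorem pair_eq_zero {p q : KPath V} (h : ∀ a b : KPath V, p.src = a.rng → q.src = b.rng →
    p * a ≠ q * b) (ξ η : M.H) : M.pair p ξ q η = 0 := by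
  refine Finset.sum_eq_zero fun t _ => ?_
  by_cases h1 : ∃ a : KPath V, p.src = a.rng ∧ p * a = t
  · by_cases h2 : ∃ b : KPath V, q.src = b.rng ∧ q * b = t
    · obtain ⟨a, ha, rfl⟩ := h1
      obtain ⟨b, hb, hab⟩ := h2
      exact absurd hab.symm (h a b ha hb)
    · rw [ext_eq_zero h2]; simp
  · rw [ext_eq_zero h1]; simp

theorem inner_preX (μ : KPath V) (f g : M.Pre) :
    (inner ℂ (M.preX μ f) (M.preX μ g) : ℂ) = inner ℂ (M.preX (KPath.id μ.src) f) g := by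
  induction f using pre_induction with
  | h0 => simp
  | ha f f' hf hf' => rw [map_add, map_add, inner_add_left, inner_add_left, hf, hf']
  | hs p ξ =>
    induction g using pre_induction with
    | h0 => simp
    | ha g g' hg hg' => rw [map_add, inner_add_right, inner_add_right, hg, hg']
    | hs q η =>
      by_cases hp : μ.src = p.rng
      · rw [preX_single hp, preX_single (μ := KPath.id μ.src) hp, KPath.id_mul hp, inner_single]
        by_cases hq : μ.src = q.rng
        · rw [preX_single hq, inner_single, pair_mul_mul hp hq]
        · rw [preX_single' hq, inner_zero_right, pair_eq_zero]
          intro a b ha hb hab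
          have := congrArg KPath.rng hab
          rw [KPath.rng_mul ha, KPath.rng_mul hb] at this
          exact hq (hp.trans this)
      · rw [preX_single' hp, preX_single' (μ := KPath.id μ.src) hp, inner_zero_left,
          inner_zero_left]

theorem preX_id_id (v : V) (f : M.Pre) :
    M.preX (KPath.id v) (M.preX (KPath.id v) f) = M.preX (KPath.id v) f := by
  induction f using pre_induction with
  | h0 => simp
  | ha f f' hf hf' => rw [map_add, map_add, hf, hf']
  | hs p ξ =>
    by_cases h : (KPath.id v).src = p.rng
    · have h' : KPath.id v * p = p := KPath.id_mul h
      rw [preX_single h, h', preX_single h, h']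
    · rw [preX_single' h, map_zero]

theorem norm_preX_id_le (v : V) (f : M.Pre) : ‖M.preX (KPath.id v) f‖ ≤ ‖f‖ := by
  have h1 := inner_preX (KPath.id v) f f
  have h2 : ‖M.preX (KPath.id v) f‖ ^ 2 ≤ ‖M.preX (KPath.id v) f‖ * ‖f‖ := by
    rw [← inner_self_eq_norm_sq (𝕜 := ℂ), h1]
    exact re_inner_le_norm _ _
  nlinarith [norm_nonneg (M.preX (KPath.id v) f), norm_nonneg f]

theorem norm_preX_le (μ : KPath V) (f : M.Pre) : ‖M.preX μ f‖ ≤ 1 * ‖f‖ := by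
  have h2 : ‖M.preX μ f‖ ^ 2 ≤ ‖f‖ * ‖f‖ := by
    rw [← inner_self_eq_norm_sq (𝕜 := ℂ), inner_preX]
    exact (re_inner_le_norm _ _).trans
      (mul_le_mul_of_nonneg_right (norm_preX_id_le _ _) (norm_nonneg _))
  rw [one_mul]
  exact abs_le_of_sq_le_sq' (by nlinarith) (norm_nonneg _) |>.2


/-- The caret relation holds up to vectors of norm zero. -/
theorem norm_caret {p : KPath V} {i : Fin k} (h : (Λ.edges p.src i).Nonempty) (ξ : M.H) :
    ‖M.single p ξ - ∑ α ∈ Λ.edges p.src i, M.single (p * α) (M.A α ξ)‖ = 0 := by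
  classical
  set z := M.single p ξ - ∑ α ∈ Λ.edges p.src i, M.single (p * α) (M.A α ξ) with hz
  have hα : ∀ α ∈ Λ.edges p.src i, p.src = α.rng := fun α h => (mem_edges.1 h).1.symm
  have hgood : z ∈ M.good {p.rng} (Λ.d p + e i) := by
    refine sub_mem (single_mem_good (by simp)
      (le_add_of_nonneg_right fun _ => Nat.zero_le _) ξ) (sum_mem fun α h => ?_)
    refine single_mem_good (by simp [KPath.rng_mul (hα α h)]) ?_ _
    rw [d_mul (hα α h), (mem_edges.1 h).2]
  have h0 : (inner ℂ z z : ℂ) = 0 := by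
    refine (form_eq hgood hgood).trans (Finset.sum_eq_zero fun t ht => ?_)
    rw [Finset.singleton_biUnion, mem_lePaths] at ht
    suffices hc : M.coord t z = 0 by rw [hc, inner_zero_left]
    rw [hz, map_sub, map_sum, coord_single, sub_eq_zero]
    simp only [coord_single]
    by_cases hex : ∃ q : KPath V, p.src = q.rng ∧ p * q = t
    · obtain ⟨q, hq, rfl⟩ := hex
      rw [mul_mem_pathsLE_iff hq, mem_pathsLE] at ht
      have hqi : 1 ≤ Λ.d q i := by
        by_contra hlt
        have h1 : Λ.d q i = 0 := by omega
        refine ht.2.2 i (by rw [h1, e_same]; exact one_pos) (exists_edge_of_path q h1 ?_)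
        rw [← hq]
        exact edges_nonempty.1 h
      obtain ⟨α, r, hαr, rfl, hαd, -⟩ := exists_factor (Λ := Λ) (p := q)
        (add_tsub_cancel_of_le (e_le_iff.2 hqi)).symm
      rw [KPath.rng_mul hαr] at hq
      have hmem : α ∈ Λ.edges p.src i := mem_edges.2 ⟨hq.symm, hαd⟩
      rw [ext_mul (by rw [KPath.rng_mul hαr, hq]), Finset.sum_eq_single_of_mem α hmem]
      · rw [← KPath.assoc hq hαr, ext_mul (by rw [KPath.src_mul hq, hαr]), A_mul hαr]
      · intro β hβ hne
        rw [ext_eq_zero]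
        · rfl
        · rintro ⟨s, hs, heq⟩
          have hβ' := hα β hβ
          rw [KPath.src_mul hβ'] at hs
          rw [KPath.assoc hβ' hs] at heq
          have h3 := Λ.mul_left_cancel (by rw [KPath.rng_mul hs, hβ'])
            (by rw [KPath.rng_mul hαr, hq]) heq
          exact hne (factor_unique (Λ := Λ) hs hαr h3 (by rw [hαd, (mem_edges.1 hβ).2])).1
    · rw [ext_eq_zero hex, Finset.sum_eq_zero]
      · rfl
      · intro α h
        rw [ext_eq_zero]
        · rfl
        · rintro ⟨s, hs, heq⟩
          have hα' := hα α h
          rw [KPath.src_mul hα'] at hs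
          rw [KPath.assoc hα' hs] at heq
          exact hex ⟨α * s, by rw [KPath.rng_mul hs, hα'], heq⟩
  have h1 := inner_self_eq_norm_sq (𝕜 := ℂ) z
  rw [h0] at h1
  have h2 : ‖z‖ ^ 2 = 0 := by simpa using h1.symm
  exact pow_eq_zero_iff (two_ne_zero) |>.1 h2

/-! #### The Hilbert space `L` and the operators `X_μ` -/

open UniformSpace (Completion)

variable (M) in
/-- The Hilbert space `L`: the (Hausdorff) completion of `L^{00}` for the form. -/
abbrev Lift : Type u := Completion M.Pre

variable (M) in
/-- The class `[λ, ξ]` in `L`. -/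
def cls (p : KPath V) (ξ : M.H) : M.Lift := ((M.single p ξ : M.Pre) : M.Lift)

variable (M) in
/-- The operator `X_μ` on `L`, the continuous extension of `preX μ`. -/
def liftX (μ : KPath V) : M.Lift →L[ℂ] M.Lift :=
  ((Completion.toComplL : M.Pre →L[ℂ] M.Lift).comp
    ((M.preX μ).mkContinuous 1 (norm_preX_le μ))).extend (Completion.toComplL : M.Pre →L[ℂ] M.Lift)

theorem liftX_coe (μ : KPath V) (f : M.Pre) : M.liftX μ (f : M.Lift) = (M.preX μ f : M.Lift) :=
  ContinuousLinearMap.extend_eq (e := (Completion.toComplL : M.Pre →L[ℂ] M.Lift)) _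
    Completion.denseRange_coe (Completion.isUniformInducing_coe M.Pre) f

theorem liftX_cls {μ p : KPath V} (h : μ.src = p.rng) (ξ : M.H) :
    M.liftX μ (M.cls p ξ) = M.cls (μ * p) ξ := by
  rw [cls, liftX_coe, preX_single h, cls]

theorem liftX_cls' {μ p : KPath V} (h : μ.src ≠ p.rng) (ξ : M.H) :
    M.liftX μ (M.cls p ξ) = 0 := by
  rw [cls, liftX_coe, preX_single' h, Completion.coe_zero]

theorem lift_ext {T T' : M.Lift →L[ℂ] M.Lift} (h : ∀ p ξ, T (M.cls p ξ) = T' (M.cls p ξ)) :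
    T = T' := by
  ext x
  induction x using Completion.induction_on with
  | hp => exact isClosed_eq T.continuous T'.continuous
  | ih f =>
    induction f using pre_induction with
    | h0 => rw [Completion.coe_zero, map_zero, map_zero]
    | ha f g hf hg => rw [Completion.coe_add, map_add, map_add, hf, hg]
    | hs p ξ => exact h p ξ

theorem cls_caret {p : KPath V} {i : Fin k} (h : (Λ.edges p.src i).Nonempty) (ξ : M.H) :
    M.cls p ξ = ∑ α ∈ Λ.edges p.src i, M.cls (p * α) (M.A α ξ) := by
  have h1 := norm_caret h ξ
  rw [← Completion.norm_coe, norm_eq_zero, Completion.coe_sub, sub_eq_zero] at h1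
  refine h1.trans ?_
  exact map_sum (Completion.toComplL : M.Pre →L[ℂ] M.Lift) _ _

theorem star_liftX_mul (μ : KPath V) : star (M.liftX μ) * M.liftX μ = M.liftX (KPath.id μ.src) := by
  ext x
  refine ext_inner_right ℂ fun y => ?_
  rw [mul_apply_eq_comp, ContinuousLinearMap.star_eq_adjoint,
    ContinuousLinearMap.adjoint_inner_left]
  induction x, y using Completion.induction_on₂ with
  | hp =>
    exact isClosed_eq (by fun_prop) (by fun_prop)
  | ih f g => rw [liftX_coe, liftX_coe, liftX_coe, Completion.inner_coe, Completion.inner_coe,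
      inner_preX]

theorem star_liftX_mul_of_ne {μ ν : KPath V} (hd : Λ.d μ = Λ.d ν) (hne : μ ≠ ν) :
    star (M.liftX μ) * M.liftX ν = 0 := by
  ext x
  refine ext_inner_right ℂ fun y => ?_
  rw [mul_apply_eq_comp, ContinuousLinearMap.star_eq_adjoint,
    ContinuousLinearMap.adjoint_inner_left, zero_apply, inner_zero_left]
  induction x, y using Completion.induction_on₂ with
  | hp => exact isClosed_eq (by fun_prop) continuous_const
  | ih f g =>
    rw [liftX_coe, liftX_coe, Completion.inner_coe]
    induction f using pre_induction with
    | h0 => simp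
    | ha f f' hf hf' => rw [map_add, inner_add_left, hf, hf', add_zero]
    | hs p ξ =>
      induction g using pre_induction with
      | h0 => simp
      | ha g g' hg hg' => rw [map_add, inner_add_right, hg, hg', add_zero]
      | hs q η =>
        by_cases hp : ν.src = p.rng
        · by_cases hq : μ.src = q.rng
          · rw [preX_single hp, preX_single hq, inner_single, pair_eq_zero]
            intro a b ha hb hab
            rw [KPath.src_mul hp] at ha
            rw [KPath.src_mul hq] at hb
            rw [KPath.assoc hp ha, KPath.assoc hq hb] at hab
            exact hne (factor_unique (Λ := Λ) (by rw [KPath.rng_mul ha, hp])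
              (by rw [KPath.rng_mul hb, hq]) hab hd.symm).1.symm
          · rw [preX_single' hq, inner_zero_right]
        · rw [preX_single' hp, inner_zero_left]

theorem liftX_mul {μ ν : KPath V} (h : μ.src = ν.rng) :
    M.liftX μ * M.liftX ν = M.liftX (μ * ν) := by
  refine lift_ext fun p ξ => ?_
  rw [mul_apply_eq_comp]
  by_cases hp : ν.src = p.rng
  · rw [liftX_cls hp, liftX_cls (by rw [KPath.rng_mul hp, h]),
      liftX_cls (by rw [KPath.src_mul h, hp]), KPath.assoc h hp]
  · rw [liftX_cls' hp, liftX_cls' (by rw [KPath.src_mul h]; exact hp), map_zero]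

theorem liftX_id_cls {v : V} {p : KPath V} (h : v = p.rng) (ξ : M.H) :
    M.liftX (KPath.id v) (M.cls p ξ) = M.cls p ξ := by
  rw [liftX_cls (μ := KPath.id v) h, KPath.id_mul h]

theorem liftX_proj (v : V) : IsStarProjection (M.liftX (KPath.id v)) := by
  refine ⟨?_, ?_⟩
  · have h := liftX_mul (M := M) (μ := KPath.id v) (ν := KPath.id v) rfl
    have h' : KPath.id v * KPath.id v = KPath.id v := KPath.id_mul rfl
    rwa [h'] at h
  · have h := star_liftX_mul (M := M) (KPath.id v)
    rw [KPath.id_src] at h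
    have h2 := congrArg star h
    rw [star_mul, star_star, h] at h2
    exact h2.symm

theorem liftX_isCKFamily (M : Λ.AModule) : Λ.IsCKFamily M.liftX where
  proj := liftX_proj
  orth v w hvw := by
    refine lift_ext fun p ξ => ?_
    rw [mul_apply_eq_comp, zero_apply]
    by_cases hw : w = p.rng
    · rw [liftX_id_cls hw, liftX_cls' (fun h => hvw (h.trans hw.symm))]
    · rw [liftX_cls' hw, map_zero]
  isom := star_liftX_mul
  mul _ _ := liftX_mul
  sum v i hi := by
    have hsrc : ∀ α ∈ Λ.edges v i, v = α.rng := fun α h => (mem_edges.1 h).1.symm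
    have hfix : ∀ β ∈ Λ.edges v i, (∑ α ∈ Λ.edges v i, M.liftX α * star (M.liftX α)) * M.liftX β =
        M.liftX β := fun β hβ => by
      rw [Finset.sum_mul, Finset.sum_eq_single_of_mem β hβ]
      · rw [mul_assoc, star_liftX_mul, liftX_mul rfl, KPath.mul_id rfl]
      · intro α hα hne
        rw [mul_assoc, star_liftX_mul_of_ne ((mem_edges.1 hα).2.trans (mem_edges.1 hβ).2.symm) hne,
          mul_zero]
    have hfix' : ∀ (r : KPath V) (ξ : M.H), r.rng = v → 1 ≤ Λ.d r i →
        (∑ α ∈ Λ.edges v i, M.liftX α * star (M.liftX α)) (M.cls r ξ) = M.cls r ξ := by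
      intro r ξ hr hri
      obtain ⟨β, s, hβs, rfl, hβ, -⟩ := exists_factor (Λ := Λ) (p := r)
        (add_tsub_cancel_of_le (e_le_iff.2 hri)).symm
      rw [KPath.rng_mul hβs] at hr
      rw [← liftX_cls hβs, ← mul_apply_eq_comp, hfix β (mem_edges.2 ⟨hr, hβ⟩)]
    refine lift_ext fun p ξ => ?_
    by_cases hp : v = p.rng
    · rw [liftX_id_cls hp]
      by_cases hpi : 1 ≤ Λ.d p i
      · exact (hfix' p ξ hp.symm hpi).symm
      · have hpi0 : Λ.d p i = 0 := by omega
        have hN : (Λ.edges p.src i).Nonempty :=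
          edges_nonempty.2 (exists_edge_of_path p hpi0 (hp ▸ edges_nonempty.1 hi))
        rw [cls_caret hN, map_sum]
        refine Finset.sum_congr rfl fun α hα => ?_
        have hα' : p.src = α.rng := (mem_edges.1 hα).1.symm
        rw [hfix' _ _ (by rw [KPath.rng_mul hα', hp])]
        rw [d_mul hα', (mem_edges.1 hα).2]
        simp [e_same]
    · rw [liftX_cls' hp, sum_apply, Finset.sum_eq_zero]
      intro α hα
      have h1 : M.liftX α = M.liftX (KPath.id v) * M.liftX α := by
        rw [liftX_mul (hsrc α hα), KPath.id_mul (hsrc α hα)]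
      have h2 : star (M.liftX α) = star (M.liftX α) * M.liftX (KPath.id v) := by
        conv_lhs => rw [h1]
        rw [star_mul, (liftX_proj v).isSelfAdjoint.star_eq]
      rw [h2, mul_apply_eq_comp, mul_apply_eq_comp, liftX_cls' hp, map_zero, map_zero]

theorem liftX_nondeg (x : M.Lift) : HasSum (fun v : V => M.liftX (KPath.id v) x) x := by
  classical
  have hP : ∀ F : Finset V, ‖∑ v ∈ F, M.liftX (KPath.id v)‖ ≤ 1 := fun F => by
    have : IsStarProjection (∑ v ∈ F, M.liftX (KPath.id v)) := by
      refine ⟨?_, ?_⟩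
      · rw [IsIdempotentElem, Finset.sum_mul_sum]
        refine Finset.sum_congr rfl fun v hv => ?_
        rw [Finset.sum_eq_single_of_mem v hv]
        · exact (liftX_proj v).isIdempotentElem
        · exact fun w _ hw => M.liftX_isCKFamily.orth v w hw.symm
      · exact isSelfAdjoint_sum _ fun v _ => (liftX_proj v).isSelfAdjoint
    exact this.norm_le
  have hpre : ∀ f : M.Pre, HasSum (fun v : V => M.liftX (KPath.id v) (f : M.Lift)) (f : M.Lift) := by
    intro f
    induction f using pre_induction with
    | h0 =>
      simp only [Completion.coe_zero, map_zero]
      exact hasSum_zero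
    | ha f g hf hg =>
      simp only [Completion.coe_add, map_add]
      exact hf.add hg
    | hs p ξ =>
      have h := hasSum_single (f := fun v : V => M.liftX (KPath.id v) (M.cls p ξ)) p.rng
        fun v hv => liftX_cls' hv ξ
      rwa [liftX_id_cls rfl] at h
  rw [HasSum, Metric.tendsto_nhds]
  intro ε hε
  obtain ⟨f, hf⟩ := Completion.denseRange_coe.exists_dist_lt x (ε := ε / 3) (by positivity)
  have h1 := hpre f
  rw [HasSum, Metric.tendsto_nhds] at h1
  filter_upwards [h1 (ε / 3) (by positivity)] with F hF
  have e1 : ∀ y : M.Lift, ∑ v ∈ F, M.liftX (KPath.id v) y = (∑ v ∈ F, M.liftX (KPath.id v)) y :=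
    fun y => (sum_apply _ _ _).symm
  rw [e1] at hF ⊢
  have h2 : dist ((∑ v ∈ F, M.liftX (KPath.id v)) x) ((∑ v ∈ F, M.liftX (KPath.id v)) f) ≤
      dist x f := by
    rw [dist_eq_norm, ← map_sub, dist_eq_norm]
    refine (ContinuousLinearMap.le_opNorm _ _).trans ?_
    exact (mul_le_mul_of_nonneg_right (hP F) (norm_nonneg _)).trans (one_mul _).le
  calc dist ((∑ v ∈ F, M.liftX (KPath.id v)) x) x
      ≤ dist ((∑ v ∈ F, M.liftX (KPath.id v)) x) ((∑ v ∈ F, M.liftX (KPath.id v)) f) +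
        dist ((∑ v ∈ F, M.liftX (KPath.id v)) f) f + dist (f : M.Lift) x := dist_triangle4 _ _ _ _
    _ < ε := by rw [dist_comm (f : M.Lift) x]; linarith

/-- The Pythagorean functor on objects: the representation `Π(H)` of `O_Λ` on `L` in which `x_μ`
acts by `[λ, ξ] ↦ [μλ, ξ]` if `r(λ) = s(μ)`, and `[λ, ξ] ↦ 0` otherwise. -/
def Pi (M : Λ.AModule) : Λ.ORep where
  H := M.Lift
  π := UniversalCStar.lift Λ.ckRel_bound ⟨M.Lift, M.liftX, M.liftX_isCKFamily⟩
  nondeg := liftX_nondeg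

end AModule

/-! ### Pythagorean dimension -/

namespace ORep

/-- `L` has finite Pythagorean dimension if `L ≃ Π(K)` for some finite dimensional module `K`. -/
def HasFinitePdim (L : Λ.ORep) : Prop :=
  ∃ K : Λ.AModule, FiniteDimensional ℂ K.H ∧ K.Pi.Iso L

/-- `L` has finite Pythagorean dimension, and its Pythagorean dimension vector, i.e. the usual
dimension vector of `Σ(L)`, is `δ`. -/
def HasPdimVec (L : Λ.ORep) (δ : V → ℕ∞) : Prop := L.HasFinitePdim ∧ L.Sigma.dimVec = δ

end ORep

/-! ### Classes of irreducibles -/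

theorem AModule.iso_equivalence : Equivalence (AModule.Iso (Λ := Λ)) where
  refl M := ⟨ContinuousLinearEquiv.refl ℂ _, fun _ _ => rfl⟩
  symm := by
    rintro M N ⟨θ, h⟩
    refine ⟨θ.symm, fun b ξ => θ.injective ?_⟩
    rw [h, θ.apply_symm_apply, θ.apply_symm_apply]
  trans := by
    rintro M N K ⟨θ, h⟩ ⟨θ', h'⟩
    exact ⟨θ.trans θ', fun b ξ => by simp [h, h']⟩

variable (Λ)

/-- The irreducible `A_Λ`-modules with usual dimension vector `δ`. -/
def IrrMod (δ : V → ℕ∞) : Type (u + 1) :=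
  {M : Λ.AModule // M.Irreducible ∧ M.dimVec = δ}

/-- The irreducible representations of `O_Λ` with Pythagorean dimension vector `δ`. -/
def IrrRep (δ : V → ℕ∞) : Type (u + 1) :=
  {L : Λ.ORep // L.Irreducible ∧ L.HasPdimVec δ}

/-- Isomorphism of modules. -/
instance irrModSetoid (δ : V → ℕ∞) : Setoid (Λ.IrrMod δ) where
  r M N := M.1.Iso N.1
  iseqv := ⟨fun M => AModule.iso_equivalence.refl M.1, AModule.iso_equivalence.symm,
    AModule.iso_equivalence.trans⟩

/-- Isomorphism of representations. -/
instance irrRepSetoid (δ : V → ℕ∞) : Setoid (Λ.IrrRep δ) where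
  r L L' := L.1.Iso L'.1
  iseqv := ⟨fun L => ORep.iso_equivalence.refl L.1, ORep.iso_equivalence.symm,
    ORep.iso_equivalence.trans⟩

/-- Isomorphism classes of irreducible `A_Λ`-modules with usual dimension vector `δ`. -/
abbrev IrrModClasses (δ : V → ℕ∞) : Type (u + 1) := Quotient (Λ.irrModSetoid δ)

/-- Isomorphism classes of irreducible representations of `O_Λ` with Pythagorean dimension
vector `δ`. -/
abbrev IrrRepClasses (δ : V → ℕ∞) : Type (u + 1) := Quotient (Λ.irrRepSetoid δ)

end KGraph

end

/-! The argument runs through cores. A core of a representation `L` is a nonzero finite-dimensional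
subspace `S`, invariant under the operators `X_λ^*`, minimal among such nonzero subspaces, and
generating in the sense that the vectors `X_λ η` with `η ∈ S` span a dense subspace.

The decisive fact is `Generates.exists_mem_inter`: a finite-dimensional generating submodule meets
every nonzero submodule `T`. Indeed, a vector of `T` is close to the orbit of `S`, and far out along
`Λ^{≤ m}` the operators `X_t^*` carry the orbit into `S`. The Pythagorean identity preserves the
total squared norm, so for some `t` the relative error of `X_t^*` of the vector is small. This gives
unit vectors of `T` arbitrarily near `S`, and compactness of balls in `S` yields a common nonzero
vector. By minimality a core then lies in every nonzero submodule (`IsCore.le`).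

Consequences: complete submodules are nonzero, because squared norms add up along trees; generating
submodules are complete, because `Λ^{≤ m}` is a tree. Hence a core is the smallest complete
submodule, and a representation with a core is irreducible. Conversely, if `L` is irreducible and of
the form `Π(K)` with `K` finite-dimensional, the image of `K` contains nonzero submodules, and one
of least dimension is a core: its closed orbit is invariant under `O_Λ`, so it is everything.

The link with `Π` is `pi_iso_of_generates`. The squared norm on `Π(M)` is a sum of squared norms of
coordinates along `Λ^{≤ m}`, and an intertwiner `j : M → L` acts coordinatewise. So bounds for `j`
above and below pass to its extension `Π(M) → L`, which is an isomorphism when `j` is injective with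
generating range. Together with the canonical embedding of `M` in `Π(M)` (`exists_embedding`), whose
range is a core if `M` is irreducible (`isCore_rangeSub`), this gives `M ≅ Σ(Π(M))` and `Π(Σ(L)) ≅
L`, as well as compatibility with isomorphisms, which need not be unitary. -/

noncomputable section

/-! ### Induction on generators -/

section Universal

variable {ι : Type u} {R : OpRelations ι} {hR : ∀ (F : OpFamily R) (i : ι), ‖F.op i‖ ≤ 1}

/-- A closed property of elements of a universal C*-algebra holds everywhere if it is stable under
the operations and holds for the generators and their adjoints. -/
theorem UniversalCStar.induction_on {P : UniversalCStar hR → Prop}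
    (closed : IsClosed {b | P b}) (gen : ∀ i, P (UniversalCStar.gen hR i))
    (star_gen : ∀ i, P (star (UniversalCStar.gen hR i))) (zero : P 0)
    (add : ∀ b c, P b → P c → P (b + c)) (mul : ∀ b c, P b → P c → P (b * c))
    (smul : ∀ (z : ℂ) b, P b → P (z • b)) (b : UniversalCStar hR) : P b := by
  let C : NonUnitalSubalgebra ℂ (UniversalCStar hR) :=
    { carrier := {b | P b}
      add_mem' := fun {b c} hb hc => add b c hb hc
      zero_mem' := zero
      mul_mem' := fun {b c} hb hc => mul b c hb hc
      smul_mem' := fun z b hb => smul z b hb }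
  let ν : UniversalCStar hR →ₙₐ[ℂ] OpProduct R :=
    NonUnitalSubalgebraClass.subtype (opSubalgebra hR)
  -- The comparison takes place in the ambient product: as a plain algebra, the generated star
  -- subalgebra is generated by the generators together with their adjoints.
  have hle : (NonUnitalStarAlgebra.adjoin ℂ (Set.range (opGen hR))).toNonUnitalSubalgebra ≤
      C.map ν := by
    rw [NonUnitalStarAlgebra.adjoin_toNonUnitalSubalgebra, NonUnitalAlgebra.adjoin_le_iff]
    rintro y (⟨i, rfl⟩ | ⟨i, hi⟩)
    · exact ⟨UniversalCStar.gen hR i, gen i, rfl⟩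
    · refine ⟨star (UniversalCStar.gen hR i), star_gen i, ?_⟩
      rw [← star_star y, ← hi]
      rfl
  have hb : b ∈ closure {b | P b} := by
    refine closure_subtype.2 ?_
    refine closure_mono ?_ (show (b.1 : OpProduct R) ∈ closure _ from b.2)
    intro y hy
    obtain ⟨c, hc, rfl⟩ := hle hy
    exact ⟨c, hc, rfl⟩
  exact closed.closure_subset hb

end Universal

namespace KGraph

variable {k : ℕ} {V : Type u} [SmallCategory V] {Λ : KGraph k V} [Λ.RowFinite]

/-- The analogue for the non-self-adjoint algebra. No clause for adjoints appears, since `A_Λ` is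
the closure of the polynomials in the `a_λ` alone. -/
theorem A_induction [Λ.LocallyConvex] {P : Λ.A → Prop} (closed : IsClosed {b | P b})
    (gen : ∀ p, P (Λ.a p)) (zero : P 0) (add : ∀ b c, P b → P c → P (b + c))
    (mul : ∀ b c, P b → P c → P (b * c)) (smul : ∀ (z : ℂ) b, P b → P (z • b)) (b : Λ.A) :
    P b := by
  let C : NonUnitalSubalgebra ℂ Λ.A :=
    { carrier := {b | P b}
      add_mem' := fun {b c} hb hc => add b c hb hc
      zero_mem' := zero
      mul_mem' := fun {b c} hb hc => mul b c hb hc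
      smul_mem' := fun z b hb => smul z b hb }
  have hle : NonUnitalAlgebra.adjoin ℂ (Set.range Λ.aP) ≤
      C.map (NonUnitalSubalgebraClass.subtype Λ.A) := by
    rw [NonUnitalAlgebra.adjoin_le_iff]
    rintro y ⟨p, rfl⟩
    exact ⟨Λ.a p, gen p, rfl⟩
  have hb : b ∈ closure {b | P b} := by
    refine closure_subtype.2 (closure_mono ?_ (show (b : Λ.P) ∈ closure _ from b.2))
    intro y hy
    obtain ⟨c, hc, rfl⟩ := hle hy
    exact ⟨c, hc, rfl⟩
  exact closed.closure_subset hb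

/-! ### Invariance and intertwining tested on generators. -/

namespace ORep

theorem π_continuous (L : Λ.ORep) : Continuous L.π :=
  AddMonoidHomClass.continuous_of_bound L.π 1 fun b => by
    rw [one_mul]; exact NonUnitalStarAlgHom.norm_apply_le L.π b

theorem invariant_of_X {L : Λ.ORep} {S : Submodule ℂ L.H} (hS : IsClosed (S : Set L.H))
    (hX : ∀ p, ∀ ξ ∈ S, L.X p ξ ∈ S) (hX' : ∀ p, ∀ ξ ∈ S, star (L.X p) ξ ∈ S) (b : Λ.O) :
    ∀ ξ ∈ S, L.π b ξ ∈ S := by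
  induction b using UniversalCStar.induction_on with
  | closed =>
    simp only [Set.ofPred_forall]
    refine isClosed_iInter fun ξ => isClosed_iInter fun _ => hS.preimage ?_
    exact (ContinuousLinearMap.apply ℂ L.H ξ).continuous.comp L.π_continuous
  | gen p => exact hX p
  | star_gen p =>
    intro ξ hξ
    rw [map_star]
    exact hX' p ξ hξ
  | zero => intro ξ _; rw [map_zero]; exact S.zero_mem
  | add b c hb hc => intro ξ hξ; rw [map_add]; exact S.add_mem (hb ξ hξ) (hc ξ hξ)
  | mul b c hb hc => intro ξ hξ; rw [map_mul]; exact hb _ (hc ξ hξ)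
  | smul z b hb => intro ξ hξ; rw [map_smul]; exact S.smul_mem z (hb ξ hξ)

/-- The adjoints need a hypothesis of their own because `θ` is merely bounded. It is supplied later
by `IsCKFamily.intertwine_star`. -/
theorem intertwine_of_X {L L' : Λ.ORep} {θ : L.H →L[ℂ] L'.H}
    (hX : ∀ p ξ, θ (L.X p ξ) = L'.X p (θ ξ))
    (hX' : ∀ p ξ, θ (star (L.X p) ξ) = star (L'.X p) (θ ξ)) (b : Λ.O) :
    ∀ ξ, θ (L.π b ξ) = L'.π b (θ ξ) := by
  induction b using UniversalCStar.induction_on with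
  | closed =>
    simp only [Set.ofPred_forall]
    refine isClosed_iInter fun ξ => isClosed_eq ?_ ?_
    · exact θ.continuous.comp
        ((ContinuousLinearMap.apply ℂ L.H ξ).continuous.comp L.π_continuous)
    · exact (ContinuousLinearMap.apply ℂ L'.H (θ ξ)).continuous.comp L'.π_continuous
  | gen p => exact hX p
  | star_gen p =>
    intro ξ
    rw [map_star, map_star]
    exact hX' p ξ
  | zero => intro ξ; simp
  | add b c hb hc => intro ξ; simp [hb, hc]
  | mul b c hb hc => intro ξ; simp [hb, hc]
  | smul z b hb => intro ξ; simp [hb]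

end ORep

namespace AModule

variable [Λ.LocallyConvex]

theorem invariant_of_A {M : Λ.AModule} {S : Submodule ℂ M.H} (hS : IsClosed (S : Set M.H))
    (hA : ∀ p, ∀ ξ ∈ S, M.A p ξ ∈ S) (b : Λ.A) : ∀ ξ ∈ S, M.π b ξ ∈ S := by
  induction b using A_induction with
  | closed =>
    simp only [Set.ofPred_forall]
    refine isClosed_iInter fun ξ => isClosed_iInter fun _ => hS.preimage ?_
    exact (ContinuousLinearMap.apply ℂ M.H ξ).continuous.comp M.cont
  | gen p => exact hA p
  | zero => intro ξ _; rw [map_zero]; exact S.zero_mem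
  | add b c hb hc => intro ξ hξ; rw [map_add]; exact S.add_mem (hb ξ hξ) (hc ξ hξ)
  | mul b c hb hc => intro ξ hξ; rw [map_mul]; exact hb _ (hc ξ hξ)
  | smul z b hb => intro ξ hξ; rw [map_smul]; exact S.smul_mem z (hb ξ hξ)

theorem intertwine_of_A {M N : Λ.AModule} {θ : M.H →L[ℂ] N.H}
    (hA : ∀ p ξ, θ (M.A p ξ) = N.A p (θ ξ)) (b : Λ.A) : ∀ ξ, θ (M.π b ξ) = N.π b (θ ξ) := by
  induction b using A_induction with
  | closed =>
    simp only [Set.ofPred_forall]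
    refine isClosed_iInter fun ξ => isClosed_eq ?_ ?_
    · exact θ.continuous.comp ((ContinuousLinearMap.apply ℂ M.H ξ).continuous.comp M.cont)
    · exact (ContinuousLinearMap.apply ℂ N.H (θ ξ)).continuous.comp N.cont
  | gen p => exact hA p
  | zero => intro ξ; simp
  | add b c hb hc => intro ξ; simp [hb, hc]
  | mul b c hb hc => intro ξ; simp [hb, hc]
  | smul z b hb => intro ξ; simp [hb]

/-- A closed subspace that is invariant under the operators `A_λ`, as a submodule. -/
def Sub.ofA {M : Λ.AModule} (S : Submodule ℂ M.H) (hS : IsClosed (S : Set M.H))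
    (hA : ∀ p, ∀ ξ ∈ S, M.A p ξ ∈ S) : M.Sub :=
  { S with
    closed := hS
    invariant := invariant_of_A hS hA }

@[simp] theorem Sub.ofA_toSubmodule {M : Λ.AModule} {S : Submodule ℂ M.H}
    (hS : IsClosed (S : Set M.H)) (hA : ∀ p, ∀ ξ ∈ S, M.A p ξ ∈ S) :
    (Sub.ofA S hS hA).toSubmodule = S := rfl

theorem Sub.toSubmodule_injective {M : Λ.AModule} {S T : M.Sub}
    (h : S.toSubmodule = T.toSubmodule) : S = T := by
  cases S; cases T; cases h; rfl

end AModule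

/-! ### Paths of maximal degree -/

section Paths

variable [Λ.LocallyConvex]

theorem rng_of_mem_lePaths {v : V} {m : Fin k → ℕ} {p : KPath V} (h : p ∈ Λ.lePaths v m) :
    p.rng = v := (mem_pathsLE.1 (mem_lePaths.1 h)).1

/-- A sum over `v Λ^{≤ m}` to which only the extensions of `p` contribute. -/
theorem sum_lePaths_extending {E : Type*} [AddCommMonoid E] {p : KPath V} {m : Fin k → ℕ}
    (hp : Λ.d p ≤ m) {g : KPath V → E}
    (hg : ∀ t ∈ Λ.lePaths p.rng m, (¬ ∃ q : KPath V, p.src = q.rng ∧ p * q = t) → g t = 0) :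
    ∑ t ∈ Λ.lePaths p.rng m, g t = ∑ q ∈ Λ.lePaths p.src (m - Λ.d p), g (p * q) := by
  classical
  obtain ⟨n, rfl⟩ : ∃ n, m = Λ.d p + n := ⟨m - Λ.d p, (add_tsub_cancel_of_le hp).symm⟩
  rw [add_tsub_cancel_left]
  have hmem : ∀ q ∈ Λ.lePaths p.src n, p.src = q.rng := fun q hq => (rng_of_mem_lePaths hq).symm
  have hinj : Set.InjOn (fun q => p * q) (Λ.lePaths p.src n : Set (KPath V)) :=
    fun q hq q' hq' h => Λ.mul_left_cancel (hmem q hq) (hmem q' hq') h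
  rw [← Finset.sum_image (f := g) hinj]
  symm
  refine Finset.sum_subset (fun t ht => ?_) (fun t ht ht' => hg t ht ?_)
  · obtain ⟨q, hq, rfl⟩ := Finset.mem_image.1 ht
    exact mem_lePaths.2 ((mul_mem_pathsLE_iff (hmem q hq)).2 (mem_lePaths.1 hq))
  · rintro ⟨q, hq, rfl⟩
    exact ht' (Finset.mem_image.2
      ⟨q, mem_lePaths.2 ((mul_mem_pathsLE_iff hq).1 (mem_lePaths.1 ht)), rfl⟩)

/-- `Λ^{≤ m}` is a tree. -/
theorem isTree_pathsLE (v : V) (m : Fin k → ℕ) : Λ.IsTree v (Λ.pathsLE v m) := by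
  classical
  induction m using degree_induction with
  | h0 => rw [pathsLE_zero]; exact IsTree.trivial
  | hs m i ih =>
    -- A tree grows by one caret at a time, so the leaves of `Λ^{≤ m}` are grafted one by one, `F`
    -- being the set of leaves already treated.
    have key : ∀ F : Finset (KPath V), F ⊆ Λ.lePaths v m →
        Λ.IsTree v ((Λ.pathsLE v m \ F) ∪
          ⋃ p ∈ F, (fun q => p * q) '' Λ.pathsLE p.src (e i)) := by
      intro F
      induction F using Finset.induction_on with
      | empty => intro _; simpa using ih
      | insert μ F hμ hF =>
        intro hsub
        have hμm : μ ∈ Λ.pathsLE v m := mem_lePaths.1 (hsub (Finset.mem_insert_self _ _))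
        have hFm : ∀ p ∈ F, p ∈ Λ.pathsLE v m :=
          fun p hp => mem_lePaths.1 (hsub (Finset.mem_insert_of_mem hp))
        -- Removing the leaf `μ` must not remove a path grafted earlier. If `μ = pq` with `p ∈ Λ^{≤
        -- m}`, then maximality of `p` forces `d(q) = 0`, hence `μ = p ∈ F`.
        have hnot : ∀ p ∈ F, μ ∉ (fun q => p * q) '' Λ.pathsLE p.src (e i) := by
          rintro p hp ⟨q, hq, rfl⟩
          have hpq : p.src = q.rng := (mem_pathsLE.1 hq).1.symm
          have h0 : Λ.d q = 0 := (hFm p hp).2.2 q hpq hμm.2.1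
          have hq0 := eq_id_of_d_eq_zero h0
          refine hμ ?_
          have : p * q = p := by rw [hq0, ← hpq]; exact KPath.mul_id rfl
          change p * q ∈ F
          rw [this]
          exact hp
        have h := IsTree.graft _ μ i (hF fun p hp => hsub (Finset.mem_insert_of_mem hp))
          (Or.inl ⟨hμm, hμ⟩)
        convert h using 1
        ext t
        simp only [Set.mem_union, Set.mem_sdiff, Set.mem_iUnion, Finset.coe_insert,
          Finset.mem_insert, Set.mem_insert_iff, Finset.mem_coe, Set.mem_singleton_iff]
        constructor
        · rintro (⟨h1, h2⟩ | ⟨p, rfl | hp, ht⟩)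
          · exact Or.inl ⟨Or.inl ⟨h1, fun h => h2 (Or.inr h)⟩, fun h => h2 (Or.inl h)⟩
          · exact Or.inr ht
          · refine Or.inl ⟨Or.inr ⟨p, hp, ht⟩, ?_⟩
            rintro rfl
            exact hnot p hp ht
        · rintro (⟨⟨h1, h2⟩ | ⟨p, hp, ht⟩, h3⟩ | ht)
          · exact Or.inl ⟨h1, fun h => h.elim h3 h2⟩
          · exact Or.inr ⟨p, Or.inr hp, ht⟩
          · exact Or.inr ⟨μ, Or.inl rfl, ht⟩
    convert key (Λ.lePaths v m) le_rfl using 1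
    ext t
    constructor
    · intro ht
      obtain ⟨p, q, hp, hq, rfl⟩ := exists_mul_of_mem_pathsLE ht
      exact Or.inr (Set.mem_biUnion (mem_lePaths.2 hp) ⟨q, hq, rfl⟩)
    · rintro (⟨h1, h2⟩ | ht)
      · exact absurd (mem_lePaths.2 h1) h2
      · obtain ⟨p, hp, q, hq, rfl⟩ := Set.mem_iUnion₂.1 ht
        exact mul_mem_pathsLE (mem_lePaths.1 hp) hq

/-- The Pythagorean identity: the relation for `vΛ^{≤ m}` evaluated in the quadratic form at `ξ`. -/
theorem IsPyFamily.sum_norm_sq_apply {H : Type*} [NormedAddCommGroup H] [InnerProductSpace ℂ H]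
    [CompleteSpace H] {a : KPath V → H →L[ℂ] H} (h : Λ.IsPyFamily a) (v : V) (m : Fin k → ℕ)
    (ξ : H) : ∑ p ∈ Λ.lePaths v m, ‖a p ξ‖ ^ 2 = ‖a (KPath.id v) ξ‖ ^ 2 := by
  have h1 := sum_norm_sq (h.sum v m) ξ ξ
  have h2 : (inner ℂ ξ (a (KPath.id v) ξ) : ℂ) =
      inner ℂ (a (KPath.id v) ξ) (a (KPath.id v) ξ) := by
    rw [← ContinuousLinearMap.adjoint_inner_right, ← ContinuousLinearMap.star_eq_adjoint,
      (h.proj v).isSelfAdjoint.star_eq, ← mul_apply_eq_comp, (h.proj v).isIdempotentElem.eq]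
  rw [h2] at h1
  simp only [inner_self_eq_norm_sq_to_K] at h1
  exact_mod_cast h1

/-- Along every tree at `v` the squared norms add up. -/
theorem IsTree.finsum_norm_sq {M : Λ.AModule} {v : V} {t : Set (KPath V)} (ht : Λ.IsTree v t)
    {ξ : M.H} (hξ : M.A (KPath.id v) ξ = ξ) : ∑ᶠ μ ∈ t, ‖M.A μ ξ‖ ^ 2 = ‖ξ‖ ^ 2 := by
  classical
  -- The induction also carries finiteness and prefix-freeness: distinct leaves have no common
  -- extension. Without it a grafted path could coincide with an old leaf and the sum would lose a
  -- term.
  suffices h : ∃ F : Finset (KPath V), (F : Set (KPath V)) = t ∧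
      (∀ μ ∈ F, ∀ ν ∈ F, μ ≠ ν → ∀ a b : KPath V, μ.src = a.rng → ν.src = b.rng →
        μ * a ≠ ν * b) ∧ ∑ μ ∈ F, ‖M.A μ ξ‖ ^ 2 = ‖ξ‖ ^ 2 by
    obtain ⟨F, rfl, -, hF⟩ := h
    rw [finsum_mem_coe_finset, hF]
  induction ht with
  | trivial => exact ⟨{KPath.id v}, by simp, by simp, by simp [hξ]⟩
  | graft t μ i _ hμ ih =>
    obtain ⟨F, rfl, hanti, hsum⟩ := ih
    have hmem : ∀ q ∈ Λ.lePaths μ.src (e i), μ.src = q.rng :=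
      fun q hq => (rng_of_mem_lePaths hq).symm
    have hinj : Set.InjOn (fun q => μ * q) (Λ.lePaths μ.src (e i) : Set (KPath V)) :=
      fun q hq q' hq' h => Λ.mul_left_cancel (hmem q hq) (hmem q' hq') h
    -- A caret consists of edges of degree `e_i` or of the vertex alone, so its degree is constant
    -- and unique factorisation separates its elements.
    have hd : ∀ q ∈ Λ.lePaths μ.src (e i), ∀ q' ∈ Λ.lePaths μ.src (e i), Λ.d q = Λ.d q' := by
      intro q hq q' hq'
      by_cases hN : (Λ.edges μ.src i).Nonempty
      · rw [lePaths_e_of_nonempty hN] at hq hq'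
        rw [(mem_edges.1 hq).2, (mem_edges.1 hq').2]
      · rw [lePaths_e_of_empty hN, Finset.mem_singleton] at hq hq'
        rw [hq, hq']
    refine ⟨F.erase μ ∪ (Λ.lePaths μ.src (e i)).image (fun q => μ * q), ?_, ?_, ?_⟩
    · ext p
      simp [and_comm]
    · have hmix : ∀ q ∈ Λ.lePaths μ.src (e i), ∀ ν ∈ F.erase μ, ∀ a b : KPath V,
          (μ * q).src = a.rng → ν.src = b.rng → μ * q * a ≠ ν * b := by
        intro q hq ν hν a b ha hb
        rw [KPath.src_mul (hmem q hq)] at ha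
        rw [KPath.assoc (hmem q hq) ha]
        exact hanti μ hμ ν (Finset.mem_of_mem_erase hν) (Finset.ne_of_mem_erase hν).symm _ _
          (by rw [KPath.rng_mul ha, hmem q hq]) hb
      intro p hp p' hp' hne a b ha hb
      rcases Finset.mem_union.1 hp with h | h <;> rcases Finset.mem_union.1 hp' with h' | h'
      · exact hanti p (Finset.mem_of_mem_erase h) p' (Finset.mem_of_mem_erase h') hne a b ha hb
      · obtain ⟨q, hq, rfl⟩ := Finset.mem_image.1 h'
        exact (hmix q hq p h b a hb ha).symm
      · obtain ⟨q, hq, rfl⟩ := Finset.mem_image.1 h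
        exact hmix q hq p' h' a b ha hb
      · obtain ⟨q, hq, rfl⟩ := Finset.mem_image.1 h
        obtain ⟨q', hq', rfl⟩ := Finset.mem_image.1 h'
        intro heq
        refine hne (factor_unique (Λ := Λ) ha hb heq ?_).1
        rw [d_mul (hmem q hq), d_mul (hmem q' hq'), hd q hq q' hq']
    -- The contribution of `μ` is redistributed over its caret by the Pythagorean identity at `A_μ
    -- ξ`.
    · rw [Finset.sum_union, Finset.sum_image hinj, ← hsum, ← Finset.sum_erase_add F _ hμ]
      · congr 1
        have h := M.A_isPyFamily.sum_norm_sq_apply μ.src (e i) (M.A μ ξ)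
        rw [AModule.A_mul rfl, KPath.mul_id rfl] at h
        rw [← h]
        exact Finset.sum_congr rfl fun q hq => by rw [AModule.A_mul (hmem q hq)]
      · rw [Finset.disjoint_left]
        intro p hp hp'
        obtain ⟨q, hq, rfl⟩ := Finset.mem_image.1 hp'
        refine hanti μ hμ _ (Finset.mem_of_mem_erase hp) (Finset.ne_of_mem_erase hp).symm q
          (KPath.id q.src) (hmem q hq) (KPath.src_mul (hmem q hq)) ?_
        exact (KPath.mul_id (KPath.src_mul (hmem q hq))).symm

end Paths

end KGraph

namespace KGraph

variable {k : ℕ} {V : Type u} [SmallCategory V] {Λ : KGraph k V} [Λ.RowFinite]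

/-! ### Cuntz–Krieger families -/

namespace IsCKFamily

section Algebra

variable {B : Type*} [NonUnitalRing B] [StarRing B] {x : KPath V → B} (h : Λ.IsCKFamily x)

include h

theorem mul_id_src (p : KPath V) : x p * x (KPath.id p.src) = x p := by
  rw [h.mul p _ rfl, KPath.mul_id rfl]

theorem id_rng_mul (p : KPath V) : x (KPath.id p.rng) * x p = x p := by
  rw [h.mul _ p rfl, KPath.id_mul rfl]

theorem star_mul_id_rng (p : KPath V) : star (x p) * x (KPath.id p.rng) = star (x p) := by
  conv_rhs => rw [← h.id_rng_mul p, star_mul, (h.proj _).isSelfAdjoint.star_eq]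

theorem id_src_mul_star (p : KPath V) : x (KPath.id p.src) * star (x p) = star (x p) := by
  conv_rhs => rw [← h.mul_id_src p, star_mul, (h.proj _).isSelfAdjoint.star_eq]

theorem star_mul_mul {p q : KPath V} (hpq : p.src = q.rng) : star (x p) * x (p * q) = x q := by
  rw [← h.mul p q hpq, ← mul_assoc, h.isom, hpq, h.id_rng_mul]

theorem star_mul_eq_zero_of_rng {p q : KPath V} (hpq : p.rng ≠ q.rng) : star (x p) * x q = 0 := by
  rw [← h.star_mul_id_rng p, ← h.id_rng_mul q, mul_assoc, ← mul_assoc (x (KPath.id p.rng)),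
    h.orth _ _ hpq, zero_mul, mul_zero]

theorem sum_lePaths [Λ.LocallyConvex] (v : V) (m : Fin k → ℕ) :
    ∑ p ∈ Λ.lePaths v m, x p * star (x p) = x (KPath.id v) := by
  have h1 := h.star_isPyFamily.sum v m
  simpa only [star_star, (h.proj v).isSelfAdjoint.star_eq] using h1

end Algebra

variable {H : Type*} [NormedAddCommGroup H] [InnerProductSpace ℂ H] [CompleteSpace H]
  {x : KPath V → H →L[ℂ] H} (h : Λ.IsCKFamily x)

include h

/-- `x_p` is a partial isometry with initial projection `x_{s(p)}`, so both squares are `⟨ξ,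
x_{s(p)} ξ⟩`. -/
theorem norm_apply_sq (p : KPath V) (ξ : H) : ‖x p ξ‖ ^ 2 = ‖x (KPath.id p.src) ξ‖ ^ 2 := by
  have h1 : ∀ q : KPath V, (inner ℂ (x q ξ) (x q ξ) : ℂ) = inner ℂ ξ (x (KPath.id q.src) ξ) := by
    intro q
    rw [← ContinuousLinearMap.adjoint_inner_right, ← ContinuousLinearMap.star_eq_adjoint,
      ← mul_apply_eq_comp, h.isom]
  have h2 := (h1 p).trans (h1 (KPath.id p.src)).symm
  simp only [inner_self_eq_norm_sq_to_K] at h2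
  exact_mod_cast h2

theorem norm_id_le (v : V) (ξ : H) : ‖x (KPath.id v) ξ‖ ≤ ‖ξ‖ :=
  ((x (KPath.id v)).le_of_opNorm_le (h.norm_le _) ξ).trans (one_mul _).le

variable [Λ.LocallyConvex]

theorem sum_norm_sq_star (v : V) (m : Fin k → ℕ) (ξ : H) :
    ∑ p ∈ Λ.lePaths v m, ‖star (x p) ξ‖ ^ 2 = ‖x (KPath.id v) ξ‖ ^ 2 := by
  rw [h.star_isPyFamily.sum_norm_sq_apply v m ξ, (h.proj v).isSelfAdjoint.star_eq]

/-- The ranges of the isometries of `Λ^{≤ m}` are orthogonal. -/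
theorem star_mul_eq_zero_of_ne {v v' : V} {m : Fin k → ℕ} {t t' : KPath V}
    (ht : t ∈ Λ.lePaths v m) (ht' : t' ∈ Λ.lePaths v' m) (hne : t ≠ t') :
    star (x t) * x t' = 0 := by
  classical
  by_cases hr : t.rng = t'.rng
  · obtain rfl : v = t.rng := (rng_of_mem_lePaths ht).symm
    obtain rfl : v' = t.rng := (rng_of_mem_lePaths ht').symm.trans hr.symm
    ext ξ
    -- In the norm identity for the vector `x_{t'} ξ` the term of `t'` already exhausts the total,
    -- so all other terms vanish.
    have h1 := h.sum_norm_sq_star t.rng m (x t' ξ)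
    rw [← Finset.add_sum_erase _ _ ht', ← mul_apply_eq_comp, ← mul_apply_eq_comp, h.isom,
      hr, h.id_rng_mul, h.norm_apply_sq t', add_eq_left] at h1
    have h2 := (Finset.sum_eq_zero_iff_of_nonneg fun _ _ => sq_nonneg _).1 h1 t
      (Finset.mem_erase.2 ⟨hne, hr ▸ ht⟩)
    rw [mul_apply_eq_comp]
    simpa using h2
  · exact h.star_mul_eq_zero_of_rng hr

/-- Inserting `x_{s(p)} = ∑ x_q x_q^*` pushes a path out to `Λ^{≤ d(p)+n}`, where distinct paths
have orthogonal ranges. -/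
theorem mul_eq_sum (p : KPath V) (n : Fin k → ℕ) :
    x p = ∑ q ∈ Λ.lePaths p.src n, x (p * q) * star (x q) := by
  conv_lhs => rw [← h.mul_id_src p, ← h.sum_lePaths p.src n, Finset.mul_sum]
  refine Finset.sum_congr rfl fun q hq => ?_
  rw [← mul_assoc, h.mul p q (rng_of_mem_lePaths hq).symm]

/-- A path of `Λ^{≤ m}` that does not extend the path `p` of degree at most `m` is orthogonal
to `p`. -/
theorem star_mul_eq_zero_of_not_extends {v : V} {m : Fin k → ℕ} {t p : KPath V}
    (ht : t ∈ Λ.lePaths v m) (hp : Λ.d p ≤ m)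
    (hn : ¬ ∃ q : KPath V, p.src = q.rng ∧ p * q = t) : star (x t) * x p = 0 := by
  rw [h.mul_eq_sum p (m - Λ.d p), Finset.mul_sum]
  refine Finset.sum_eq_zero fun q hq => ?_
  have hpq : p.src = q.rng := (rng_of_mem_lePaths hq).symm
  have hmem : p * q ∈ Λ.lePaths p.rng m := by
    rw [mem_lePaths, ← add_tsub_cancel_of_le hp]
    exact (mul_mem_pathsLE_iff hpq).2 (mem_lePaths.1 hq)
  rw [← mul_assoc, h.star_mul_eq_zero_of_ne ht hmem fun heq => hn ⟨q, hpq, heq.symm⟩, zero_mul]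

/-- A map that intertwines two families also intertwines their adjoints. -/
theorem intertwine_star {H' : Type*} [NormedAddCommGroup H'] [InnerProductSpace ℂ H']
    [CompleteSpace H'] {x' : KPath V → H' →L[ℂ] H'} (h' : Λ.IsCKFamily x') {θ : H →L[ℂ] H'}
    (hθ : ∀ p ξ, θ (x p ξ) = x' p (θ ξ)) (p : KPath V) (ξ : H) :
    θ (star (x p) ξ) = star (x' p) (θ ξ) := by
  have hp : p ∈ Λ.lePaths p.rng (Λ.d p) := mem_lePaths.2 (mem_pathsLE_self p)
  -- The vector `x_{r(p)} ξ` is resolved along `r(p)Λ^{≤ d(p)}` before `θ` is applied. Orthogonality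
  -- in the target then leaves only the term `t = p`.
  have h1 : star (x' p) (θ ξ) =
      ∑ t ∈ Λ.lePaths p.rng (Λ.d p), star (x' p) (x' t (θ (star (x t) ξ))) := by
    rw [← h'.star_mul_id_rng p, mul_apply_eq_comp, ← hθ, ← h.sum_lePaths p.rng (Λ.d p), sum_apply,
      map_sum, map_sum]
    refine Finset.sum_congr rfl fun t _ => ?_
    rw [mul_apply_eq_comp, hθ, h'.star_mul_id_rng]
  rw [h1, Finset.sum_eq_single_of_mem p hp]
  · rw [← mul_apply_eq_comp, h'.isom, ← hθ, ← mul_apply_eq_comp, h.id_src_mul_star]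
  · intro t ht hne
    rw [← mul_apply_eq_comp, h'.star_mul_eq_zero_of_ne hp ht hne.symm, zero_apply]

end IsCKFamily

/-! ### Generating subspaces -/

namespace ORep

variable {L : Λ.ORep}

variable (L) in
/-- The span of the vectors `X_λ η`, `η ∈ S`. -/
def orbit (S : Submodule ℂ L.H) : Submodule ℂ L.H :=
  Submodule.span ℂ {y | ∃ p : KPath V, ∃ η ∈ S, L.X p η = y}

variable (L) in
/-- `S` is generating if the vectors `X_λ η`, `η ∈ S`, span a dense subspace. -/
def Generates (S : Submodule ℂ L.H) : Prop := (L.orbit S).topologicalClosure = ⊤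

theorem X_mem_orbit {S : Submodule ℂ L.H} (p : KPath V) {η : L.H} (hη : η ∈ S) :
    L.X p η ∈ L.orbit S := Submodule.subset_span ⟨p, η, hη, rfl⟩

theorem exists_X_id_ne_zero {ξ : L.H} (hξ : ξ ≠ 0) : ∃ v, L.X (KPath.id v) ξ ≠ 0 := by
  by_contra hall
  push Not at hall
  refine hξ ((L.nondeg ξ).unique ?_)
  change HasSum (fun v => L.X (KPath.id v) ξ) 0
  simp only [hall]
  exact hasSum_zero

/-- The orbit of `S` is carried into the orbit of its image, and a continuous surjection preserves
density. -/
theorem Generates.map {L' : Λ.ORep} {S : Submodule ℂ L.H} (hS : L.Generates S) (θ : L.H ≃L[ℂ] L'.H)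
    (hθ : ∀ (b : Λ.O) (ξ : L.H), θ (L.π b ξ) = L'.π b (θ ξ)) :
    L'.Generates (S.map (θ : L.H →ₗ[ℂ] L'.H)) := by
  refine Submodule.dense_iff_topologicalClosure_eq_top.1 ?_
  refine Dense.mono ?_ (θ.surjective.denseRange.dense_image θ.continuous
    (Submodule.dense_iff_topologicalClosure_eq_top.2 hS))
  have h1 : L.orbit S ≤
      (L'.orbit (S.map (θ : L.H →ₗ[ℂ] L'.H))).comap (θ : L.H →ₗ[ℂ] L'.H) := by
    refine Submodule.span_le.2 ?_
    rintro _ ⟨p, η, hη, rfl⟩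
    change θ (L.X p η) ∈ L'.orbit _
    rw [X, hθ]
    exact X_mem_orbit p ⟨η, hη, rfl⟩
  rintro _ ⟨y, hy, rfl⟩
  exact h1 hy

variable [Λ.LocallyConvex]

/-- The underlying subspace of a submodule of `U(L)`, as a subspace of `L`. -/
def space (S : L.U.Sub) : Submodule ℂ L.H := S.toSubmodule

theorem isClosed_space (S : L.U.Sub) : IsClosed (space S : Set L.H) := S.closed

theorem space_injective {S T : L.U.Sub} (h : space S = space T) : S = T :=
  AModule.Sub.toSubmodule_injective h

/-- A closed subspace that is invariant under the operators `X_λ^*`, as a submodule of `U(L)`. -/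
def subOfStar (S : Submodule ℂ L.H) (hS : IsClosed (S : Set L.H))
    (hX : ∀ p, ∀ ξ ∈ S, star (L.X p) ξ ∈ S) : L.U.Sub := AModule.Sub.ofA (M := L.U) S hS hX

@[simp] theorem space_subOfStar {S : Submodule ℂ L.H} (hS : IsClosed (S : Set L.H))
    (hX : ∀ p, ∀ ξ ∈ S, star (L.X p) ξ ∈ S) : space (subOfStar S hS hX) = S := rfl

theorem sub_star_mem (S : L.U.Sub) (p : KPath V) {η : L.H} (hη : η ∈ space S) :
    star (L.X p) η ∈ space S := S.invariant (Λ.a p) η hη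

/-- Far out along the paths, the vectors of the orbit of `S` are mapped into `S`. -/
theorem exists_star_mem (S : L.U.Sub) {ζ : L.H} (hζ : ζ ∈ L.orbit (space S)) :
    ∃ m : Fin k → ℕ, ∀ n, m ≤ n → ∀ v, ∀ t ∈ Λ.lePaths v n, star (L.X t) ζ ∈ space S := by
  induction hζ using Submodule.span_induction with
  | mem y hy =>
    obtain ⟨p, η, hη, rfl⟩ := hy
    refine ⟨Λ.d p, fun n hn v t ht => ?_⟩
    by_cases hex : ∃ q : KPath V, p.src = q.rng ∧ p * q = t
    -- For `t = pq` one has `X_t^* X_p = X_q^*`, under which `S` is invariant.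
    · obtain ⟨q, hq, rfl⟩ := hex
      have h1 : star (L.X (p * q)) * L.X p = star (L.X q) := by
        rw [← star_star (L.X p), ← star_mul, L.X_isCKFamily.star_mul_mul hq]
      have h2 := sub_star_mem S q hη
      rwa [← h1] at h2
    · have h1 := L.X_isCKFamily.star_mul_eq_zero_of_not_extends ht hn hex
      rw [← mul_apply_eq_comp, h1]
      exact (space S).zero_mem
  | zero => exact ⟨0, fun n _ v t _ => by rw [map_zero]; exact (space S).zero_mem⟩
  | add y z _ _ hy hz =>
    obtain ⟨m, hm⟩ := hy
    obtain ⟨m', hm'⟩ := hz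
    refine ⟨m ⊔ m', fun n hn v t ht => ?_⟩
    rw [map_add]
    exact (space S).add_mem (hm n (le_sup_left.trans hn) v t ht)
      (hm' n (le_sup_right.trans hn) v t ht)
  | smul c y _ hy =>
    obtain ⟨m, hm⟩ := hy
    refine ⟨m, fun n hn v t ht => ?_⟩
    rw [map_smul]
    exact (space S).smul_mem c (hm n hn v t ht)

/-- Quantitative form of density: vectors are approximated by `S` along `Λ^{≤ m}`. -/
theorem Generates.exists_approx {S : L.U.Sub} (hS : L.Generates (space S)) (ζ : L.H) {ε : ℝ}
    (hε : 0 < ε) : ∃ (m : Fin k → ℕ) (ζ' : L.H), ∀ v,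
      (∀ t ∈ Λ.lePaths v m, star (L.X t) ζ' ∈ space S) ∧
      ∑ t ∈ Λ.lePaths v m, ‖star (L.X t) ζ - star (L.X t) ζ'‖ ^ 2 < ε ^ 2 := by
  have hζ : ζ ∈ closure (L.orbit (space S) : Set L.H) := by
    rw [← Submodule.topologicalClosure_coe, hS]; trivial
  obtain ⟨ζ', hζ', hd⟩ := Metric.mem_closure_iff.1 hζ ε hε
  -- The degree `m` depends on `ζ'` only and serves all vertices at once.
  obtain ⟨m, hm⟩ := exists_star_mem S hζ'
  refine ⟨m, ζ', fun v => ⟨hm m le_rfl v, ?_⟩⟩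
  simp only [← map_sub]
  rw [L.X_isCKFamily.sum_norm_sq_star]
  rw [dist_eq_norm] at hd
  have h1 := L.X_isCKFamily.norm_id_le v (ζ - ζ')
  have h2 := norm_nonneg (L.X (KPath.id v) (ζ - ζ'))
  gcongr
  exact h1.trans_lt hd

/-- The trees `vΛ^{≤ m}` suffice as witnesses. -/
theorem Generates.isComplete {S : L.U.Sub} (hS : L.Generates (space S)) : S.IsComplete := by
  intro ε hε v ξ _
  obtain ⟨m, ζ', h⟩ := hS.exists_approx ξ hε
  refine ⟨Λ.pathsLE v m, fun t => star (L.X t) ζ', isTree_pathsLE v m,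
    fun t ht => (h v).1 t (mem_lePaths.2 ht), ?_⟩
  refine lt_of_eq_of_lt ?_ (h v).2
  rw [← finsum_mem_coe_finset]
  refine finsum_mem_congr ?_ fun _ _ => rfl
  ext t; simp

/-- If `S = 0`, only zero vectors are available for approximation, and the error along any tree is
exactly `‖ξ‖²`, by additivity of squared norms. Taking `ε = ‖ξ‖` gives a contradiction. -/
theorem ne_bot_of_isComplete [Nontrivial L.H] {S : L.U.Sub} (hS : S.IsComplete) :
    space S ≠ ⊥ := by
  intro hbot
  obtain ⟨ξ₀, hξ₀⟩ := exists_ne (0 : L.H)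
  obtain ⟨v, hv⟩ := exists_X_id_ne_zero hξ₀
  obtain ⟨ξ, hξ⟩ : ∃ ξ : L.U.H, ξ = L.X (KPath.id v) ξ₀ := ⟨_, rfl⟩
  have hfix : L.U.A (KPath.id v) ξ = ξ := by
    have h1 : star (L.X (KPath.id v)) * L.X (KPath.id v) = L.X (KPath.id v) :=
      L.X_isCKFamily.isom _
    rw [hξ]
    exact congrArg (fun T : L.H →L[ℂ] L.H => T ξ₀) h1
  have hξ0 : ξ ≠ 0 := fun h => hv (hξ.symm.trans h)
  obtain ⟨t, η, ht, hη, hlt⟩ := hS ‖ξ‖ (norm_pos_iff.2 hξ0) v ξ ⟨ξ, hfix⟩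
  refine hlt.ne ?_
  rw [← ht.finsum_norm_sq hfix]
  refine finsum_mem_congr rfl fun μ hμ => ?_
  have h0 : η μ = 0 := (Submodule.mem_bot (R := ℂ) (M := L.H)).1 (hbot ▸ hη μ hμ)
  rw [h0, sub_zero]

/-- The closed orbit of an `A_Λ`-submodule is invariant under `O_Λ`. -/
theorem orbit_invariant (S : L.U.Sub) (b : Λ.O) :
    ∀ ξ ∈ (L.orbit (space S)).topologicalClosure,
      L.π b ξ ∈ (L.orbit (space S)).topologicalClosure := by
  -- By continuity an operator preserves the closed orbit as soon as it maps the spanning vectors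
  -- `X_p η` into the orbit.
  have hext : ∀ T : L.H →L[ℂ] L.H,
      (∀ p : KPath V, ∀ η ∈ space S, T (L.X p η) ∈ L.orbit (space S)) →
      ∀ ξ ∈ (L.orbit (space S)).topologicalClosure,
        T ξ ∈ (L.orbit (space S)).topologicalClosure := by
    intro T hT
    have h1 : L.orbit (space S) ≤ (L.orbit (space S)).comap (T : L.H →ₗ[ℂ] L.H) := by
      refine Submodule.span_le.2 ?_
      rintro _ ⟨p, η, hη, rfl⟩
      exact hT p η hη
    exact fun ξ hξ => map_mem_closure T.continuous hξ h1
  refine invariant_of_X (Submodule.isClosed_topologicalClosure _) (fun t => hext _ ?_)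
    (fun t => hext _ ?_) b
  · intro p η hη
    by_cases htp : t.src = p.rng
    · rw [← mul_apply_eq_comp, L.X_isCKFamily.mul t p htp]
      exact X_mem_orbit _ hη
    · rw [← mul_apply_eq_comp, ← L.X_isCKFamily.mul_id_src t, ← L.X_isCKFamily.id_rng_mul p,
        mul_assoc, ← mul_assoc (L.X (KPath.id t.src)), L.X_isCKFamily.orth _ _ htp, zero_mul,
        mul_zero]
      exact Submodule.zero_mem _
  · intro p η hη
    -- Here `X_t^* X_p η = ∑ X_t^* X_{pq} X_q^* η` with `pq ∈ Λ^{≤ d(p)+d(t)}`. Either `pq = tr`,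
    -- and the term is `X_r X_q^* η` with `X_q^* η ∈ S`, or the term vanishes.
    rw [L.X_isCKFamily.mul_eq_sum p (Λ.d t), sum_apply, map_sum]
    refine Submodule.sum_mem _ fun q hq => ?_
    have hpq : p.src = q.rng := (rng_of_mem_lePaths hq).symm
    have hmem : p * q ∈ Λ.lePaths p.rng (Λ.d p + Λ.d t) :=
      mem_lePaths.2 ((mul_mem_pathsLE_iff hpq).2 (mem_lePaths.1 hq))
    rw [mul_apply_eq_comp, ← mul_apply_eq_comp]
    by_cases hex : ∃ r : KPath V, t.src = r.rng ∧ t * r = p * q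
    · obtain ⟨r, hr, heq⟩ := hex
      rw [← heq, L.X_isCKFamily.star_mul_mul hr]
      exact X_mem_orbit _ (sub_star_mem S q hη)
    · have h1 := L.X_isCKFamily.star_mul_eq_zero_of_not_extends hmem
        (le_add_of_nonneg_left fun _ => Nat.zero_le _) hex
      have h2 := congrArg star h1
      rw [star_mul, star_star, star_zero] at h2
      rw [h2]
      exact Submodule.zero_mem _

/-- There need be no single path acting as the identity; nondegeneracy presents `η` as the limit of
finite sums of the vectors `X_v η`. -/
theorem le_orbit (S : L.U.Sub) : space S ≤ (L.orbit (space S)).topologicalClosure := by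
  intro η hη
  refine mem_closure_of_tendsto (L.nondeg η) (Filter.Eventually.of_forall fun F => ?_)
  exact Submodule.sum_mem _ fun v _ => X_mem_orbit _ hη

/-! ### Cores -/

/-- A core of a representation: a nonzero finite dimensional submodule that is generating and
minimal. -/
structure IsCore (S : L.U.Sub) : Prop where
  ne_bot : space S ≠ ⊥
  finite : FiniteDimensional ℂ (space S)
  minimal : ∀ T : L.U.Sub, space T ≤ space S →
    space T = ⊥ ∨ space T = space S
  generates : L.Generates (space S)

/-- A nonzero submodule contains vectors that are almost in a given generating submodule. -/
theorem Generates.exists_unit_near {S T : L.U.Sub} (hS : L.Generates (space S))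
    (hT : space T ≠ ⊥) {ε : ℝ} (hε : 0 < ε) :
    ∃ u ∈ space T, ∃ s ∈ space S, ‖u‖ = 1 ∧ ‖u - s‖ ≤ ε := by
  obtain ⟨ζ₀, hζ₀, hne⟩ := Submodule.exists_mem_ne_zero_of_ne_bot hT
  obtain ⟨v, hv⟩ := exists_X_id_ne_zero hne
  have hpos := norm_pos_iff.2 hv
  -- The error is measured against `‖X_v ζ₀‖`, which is then redistributed as `∑ ‖X_t^* ζ₀‖²`. A
  -- strict inequality of sums yields one `t` with `‖X_t^*(ζ₀ - ζ')‖ < ε ‖X_t^* ζ₀‖`; rescaling by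
  -- `‖X_t^* ζ₀‖⁻¹` gives the required pair.
  obtain ⟨m, ζ', h⟩ := hS.exists_approx ζ₀ (mul_pos hε hpos)
  obtain ⟨hmem, hlt⟩ := h v
  rw [mul_pow, ← L.X_isCKFamily.sum_norm_sq_star v m, Finset.mul_sum] at hlt
  obtain ⟨t, ht, hlt'⟩ := Finset.exists_lt_of_sum_lt hlt
  rw [← mul_pow] at hlt'
  have hle := (lt_of_pow_lt_pow_left₀ 2 (mul_nonneg hε.le (norm_nonneg _)) hlt').le
  have hne' : star (L.X t) ζ₀ ≠ 0 := by
    intro h0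
    rw [h0] at hlt'
    simp only [norm_zero, mul_zero, ne_eq, OfNat.ofNat_ne_zero, not_false_eq_true, zero_pow] at hlt'
    exact absurd hlt' (not_lt.2 (sq_nonneg _))
  have hpos' := norm_pos_iff.2 hne'
  set c : ℂ := ((‖star (L.X t) ζ₀‖⁻¹ : ℝ) : ℂ) with hc
  have hcn : ‖c‖ = ‖star (L.X t) ζ₀‖⁻¹ := by
    rw [hc, Complex.norm_real, Real.norm_of_nonneg (inv_nonneg.2 (norm_nonneg _))]
  refine ⟨c • star (L.X t) ζ₀, (space T).smul_mem _ (sub_star_mem T t hζ₀),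
    c • star (L.X t) ζ', (space S).smul_mem _ (hmem t ht), ?_, ?_⟩
  · rw [norm_smul, hcn, inv_mul_cancel₀ hpos'.ne']
  · rw [← smul_sub, norm_smul, hcn, inv_mul_le_iff₀ hpos', mul_comm]
    exact hle

/-- A nonzero submodule meets every finite dimensional generating submodule. -/
theorem Generates.exists_mem_inter {S T : L.U.Sub} (hS : L.Generates (space S))
    (hfin : FiniteDimensional ℂ (space S)) (hT : space T ≠ ⊥) :
    ∃ y, y ∈ space S ∧ y ∈ space T ∧ y ≠ 0 := by
  have hn : ∀ n : ℕ, (0 : ℝ) < 1 / ((n : ℝ) + 1) := fun n => Nat.one_div_pos_of_nat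
  choose w hw s hs hw1 hws using fun n : ℕ => hS.exists_unit_near hT (hn n)
  -- The radius is `2` because `‖w n‖ = 1` and the error `1/(n+1)` is at most `1`.
  have hbd : ∀ n, (⟨s n, hs n⟩ : (space S)) ∈ Metric.closedBall (0 : (space S)) 2 := by
    intro n
    rw [mem_closedBall_zero_iff, Submodule.coe_norm]
    have h1 : ‖s n‖ ≤ ‖w n‖ + ‖w n - s n‖ := by
      have := norm_sub_le (w n) (w n - s n)
      rwa [sub_sub_cancel] at this
    have h2 : 1 / ((n : ℝ) + 1) ≤ 1 := by
      rw [div_le_one (by positivity)]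
      have : (0 : ℝ) ≤ n := n.cast_nonneg
      linarith
    linarith [hws n, hw1 n]
  have hproper : ProperSpace (space S) := FiniteDimensional.proper ℂ _
  obtain ⟨y, -, φ, hφ, hlim⟩ := (isCompact_closedBall (0 : (space S)) 2).tendsto_subseq hbd
  have hlim' : Filter.Tendsto (fun n => s (φ n)) Filter.atTop (nhds (y : L.H)) :=
    (continuous_subtype_val.tendsto y).comp hlim
  have hdiff : Filter.Tendsto (fun n => w (φ n) - s (φ n)) Filter.atTop (nhds 0) := by
    refine squeeze_zero_norm (fun n => hws (φ n)) ?_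
    exact tendsto_one_div_add_atTop_nhds_zero_nat.comp hφ.tendsto_atTop
  -- The unit vectors of `T` have the same limit as their approximants in `S`, so the limit lies in
  -- both subspaces and has norm one.
  have hw' : Filter.Tendsto (fun n => w (φ n)) Filter.atTop (nhds (y : L.H)) := by
    have := hdiff.add hlim'
    simpa using this
  refine ⟨y, y.2, (isClosed_space T).mem_of_tendsto hw' (Filter.Eventually.of_forall fun n => hw _), ?_⟩
  have h1 : ‖(y : L.H)‖ = 1 := by
    refine tendsto_nhds_unique hw'.norm ?_
    simp only [hw1]
    exact tendsto_const_nhds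
  intro h0
  rw [h0, norm_zero] at h1
  exact zero_ne_one h1

/-- A core is contained in every nonzero submodule. -/
theorem IsCore.le {S T : L.U.Sub} (hS : IsCore S) (hT : space T ≠ ⊥) :
    space S ≤ space T := by
  obtain ⟨y, hyS, hyT, hy⟩ := hS.generates.exists_mem_inter hS.finite hT
  -- Minimality of the core is applied to its intersection with `T`, which has just been shown to be
  -- nonzero.
  let R : L.U.Sub := subOfStar (space S ⊓ space T)
    ((isClosed_space S).inter (isClosed_space T))
    fun p ξ hξ => ⟨sub_star_mem S p hξ.1, sub_star_mem T p hξ.2⟩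
  rcases hS.minimal R inf_le_left with h | h
  · have : y ∈ space R := ⟨hyS, hyT⟩
    rw [h, Submodule.mem_bot] at this
    exact absurd this hy
  · rw [← h]
    exact inf_le_right

theorem IsCore.nontrivial {S : L.U.Sub} (hS : IsCore S) : Nontrivial L.H := by
  obtain ⟨y, -, hy⟩ := Submodule.exists_mem_ne_zero_of_ne_bot hS.ne_bot
  exact nontrivial_of_ne y 0 hy

/-- A core lies below every complete submodule, since these are nonzero, and is itself complete,
since it generates. -/
theorem IsCore.eq_smallestComplete {S : L.U.Sub} (hS : IsCore S) :
    S = L.U.smallestComplete := by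
  have := hS.nontrivial
  refine space_injective (le_antisymm ?_ ?_)
  · exact le_iInf fun T => hS.le (ne_bot_of_isComplete T.2)
  · exact iInf_le (fun T : {S : L.U.Sub // S.IsComplete} => T.1.toSubmodule)
      ⟨S, hS.generates.isComplete⟩

/-- A nonzero closed `O_Λ`-invariant subspace is in particular a submodule of `U(L)`, so it contains
the core and with it the dense orbit of the core. -/
theorem IsCore.irreducible {S : L.U.Sub} (hS : IsCore S) : L.Irreducible := by
  refine ⟨hS.nontrivial, fun T hT hinv => ?_⟩
  by_cases hbot : T = ⊥
  · exact Or.inl hbot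
  · right
    let R : L.U.Sub := subOfStar T hT fun p ξ hξ => by
      have := hinv (star (Λ.x p)) ξ hξ
      rwa [map_star] at this
    have hle : space S ≤ T := hS.le (T := R) hbot
    rw [eq_top_iff, ← hS.generates]
    refine Submodule.topologicalClosure_minimal _ (Submodule.span_le.2 ?_) hT
    rintro _ ⟨p, η, hη, rfl⟩
    exact hinv _ _ (hle hη)

/-- An irreducible representation with a nonzero finite dimensional submodule has a core. -/
theorem Irreducible.exists_isCore (hL : L.Irreducible) {R : L.U.Sub} (hR : space R ≠ ⊥)
    (hfin : FiniteDimensional ℂ (space R)) : ∃ S : L.U.Sub, IsCore S := by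
  classical
  -- The core is a nonzero submodule of least finite dimension. Minimality is then automatic, and
  -- irreducibility of `L` makes it generating.
  have hex : ∃ n : ℕ, ∃ S : L.U.Sub, space S ≠ ⊥ ∧ FiniteDimensional ℂ (space S) ∧
      Module.finrank ℂ (space S) = n := ⟨_, R, hR, hfin, rfl⟩
  obtain ⟨S, hS, hSfin, hSn⟩ := Nat.find_spec hex
  refine ⟨S, hS, hSfin, fun T hT => ?_, ?_⟩
  · by_cases hbot : space T = ⊥
    · exact Or.inl hbot
    · right
      refine Submodule.eq_of_le_of_finrank_le hT ?_
      rw [hSn]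
      exact Nat.find_min' hex ⟨T, hbot, Submodule.finiteDimensional_of_le hT, rfl⟩
  · refine (hL.2 _ (Submodule.isClosed_topologicalClosure _) (orbit_invariant S)).resolve_left ?_
    intro h
    exact hS (le_bot_iff.1 (h ▸ le_orbit S))

/-- Submodules of the core are finite-dimensional, hence closed in `L`, so minimality within `U(L)`
applies to them. -/
theorem IsCore.restrict_irreducible {S : L.U.Sub} (hS : IsCore S) :
    (L.U.restrict S).Irreducible := by
  refine ⟨Submodule.nontrivial_iff_ne_bot.2 hS.ne_bot, fun T => ?_⟩
  have := hS.finite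
  let T' : Submodule ℂ (space S) := T.toSubmodule
  let R : L.U.Sub := subOfStar (T'.map (space S).subtype)
    (Submodule.closed_of_finiteDimensional _) fun p ξ hξ => by
      obtain ⟨η, hη, rfl⟩ := hξ
      exact ⟨_, T.invariant (Λ.a p) η hη, rfl⟩
  rcases hS.minimal R (Submodule.map_subtype_le _ _) with h | h
  · left
    exact Submodule.map_injective_of_injective (space S).injective_subtype
      (h.trans (Submodule.map_bot _).symm)
  · right
    refine (Submodule.eq_top_iff' (p := T')).2 fun y => ?_
    have hy : (y : L.H) ∈ space R := by rw [h]; exact y.2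
    obtain ⟨z, hz, hzy⟩ := hy
    exact (Subtype.ext hzy : z = y) ▸ hz

end ORep

end KGraph

namespace KGraph

variable {k : ℕ} {V : Type u} [SmallCategory V] {Λ : KGraph k V} [Λ.RowFinite] [Λ.LocallyConvex]

theorem norm_sum_sq_of_orthogonal {ι H : Type*} [NormedAddCommGroup H] [InnerProductSpace ℂ H]
    (s : Finset ι) (y : ι → H) (h : ∀ i ∈ s, ∀ j ∈ s, i ≠ j → (inner ℂ (y i) (y j) : ℂ) = 0) :
    ‖∑ i ∈ s, y i‖ ^ 2 = ∑ i ∈ s, ‖y i‖ ^ 2 := by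
  classical
  have h1 : (inner ℂ (∑ i ∈ s, y i) (∑ i ∈ s, y i) : ℂ) = ∑ i ∈ s, inner ℂ (y i) (y i) := by
    rw [sum_inner]
    refine Finset.sum_congr rfl fun i hi => ?_
    rw [inner_sum, Finset.sum_eq_single_of_mem i hi fun j hj hne => h i hi j hj hne.symm]
  simp only [inner_self_eq_norm_sq_to_K] at h1
  exact_mod_cast h1

namespace AModule

variable {M : Λ.AModule} {L : Λ.ORep}

/-! ### Extending intertwiners to `Π(H)` -/

/-- The coordinate at `t` lies in `H_{s(t)}`; for this reason `X_t` is isometric on its image under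
an intertwiner. -/
theorem A_src_coord (t : KPath V) (f : M.Pre) :
    M.A (KPath.id t.src) (M.coord t f) = M.coord t f := by
  induction f using pre_induction with
  | h0 => simp
  | ha f g hf hg => rw [map_add, map_add, hf, hg]
  | hs p ξ => rw [coord_single, A_src_ext]

open Classical in
theorem norm_sq_eq_sum {S : Finset V} {m : Fin k → ℕ} {f : M.Pre} (hf : f ∈ M.good S m) :
    ‖f‖ ^ 2 = ∑ t ∈ S.biUnion fun v => Λ.lePaths v m, ‖M.coord t f‖ ^ 2 := by
  have h : (inner ℂ f f : ℂ) = ∑ t ∈ S.biUnion fun v => Λ.lePaths v m,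
      inner ℂ (M.coord t f) (M.coord t f) := form_eq hf hf
  simp only [inner_self_eq_norm_sq_to_K] at h
  exact_mod_cast h

/-- The map `(λ, ξ) ↦ X_λ (j ξ)` on `L^{00}`. -/
def preMap (j : M.H →L[ℂ] L.H) : M.Pre →ₗ[ℂ] L.H :=
  Finsupp.lsum (M := M.H) ℂ fun p => ((L.X p).comp j : M.H →ₗ[ℂ] L.H)

theorem preMap_single (j : M.H →L[ℂ] L.H) (p : KPath V) (ξ : M.H) :
    preMap j (M.single p ξ) = L.X p (j ξ) :=
  Finsupp.sum_single_index (h := fun p ξ => L.X p (j ξ)) (by simp)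

section Extension

variable {j : M.H →L[ℂ] L.H} (hj : ∀ p ξ, j (M.A p ξ) = star (L.X p) (j ξ))

include hj

-- Each generator `(p, ξ)` is expanded to the common level `Λ^{≤ m}`: there `X_p j(ξ) = ∑ X_{pq}
-- X_q^* j(ξ)` and `X_q^* j(ξ) = j(A_q ξ)`, which are the images of the coordinates. The map thus
-- acts coordinatewise by `j`.
open Classical in
theorem preMap_eq {S : Finset V} {m : Fin k → ℕ} {f : M.Pre} (hf : f ∈ M.good S m) :
    preMap j f = ∑ t ∈ S.biUnion fun v => Λ.lePaths v m, L.X t (j (M.coord t f)) := by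
  have hf' := (Finsupp.mem_supported (M := M.H) ℂ f).1 hf
  have hc : ∀ t : KPath V, M.coord t f =
      ∑ p ∈ Finsupp.support (M := M.H) f, M.ext p t (DFunLike.coe (F := KPath V →₀ M.H) f p) :=
    fun t => rfl
  simp only [hc, map_sum]
  rw [Finset.sum_comm]
  change ∑ p ∈ Finsupp.support (M := M.H) f, L.X p (j (DFunLike.coe (F := KPath V →₀ M.H) f p)) = _
  refine Finset.sum_congr rfl fun p hp => ?_
  generalize DFunLike.coe (F := KPath V →₀ M.H) f p = ξ
  obtain ⟨hpS, hpm⟩ := hf' hp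
  have hzero : ∀ t, (¬ ∃ q : KPath V, p.src = q.rng ∧ p * q = t) →
      L.X t (j (M.ext p t ξ)) = 0 := fun t ht => by rw [ext_eq_zero ht]; simp
  -- Paths whose range is not `r(p)` do not extend `p` and contribute nothing.
  have h1 : ∑ t ∈ Λ.lePaths p.rng m, L.X t (j (M.ext p t ξ)) =
      ∑ t ∈ S.biUnion fun v => Λ.lePaths v m, L.X t (j (M.ext p t ξ)) := by
    refine Finset.sum_subset (fun t ht => Finset.mem_biUnion.2 ⟨p.rng, hpS, ht⟩)
      fun t ht ht' => hzero t ?_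
    rintro ⟨q, hq, rfl⟩
    obtain ⟨v, -, htv⟩ := Finset.mem_biUnion.1 ht
    obtain rfl : p.rng = v := (KPath.rng_mul hq).symm.trans (rng_of_mem_lePaths htv)
    exact ht' htv
  rw [← h1, sum_lePaths_extending hpm fun t _ ht => hzero t ht]
  conv_lhs => rw [L.X_isCKFamily.mul_eq_sum p (m - Λ.d p), sum_apply]
  refine Finset.sum_congr rfl fun q hq => ?_
  rw [mul_apply_eq_comp, ← hj, ext_mul (rng_of_mem_lePaths hq).symm]

-- The summands are orthogonal, having ranges of distinct paths of `Λ^{≤ m}`, and each `X_t`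
-- preserves the norm of the vector it meets. Comparison with `norm_sq_eq_sum` then transfers any
-- bound for `j`, above or below, to the extension.
open Classical in
theorem norm_preMap_sq {S : Finset V} {m : Fin k → ℕ} {f : M.Pre} (hf : f ∈ M.good S m) :
    ‖preMap j f‖ ^ 2 = ∑ t ∈ S.biUnion fun v => Λ.lePaths v m, ‖j (M.coord t f)‖ ^ 2 := by
  rw [preMap_eq hj hf, norm_sum_sq_of_orthogonal]
  · refine Finset.sum_congr rfl fun t _ => ?_
    rw [L.X_isCKFamily.norm_apply_sq,
      ← (L.X_isCKFamily.proj t.src).isSelfAdjoint.star_eq, ← hj, A_src_coord]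
  · intro t ht t' ht' hne
    obtain ⟨v, -, hv⟩ := Finset.mem_biUnion.1 ht
    obtain ⟨v', -, hv'⟩ := Finset.mem_biUnion.1 ht'
    rw [← ContinuousLinearMap.adjoint_inner_right, ← ContinuousLinearMap.star_eq_adjoint,
      ← mul_apply_eq_comp, L.X_isCKFamily.star_mul_eq_zero_of_ne hv hv' hne, zero_apply,
      inner_zero_right]

theorem norm_preMap_le (f : M.Pre) : ‖preMap j f‖ ≤ ‖j‖ * ‖f‖ := by
  obtain ⟨S, m, hf⟩ := exists_good f
  refine (pow_le_pow_iff_left₀ (norm_nonneg _) (by positivity) two_ne_zero).1 ?_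
  rw [mul_pow, norm_preMap_sq hj hf, norm_sq_eq_sum hf, Finset.mul_sum]
  refine Finset.sum_le_sum fun t _ => ?_
  rw [← mul_pow]
  gcongr
  exact j.le_opNorm _

theorem le_norm_preMap {C : ℝ} (hC : 0 ≤ C) (hlow : ∀ ξ, ‖ξ‖ ≤ C * ‖j ξ‖) (f : M.Pre) :
    ‖f‖ ≤ C * ‖preMap j f‖ := by
  obtain ⟨S, m, hf⟩ := exists_good f
  refine (pow_le_pow_iff_left₀ (norm_nonneg _) (by positivity) two_ne_zero).1 ?_
  rw [mul_pow, norm_preMap_sq hj hf, norm_sq_eq_sum hf, Finset.mul_sum]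
  refine Finset.sum_le_sum fun t _ => ?_
  rw [← mul_pow]
  gcongr
  exact hlow _

open UniformSpace (Completion)

/-- An intertwiner from `H` to a representation `L` extends to `Π(H)`. -/
theorem exists_extension : ∃ T : M.Lift →L[ℂ] L.H,
    (∀ f : M.Pre, T (f : M.Lift) = preMap j f) ∧
    (∀ p x, T (M.liftX p x) = L.X p (T x)) := by
  let T : M.Lift →L[ℂ] L.H := ((preMap j).mkContinuous ‖j‖ (norm_preMap_le hj)).extend
    (Completion.toComplL : M.Pre →L[ℂ] M.Lift)
  have hT : ∀ f : M.Pre, T (f : M.Lift) = preMap j f := fun f =>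
    ContinuousLinearMap.extend_eq (e := (Completion.toComplL : M.Pre →L[ℂ] M.Lift)) _
      Completion.denseRange_coe (Completion.isUniformInducing_coe M.Pre) f
  refine ⟨T, hT, fun p x => ?_⟩
  induction x using Completion.induction_on with
  | hp => exact isClosed_eq (by fun_prop) (by fun_prop)
  | ih f =>
    rw [liftX_coe, hT, hT]
    induction f using pre_induction with
    | h0 => simp
    | ha f g hf hg => rw [map_add, map_add, map_add, map_add, hf, hg]
    | hs q ξ =>
      by_cases hpq : p.src = q.rng
      · rw [preX_single hpq, preMap_single, preMap_single, ← L.X_isCKFamily.mul p q hpq,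
          mul_apply_eq_comp]
      · rw [preX_single' hpq, map_zero, preMap_single, ← mul_apply_eq_comp,
          ← L.X_isCKFamily.mul_id_src p, ← L.X_isCKFamily.id_rng_mul q, mul_assoc,
          ← mul_assoc (L.X (KPath.id p.src)), L.X_isCKFamily.orth _ _ hpq, zero_mul, mul_zero,
          zero_apply]

/-- A finite dimensional module that embeds into a representation as a generating subspace
determines the representation. -/
theorem pi_iso_of_generates [FiniteDimensional ℂ M.H] (hinj : Function.Injective j)
    (hgen : L.Generates (LinearMap.range (j : M.H →ₗ[ℂ] L.H))) : M.Pi.Iso L := by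
  -- Finite dimension enters here: an injective `j` is bounded below, and `K` is the constant
  -- inherited by the extension `T`.
  obtain ⟨K, -, hK⟩ := (LinearMap.injective_iff_antilipschitz (j : M.H →ₗ[ℂ] L.H)).1 hinj
  have hlow : ∀ ξ, ‖ξ‖ ≤ K * ‖j ξ‖ := fun ξ => by
    have := hK.le_mul_dist ξ 0
    simpa using this
  obtain ⟨T, hT, hTX⟩ := exists_extension hj
  have hTlow : ∀ x, ‖x‖ ≤ K * ‖T x‖ := fun x => by
    induction x using Completion.induction_on with
    | hp => exact isClosed_le (by fun_prop) (by fun_prop)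
    | ih f => rw [Completion.norm_coe, hT]; exact le_norm_preMap hj K.2 hlow f
  have hanti := T.antilipschitz_of_bound hTlow
  -- The range is closed because `T` is bounded below, and it contains the dense orbit of `j(M)`.
  have hrange : LinearMap.range (T : M.Lift →ₗ[ℂ] L.H) = ⊤ := by
    rw [eq_top_iff, ← hgen]
    refine Submodule.topologicalClosure_minimal _ (Submodule.span_le.2 ?_)
      (hanti.isClosed_range T.uniformContinuous)
    rintro _ ⟨p, _, ⟨ξ, rfl⟩, rfl⟩
    exact ⟨M.cls p ξ, (hT _).trans (preMap_single j p ξ)⟩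
  let θ := ContinuousLinearEquiv.ofBijective T (LinearMap.ker_eq_bot.2 hanti.injective) hrange
  exact ⟨θ, ORep.intertwine_of_X (L := M.Pi) (L' := L) (θ := T) hTX
    (M.liftX_isCKFamily.intertwine_star L.X_isCKFamily hTX)⟩

end Extension

/-! ### The canonical embedding of a finite dimensional module -/

open UniformSpace (Completion)

theorem cls_inner_ext {x y : M.Lift}
    (h : ∀ p ξ, (inner ℂ x (M.cls p ξ) : ℂ) = inner ℂ y (M.cls p ξ)) : x = y := by
  refine ext_inner_right ℂ fun z => ?_
  induction z using Completion.induction_on with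
  | hp => exact isClosed_eq (by fun_prop) (by fun_prop)
  | ih f =>
    induction f using pre_induction with
    | h0 => rw [Completion.coe_zero, inner_zero_right, inner_zero_right]
    | ha f g hf hg => rw [Completion.coe_add, inner_add_right, inner_add_right, hf, hg]
    | hs p ξ => exact h p ξ

theorem inner_cls (p q : KPath V) (ξ η : M.H) :
    (inner ℂ (M.cls p ξ) (M.cls q η) : ℂ) = M.pair p ξ q η := by
  rw [cls, cls, Completion.inner_coe, inner_single]

/-- A vertex has degree zero, so the form may be computed over `Λ^{≤ d(q)}`, where the only
extension of `q` is `q` itself. -/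
theorem pair_id (q : KPath V) (ξ η : M.H) :
    M.pair (KPath.id q.rng) ξ q η = inner ℂ (M.A q ξ) (M.A (KPath.id q.src) η) := by
  have hq : q ∈ Λ.lePaths q.rng (Λ.d q) := mem_lePaths.2 (mem_pathsLE_self q)
  rw [pair_eq (m := Λ.d q) (by rw [d_id]; exact fun _ => Nat.zero_le _) le_rfl, KPath.id_rng,
    Finset.sum_eq_single_of_mem q hq]
  · have h1 : M.ext (KPath.id q.rng) q = M.A q := by
      have := ext_mul (M := M) (p := KPath.id q.rng) (q := q) rfl
      rwa [KPath.id_mul rfl] at this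
    have h2 : M.ext q q = M.A (KPath.id q.src) := by
      have := ext_mul (M := M) (p := q) (q := KPath.id q.src) rfl
      rwa [KPath.mul_id rfl] at this
    rw [h1, h2]
  · intro t ht hne
    rw [ext_eq_zero (p := q)]
    · simp
    · rintro ⟨r, hr, rfl⟩
      have h0 : Λ.d r = 0 := (mem_pathsLE_self (Λ := Λ) q).2.2 r hr (mem_lePaths.1 ht).2.1
      refine hne ?_
      rw [eq_id_of_d_eq_zero h0, ← hr]
      exact KPath.mul_id rfl

theorem pair_of_rng_ne {p q : KPath V} (h : p.rng ≠ q.rng) (ξ η : M.H) :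
    M.pair p ξ q η = 0 := by
  refine pair_eq_zero (fun a b ha hb hab => h ?_) ξ η
  have := congrArg KPath.rng hab
  rwa [KPath.rng_mul ha, KPath.rng_mul hb] at this

theorem cls_zero (p : KPath V) : M.cls p 0 = 0 := by
  rw [cls, map_zero, Completion.coe_zero]

/-- `X_μ^* [r(μ), ξ] = [s(μ), A_μ ξ]`. -/
theorem star_liftX_cls_id (μ : KPath V) (ξ : M.H) :
    star (M.liftX μ) (M.cls (KPath.id μ.rng) ξ) = M.cls (KPath.id μ.src) (M.A μ ξ) := by
  refine cls_inner_ext fun q η => ?_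
  rw [ContinuousLinearMap.star_eq_adjoint, ContinuousLinearMap.adjoint_inner_left, inner_cls]
  by_cases hq : μ.src = q.rng
  · have h := pair_id (M := M) (μ * q) ξ η
    rw [KPath.rng_mul hq, KPath.src_mul hq] at h
    rw [liftX_cls hq, inner_cls, h, hq, pair_id, A_mul hq]
  · rw [liftX_cls' hq, inner_zero_right, pair_of_rng_ne hq]

theorem star_liftX_cls_id_of_ne {μ : KPath V} {v : V} (h : v ≠ μ.rng) (ξ : M.H) :
    star (M.liftX μ) (M.cls (KPath.id v) ξ) = 0 := by
  refine cls_inner_ext fun q η => ?_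
  rw [ContinuousLinearMap.star_eq_adjoint, ContinuousLinearMap.adjoint_inner_left, inner_zero_left]
  by_cases hq : μ.src = q.rng
  · rw [liftX_cls hq, inner_cls, pair_of_rng_ne]
    rw [KPath.rng_mul hq]
    exact h
  · rw [liftX_cls' hq, inner_zero_right]

/-- Only the component of `ξ` in `H_v` matters for the class `[v, ξ]`; this allows the projections
to be left out in the embedding below. -/
theorem cls_id_A (v : V) (ξ : M.H) :
    M.cls (KPath.id v) (M.A (KPath.id v) ξ) = M.cls (KPath.id v) ξ := by
  have h := star_liftX_cls_id (M := M) (KPath.id v) ξ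
  rw [(liftX_proj v).isSelfAdjoint.star_eq, KPath.id_rng,
    liftX_id_cls (v := v) (p := KPath.id v) rfl] at h
  exact h.symm

theorem A_id_eq_zero_of_cls {v : V} {ξ : M.H} (h : M.cls (KPath.id v) ξ = 0) :
    M.A (KPath.id v) ξ = 0 := by
  have h1 := pair_id (M := M) (KPath.id v) ξ ξ
  rw [KPath.id_rng, KPath.id_src, ← inner_cls, h, inner_zero_left] at h1
  exact inner_self_eq_zero.1 h1.symm

theorem eq_zero_of_A_id {ξ : M.H} (h : ∀ v, M.A (KPath.id v) ξ = 0) : ξ = 0 := by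
  have h1 := M.nondeg ξ ξ
  change HasSum (fun v => inner ℂ ξ (M.A (KPath.id v) ξ)) _ at h1
  simp only [h, inner_zero_right] at h1
  exact inner_self_eq_zero.1 (h1.unique hasSum_zero)

/-- The vertex projections of a finite dimensional module are zero up to finitely many. -/
theorem finite_vertices (M : Λ.AModule) [FiniteDimensional ℂ M.H] :
    {v : V | M.A (KPath.id v) ≠ 0}.Finite := by
  have hex : ∀ v : {v : V | M.A (KPath.id v) ≠ 0}, ∃ ξ, M.A (KPath.id v.1) ξ ≠ 0 := fun v => by
    by_contra hall
    push Not at hall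
    exact v.2 (ContinuousLinearMap.ext hall)
  choose ξ hξ using hex
  -- Nonzero vectors in the ranges of mutually orthogonal projections are independent, so finite
  -- dimension bounds their number.
  have hli : LinearIndependent ℂ fun v => M.A (KPath.id v.1) (ξ v) := by
    refine linearIndependent_of_ne_zero_of_inner_eq_zero hξ fun v w hvw => ?_
    change inner ℂ (M.A (KPath.id v.1) (ξ v)) (M.A (KPath.id w.1) (ξ w)) = 0
    rw [← ContinuousLinearMap.adjoint_inner_right, ← ContinuousLinearMap.star_eq_adjoint,
      (M.A_isPyFamily.proj v.1).isSelfAdjoint.star_eq, ← mul_apply_eq_comp,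
      M.A_isPyFamily.orth _ _ fun h => hvw (Subtype.ext h), zero_apply, inner_zero_right]
  exact Set.finite_coe_iff.1 hli.finite

/-- The embedding `ξ ↦ ∑_v [v, A_v ξ]` of a finite dimensional module into `Π(H)`. -/
theorem exists_embedding (M : Λ.AModule) [FiniteDimensional ℂ M.H] : ∃ j : M.H →L[ℂ] M.Pi.H,
    (∀ p ξ, j (M.A p ξ) = star (M.Pi.X p) (j ξ)) ∧ Function.Injective j ∧
      M.Pi.Generates (LinearMap.range (j : M.H →ₗ[ℂ] M.Pi.H)) := by
  classical
  let F : Finset V := M.finite_vertices.toFinset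
  have hF : ∀ v, v ∉ F → M.A (KPath.id v) = 0 := fun v hv => by
    simpa [F] using hv
  -- The sum can be restricted to `F`, since `[v, ξ] = [v, A_v ξ]` vanishes outside it.
  let j₀ : M.H →ₗ[ℂ] M.Lift :=
    ∑ v ∈ F, (Completion.toComplL : M.Pre →L[ℂ] M.Lift).toLinearMap ∘ₗ M.single (KPath.id v)
  let j : M.H →L[ℂ] M.Lift := LinearMap.toContinuousLinearMap j₀
  have hj : ∀ ξ, j ξ = ∑ v ∈ F, M.cls (KPath.id v) ξ := fun ξ => by
    change j₀ ξ = _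
    rw [LinearMap.sum_apply]
    rfl
  have hjA : ∀ p ξ, j (M.A p ξ) = M.cls (KPath.id p.src) (M.A p ξ) := fun p ξ => by
    have hsrc : M.A (KPath.id p.src) (M.A p ξ) = M.A p ξ := by rw [A_mul rfl, KPath.mul_id rfl]
    rw [hj]
    refine Finset.sum_eq_single _ (fun v _ hv => ?_) fun hv => ?_
    · rw [← cls_id_A, ← hsrc, ← mul_apply_eq_comp, M.A_isPyFamily.orth _ _ hv, zero_apply, cls_zero]
    · rw [← cls_id_A, hF _ hv, zero_apply, cls_zero]
  have hint : ∀ p ξ, j (M.A p ξ) = star (M.liftX p) (j ξ) := fun p ξ => by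
    rw [hjA, hj, map_sum, ← star_liftX_cls_id]
    symm
    refine Finset.sum_eq_single _ (fun v _ hv => star_liftX_cls_id_of_ne hv ξ) fun hv => ?_
    rw [← cls_id_A, hF _ hv, zero_apply, cls_zero, map_zero]
  refine ⟨j, hint, ?_, ?_⟩
  · refine (injective_iff_map_eq_zero j).2 fun ξ h0 => eq_zero_of_A_id fun v => ?_
    refine A_id_eq_zero_of_cls ?_
    have h1 := hint (KPath.id v) ξ
    rw [h0, map_zero, hjA] at h1
    rwa [← cls_id_A]
  · have hmem : ∀ f : M.Pre, (f : M.Lift) ∈ M.Pi.orbit (LinearMap.range (j : M.H →ₗ[ℂ] M.Lift)) := by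
      intro f
      induction f using pre_induction with
      | h0 => rw [Completion.coe_zero]; exact Submodule.zero_mem _
      | ha f g hf hg => rw [Completion.coe_add]; exact Submodule.add_mem _ hf hg
      | hs p ξ =>
        -- All classes `[p, ξ]` arise as `X_p` applied to the image of `A_{s(p)} ξ`, so the orbit
        -- contains the dense image of `L^{00}`.
        have h1 : M.liftX p (j (M.A (KPath.id p.src) ξ)) = M.cls p ξ := by
          rw [hjA, KPath.id_src, cls_id_A, liftX_cls rfl, KPath.mul_id rfl]
        have h2 := ORep.X_mem_orbit (L := M.Pi)
          (S := LinearMap.range (j : M.H →ₗ[ℂ] M.Lift)) p ⟨M.A (KPath.id p.src) ξ, rfl⟩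
        change M.cls p ξ ∈ _
        rw [← h1]
        exact h2
    refine (Submodule.dense_iff_topologicalClosure_eq_top (M := M.Pi.H)).1 ?_
    refine Dense.mono ?_ (Completion.denseRange_coe (α := M.Pre))
    rintro _ ⟨f, rfl⟩
    exact hmem f

/-! ### Dimension vectors -/

theorem Iso.dimVec_eq {M N : Λ.AModule} (h : M.Iso N) : M.dimVec = N.dimVec := by
  obtain ⟨θ, hθ⟩ := h
  funext v
  have hmap : (M.vertexSpace v).map (θ.toLinearEquiv : M.H →ₗ[ℂ] N.H) = N.vertexSpace v := by
    ext y
    constructor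
    · rintro ⟨_, ⟨ξ, rfl⟩, rfl⟩
      exact ⟨θ ξ, (hθ _ ξ).symm⟩
    · rintro ⟨η, rfl⟩
      refine ⟨_, ⟨θ.symm η, rfl⟩, (hθ (Λ.a (KPath.id v)) (θ.symm η)).trans ?_⟩
      rw [θ.apply_symm_apply]
      rfl
  rw [dimVec, dimVec, ← hmap, (θ.toLinearEquiv.submoduleMap (M.vertexSpace v)).rank_eq]

/-- Each `H_v` has finite dimension `δ v`, and by nondegeneracy the module is the sum of the
finitely many `H_v` with `v` in the support of `δ`. -/
theorem finiteDimensional_of_dimVec {M : Λ.AModule} {δ : V →₀ ℕ}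
    (h : M.dimVec = fun v => (δ v : ℕ∞)) : FiniteDimensional ℂ M.H := by
  classical
  have hdim : ∀ v, Cardinal.toENat (Module.rank ℂ (M.vertexSpace v)) = (δ v : ℕ∞) := congrFun h
  have hfin : ∀ v, FiniteDimensional ℂ (M.vertexSpace v) := fun v => by
    refine Module.rank_lt_aleph0_iff.1 (Cardinal.toENat_lt_top.1 ?_)
    rw [hdim]
    exact ENat.natCast_lt_top _
  have hzero : ∀ v, v ∉ δ.support → ∀ ξ, M.A (KPath.id v) ξ = 0 := fun v hv ξ => by
    have h1 := hdim v
    rw [Finsupp.notMem_support_iff.1 hv, Nat.cast_zero, Cardinal.toENat_eq_zero,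
      Submodule.rank_eq_zero] at h1
    have h2 : M.A (KPath.id v) ξ ∈ M.vertexSpace v := ⟨ξ, rfl⟩
    rwa [h1, Submodule.mem_bot] at h2
  have htop : δ.support.sup M.vertexSpace = ⊤ := by
    refine eq_top_iff.2 fun ξ _ => ?_
    have h1 : ∑ v ∈ δ.support, M.A (KPath.id v) ξ = ξ := by
      refine ext_inner_left ℂ fun η => ?_
      rw [inner_sum]
      refine (hasSum_sum_of_ne_finset_zero fun v hv => ?_).unique (M.nondeg ξ η)
      rw [hzero v hv, inner_zero_right]
    rw [← h1]
    exact Submodule.sum_mem _ fun v hv =>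
      (Finset.le_sup (f := M.vertexSpace) hv) ⟨ξ, rfl⟩
  have := Submodule.finiteDimensional_finset_sup δ.support M.vertexSpace
  rw [htop] at this
  exact Module.finite_def.2 (Module.Finite.iff_fg.1 this)

/-! ### Comparison of modules with cores -/

section Core

variable [FiniteDimensional ℂ M.H] {j : M.H →L[ℂ] L.H}
  (hj : ∀ p ξ, j (M.A p ξ) = star (L.X p) (j ξ))

/-- The range of an intertwiner, as a submodule. -/
def rangeSub : L.U.Sub :=
  ORep.subOfStar (LinearMap.range (j : M.H →ₗ[ℂ] L.H)) (Submodule.closed_of_finiteDimensional _)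
    fun p ξ hξ => by
      obtain ⟨η, rfl⟩ := hξ
      exact ⟨M.A p η, hj p η⟩

/-- Minimality is irreducibility of `M` transported along `j`: a submodule inside the range is the
image of its preimage, which is a submodule of `M`. -/
theorem isCore_rangeSub (hM : M.Irreducible) (hinj : Function.Injective j)
    (hgen : L.Generates (LinearMap.range (j : M.H →ₗ[ℂ] L.H))) :
    ORep.IsCore (rangeSub hj) where
  ne_bot := by
    obtain ⟨ξ, hξ⟩ := (nontrivial_iff_exists_ne (0 : M.H)).1 hM.1
    intro h
    have h1 : j ξ ∈ ORep.space (rangeSub hj) := ⟨ξ, rfl⟩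
    rw [h, Submodule.mem_bot] at h1
    exact hξ (hinj (h1.trans (map_zero j).symm))
  finite := inferInstanceAs (FiniteDimensional ℂ (LinearMap.range (j : M.H →ₗ[ℂ] L.H)))
  minimal T hT := by
    let R : M.Sub := Sub.ofA ((ORep.space T).comap (j : M.H →ₗ[ℂ] L.H))
      ((ORep.isClosed_space T).preimage j.continuous) fun p ξ hξ => by
        change j (M.A p ξ) ∈ ORep.space T
        rw [hj]
        exact ORep.sub_star_mem T p hξ
    have hR : ∀ ξ, j ξ ∈ ORep.space T ↔ ξ ∈ R.toSubmodule := fun ξ => Iff.rfl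
    rcases hM.2 R with h | h
    · left
      refine (Submodule.eq_bot_iff _).2 fun y hy => ?_
      obtain ⟨ξ, rfl⟩ := hT hy
      have h1 := (hR ξ).1 hy
      rw [h, Submodule.mem_bot] at h1
      rw [h1, map_zero]
    · right
      refine le_antisymm hT ?_
      rintro _ ⟨ξ, rfl⟩
      exact (hR ξ).2 (h ▸ Submodule.mem_top)
  generates := hgen

theorem iso_restrict_rangeSub (hinj : Function.Injective j) :
    M.Iso (L.U.restrict (rangeSub hj)) := by
  let θ := (LinearEquiv.ofInjective (j : M.H →ₗ[ℂ] L.H) hinj).toContinuousLinearEquiv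
  refine ⟨θ, intertwine_of_A (N := L.U.restrict (rangeSub hj))
    (θ := (θ : M.H →L[ℂ] LinearMap.range (j : M.H →ₗ[ℂ] L.H))) fun p ξ => Subtype.ext (hj p ξ)⟩

-- The tool for recognising `Σ(L)`: any irreducible finite-dimensional module sitting in `L` as a
-- generating subspace is a core, and the core is unique.
include hj in
theorem iso_sigma (hM : M.Irreducible) (hinj : Function.Injective j)
    (hgen : L.Generates (LinearMap.range (j : M.H →ₗ[ℂ] L.H))) : M.Iso L.Sigma := by
  rw [ORep.Sigma, ← (isCore_rangeSub hj hM hinj hgen).eq_smallestComplete]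
  exact iso_restrict_rangeSub hj hinj

end Core

end AModule

/-! ### Cores and the map `Σ`. -/

namespace ORep

open AModule

variable {L L' : Λ.ORep}

/-- An irreducible representation of finite Pythagorean dimension has a core. -/
theorem HasFinitePdim.exists_isCore (h : L.HasFinitePdim) (hL : L.Irreducible) :
    ∃ S : L.U.Sub, IsCore S := by
  obtain ⟨K, hK, θ, hθ⟩ := h
  obtain ⟨j, hj, -, hgen⟩ := K.exists_embedding
  let j' : K.H →L[ℂ] L.H := (θ : K.Pi.H →L[ℂ] L.H).comp j
  have hj' : ∀ p ξ, j' (K.A p ξ) = star (L.X p) (j' ξ) := fun p ξ => by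
    change θ (j _) = star (L.X p) (θ (j ξ))
    rw [hj, X, X, ← map_star, ← map_star, hθ]
  -- The module `K` need not be irreducible; only nonvanishing of its image is required. A zero
  -- image would generate only the zero subspace, yet it generates the nonzero space `L`.
  refine hL.exists_isCore (R := rangeSub hj') (fun hbot => ?_)
    (inferInstanceAs (FiniteDimensional ℂ (LinearMap.range (j' : K.H →ₗ[ℂ] L.H))))
  have h1 := hgen.map θ hθ
  have h2 : (LinearMap.range (j : K.H →ₗ[ℂ] K.Pi.H)).map (θ : K.Pi.H →ₗ[ℂ] L.H) = ⊥ := by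
    rw [← LinearMap.range_comp]
    exact hbot
  rw [h2] at h1
  have h3 : L.orbit ⊥ = ⊥ := by
    refine Submodule.span_eq_bot.2 ?_
    rintro _ ⟨p, η, hη, rfl⟩
    rw [(Submodule.mem_bot ℂ).1 hη, map_zero]
  have := hL.1
  rw [Generates, h3, (Submodule.closed_of_finiteDimensional _).submodule_topologicalClosure_eq] at h1
  exact bot_ne_top h1

theorem IsCore.smallestComplete {S : L.U.Sub} (hS : IsCore S) : IsCore L.U.smallestComplete :=
  hS.eq_smallestComplete ▸ hS

/-- The inclusion of the core is an injective intertwiner with generating range, so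
`pi_iso_of_generates` applies to it. -/
theorem IsCore.pi_sigma_iso {S : L.U.Sub} (hS : IsCore S) : L.Sigma.Pi.Iso L := by
  have h := hS.smallestComplete
  let j : L.Sigma.H →L[ℂ] L.H := (space L.U.smallestComplete).subtypeL
  have : FiniteDimensional ℂ L.Sigma.H := h.finite
  refine pi_iso_of_generates (M := L.Sigma) (j := j) (fun p ξ => rfl) Subtype.val_injective ?_
  have hr : LinearMap.range (j : L.Sigma.H →ₗ[ℂ] L.H) = space L.U.smallestComplete :=
    Submodule.range_subtype _
  rw [hr]
  exact h.generates

theorem IsCore.sigma_irreducible {S : L.U.Sub} (hS : IsCore S) : L.Sigma.Irreducible :=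
  hS.smallestComplete.restrict_irreducible

/-- The isomorphism carries the core of `L` to a generating copy in `L'`, which `iso_sigma`
identifies with `Σ(L')`. Completeness, defined by norms, need not be transported along the possibly
non-unitary map. -/
theorem Iso.sigma (h : L.Iso L') {S : L.U.Sub} (hS : IsCore S) : L.Sigma.Iso L'.Sigma := by
  obtain ⟨θ, hθ⟩ := h
  have h := hS.smallestComplete
  let j : L.Sigma.H →L[ℂ] L'.H :=
    (θ : L.H →L[ℂ] L'.H).comp (space L.U.smallestComplete).subtypeL
  have : FiniteDimensional ℂ L.Sigma.H := h.finite
  have hj : ∀ p ξ, j (L.Sigma.A p ξ) = star (L'.X p) (j ξ) := fun p ξ => by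
    have h1 := hθ (star (Λ.x p)) ((space L.U.smallestComplete).subtypeL ξ)
    rw [map_star, map_star] at h1
    exact h1
  refine iso_sigma hj hS.sigma_irreducible (θ.injective.comp Subtype.val_injective) ?_
  have hr : LinearMap.range (j : L.Sigma.H →ₗ[ℂ] L'.H) =
      (space L.U.smallestComplete).map (θ : L.H →ₗ[ℂ] L'.H) := by
    refine (LinearMap.range_comp _ _).trans ?_
    exact congrArg _ (Submodule.range_subtype _)
  rw [hr]
  exact h.generates.map θ hθ

end ORep

/-! ### Finite-dimensional modules and the map `Π`. -/

namespace AModule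

variable {M N : Λ.AModule}

theorem Irreducible.exists_isCore_pi [FiniteDimensional ℂ M.H] (hM : M.Irreducible) :
    ∃ S : M.Pi.U.Sub, ORep.IsCore S := by
  obtain ⟨j, hj, hinj, hgen⟩ := M.exists_embedding
  exact ⟨_, isCore_rangeSub hj hM hinj hgen⟩

theorem Irreducible.iso_sigma_pi [FiniteDimensional ℂ M.H] (hM : M.Irreducible) :
    M.Iso M.Pi.Sigma := by
  obtain ⟨j, hj, hinj, hgen⟩ := M.exists_embedding
  exact iso_sigma hj hM hinj hgen

/-- Composing the isomorphism with the embedding of `N` in `Π(N)` embeds `M` with the same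
generating range, so `Π(N)` is also a model of `Π(M)`. -/
theorem Iso.pi [FiniteDimensional ℂ N.H] (h : M.Iso N) : M.Pi.Iso N.Pi := by
  obtain ⟨θ, hθ⟩ := h
  obtain ⟨j, hj, hinj, hgen⟩ := N.exists_embedding
  have : FiniteDimensional ℂ M.H := θ.symm.toLinearEquiv.finiteDimensional
  refine pi_iso_of_generates (j := j.comp (θ : M.H →L[ℂ] N.H)) (fun p ξ => ?_)
    (hinj.comp θ.injective) ?_
  · exact (congrArg j (hθ (Λ.a p) ξ)).trans (hj p (θ ξ))
  · have hr : LinearMap.range ((j.comp (θ : M.H →L[ℂ] N.H) : M.H →L[ℂ] N.Pi.H) : M.H →ₗ[ℂ] N.Pi.H)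
        = LinearMap.range (j : N.H →ₗ[ℂ] N.Pi.H) :=
      LinearMap.range_comp_of_range_eq_top _ (LinearMap.range_eq_top.2 θ.surjective)
    rw [hr]
    exact hgen

end AModule

end KGraph

end

/-! ### The correspondence of isomorphism classes. -/

theorem mainTheorem5 {k : ℕ} {V : Type u} [CategoryTheory.SmallCategory V] (Λ : KGraph k V)
    [Λ.RowFinite] [Λ.LocallyConvex] (δ : V →₀ ℕ) :
    (∀ L : Λ.IrrRep (fun v => (δ v : ℕ∞)), L.1.U.smallestComplete.IsComplete) ∧
    ∃ (hPi : ∀ M : Λ.IrrMod (fun v => (δ v : ℕ∞)),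
        M.1.Pi.Irreducible ∧ M.1.Pi.HasPdimVec (fun v => (δ v : ℕ∞)))
      (hSigma : ∀ L : Λ.IrrRep (fun v => (δ v : ℕ∞)),
        L.1.Sigma.Irreducible ∧ L.1.Sigma.dimVec = fun v => (δ v : ℕ∞))
      (Φ : Λ.IrrModClasses (fun v => (δ v : ℕ∞)) ≃ Λ.IrrRepClasses (fun v => (δ v : ℕ∞))),
      (∀ M : Λ.IrrMod (fun v => (δ v : ℕ∞)), Φ ⟦M⟧ = ⟦⟨M.1.Pi, hPi M⟩⟧) ∧
      (∀ L : Λ.IrrRep (fun v => (δ v : ℕ∞)), Φ.symm ⟦L⟧ = ⟦⟨L.1.Sigma, hSigma L⟩⟧) := by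
  have hcore : ∀ L : Λ.IrrRep (fun v => (δ v : ℕ∞)), ∃ S : L.1.U.Sub, KGraph.ORep.IsCore S :=
    fun L => L.2.2.1.exists_isCore L.2.1
  have hfin : ∀ M : Λ.IrrMod (fun v => (δ v : ℕ∞)), FiniteDimensional ℂ M.1.H :=
    fun M => KGraph.AModule.finiteDimensional_of_dimVec M.2.2
  have hPi : ∀ M : Λ.IrrMod (fun v => (δ v : ℕ∞)),
      M.1.Pi.Irreducible ∧ M.1.Pi.HasPdimVec (fun v => (δ v : ℕ∞)) := fun M => by
    have := hfin M
    obtain ⟨S, hS⟩ := M.2.1.exists_isCore_pi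
    -- The module itself witnesses finite Pythagorean dimension, and `M ≅ Σ(Π(M))` identifies the
    -- dimension vectors.
    exact ⟨hS.irreducible, ⟨M.1, hfin M, KGraph.ORep.iso_equivalence.refl _⟩,
      M.2.1.iso_sigma_pi.dimVec_eq.symm.trans M.2.2⟩
  have hSigma : ∀ L : Λ.IrrRep (fun v => (δ v : ℕ∞)),
      L.1.Sigma.Irreducible ∧ L.1.Sigma.dimVec = fun v => (δ v : ℕ∞) := fun L => by
    obtain ⟨S, hS⟩ := hcore L
    exact ⟨hS.sigma_irreducible, L.2.2.2⟩
  refine ⟨fun L => ?_, hPi, hSigma,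
    { toFun := Quotient.map' (fun M => ⟨M.1.Pi, hPi M⟩) fun M N h => ?_
      invFun := Quotient.map' (fun L => ⟨L.1.Sigma, hSigma L⟩) fun L L' h => ?_
      left_inv := ?_
      right_inv := ?_ }, fun M => rfl, fun L => rfl⟩
  · obtain ⟨S, hS⟩ := hcore L
    exact hS.smallestComplete.generates.isComplete
  · have := hfin N
    exact KGraph.AModule.Iso.pi h
  · obtain ⟨S, hS⟩ := hcore L
    exact KGraph.ORep.Iso.sigma h hS
  -- The two inverse laws are `M ≅ Σ(Π(M))` and `Π(Σ(L)) ≅ L`, read on classes.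
  · rintro ⟨M⟩
    have := hfin M
    exact Quotient.sound (KGraph.AModule.iso_equivalence.symm M.2.1.iso_sigma_pi)
  · rintro ⟨L⟩
    obtain ⟨S, hS⟩ := hcore L
    exact Quotient.sound hS.pi_sigma_iso
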